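/- Let $k$ be a field. Paths in quivers are composed from left to right. **Gentle algebras.** A gentle algebra is a $k$-algebra isomorphic to a finite-dimensional algebra $kQ/I$, where $Q=(Q_0,Q_1,s,t)$ is a finite connected quiver, $I$ is generated by a set of paths of length two, every vertex is the source of at most two arrows and the target of at most two arrows, and for every arrow $a$ there is at most one arrow $b$ with $t(a)=s(b)$, $ab\notin I$, at most one $b$ with $t(a)=s(b)$, $ab\in I$, at most one $b$ with $t(b)=s(a)$, $ba\notin I$, and at most one $b$ with $t(b)=s(a)$, $ba\in I$. **CM-Auslander algebra.** For a finite-dimensional algebra $A$ put $A^{\mathrm{CMA}}=\big(\mathrm{End}_A(\bigoplus_G G)\big)^{\mathrm{op}}$, where $G$ runs over the isomorphism classes of indecomposable finitely generated Gorenstein-projective right $A$-modules, and endomorphisms in $\mathrm{End}_A$ are multiplied from left to right (first $f$, then $g$); thus the product of $A^{\mathrm{CMA}}$ is $f\circ g$, and $\mathrm{End}_A(A_A)^{\mathrm{op}}\cong A$. **Marked surfaces.** A marked surface $\mathbf S$ is given by finitely many oriented polygons $P_1,\dots,P_s$ ($s\geq 1$). $P_j$ has $m_j+1\geq 2$ edges: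 one boundary segment carrying one $\bullet$-marked point, and $m_j$ edges called $\circ$-arcs, numbered anticlockwise starting after the boundary segment. All the $\circ$-arcs are glued in pairs, compatibly with the orientations, such that the resulting surface is connected. Each glued $\circ$-arc is crossed by a dual $\bullet$-arc, which joins the $\bullet$-marked points of the two polygons that meet along it. We then ignore the $\circ$-arcs and replace each $\circ$-marked point (vertex of the polygons) in the interior of the surface by a boundary component without marked points. The $\bullet$-arcs cut the surface into $\bullet$-elementary polygons. Each of these is either a disc with exactly one boundary segment, or an $\infty$-elementary polygon: an annulus whose inner boundary is a component that has replaced a $\circ$-marked point and whose outer boundary consists of $\ell\geq1$ sides of $\bullet$-arcs. The algebra $A(\mathbf S)$ is $kQ/I$, where the vertices of $Q$ are the $\bullet$-arcs, the arrows are the interior angles of the $\bullet$-elementary polygons between two sides that follow each other anticlockwise, and $I$ is generated by the products of two consecutive angles of the same elementary polygon. One says that $\mathbf S$ is a marked surface $\mathbf S_A$ of the algebra $A$ if $A(\mathbf S)\cong A$. Two surfaces with marked points and arcs are called homotopic if there is an orientation-preserving homeomorphism between them which sends marked points onto marked points and arcs onto arcs, up to homotopy of arcs with fixed end points. **The surface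 $\mathbf S^{\mathrm{CMA}}$.** It is obtained from $\mathbf S$ by adding, for each $\infty$-elementary polygon with $\ell$ edges and vertices $v_1,\dots,v_\ell$ (in anticlockwise order, one for each corner of the polygon), $\ell$ new $\bullet$-marked points $w_1,\dots,w_\ell$ on its inner boundary, in the same cyclic order, and $\ell$ new $\bullet$-arcs inside the polygon, the $i$-th one joining $v_i$ to $w_i$, which cut the polygon into $\ell$ quadrilaterals, each with three arcs and one boundary segment as sides. The algebra $A(\mathbf S^{\mathrm{CMA}})$ is defined by the same recipe as $A(\mathbf S)$. **Proposition 3.2.** 1. Let $A$ be a gentle algebra. Then $A$ and $A^{\mathrm{CMA}}$ have marked surfaces, and for every marked surface $\mathbf S_A$ of $A$ and every marked surface $\mathbf S_{A^{\mathrm{CMA}}}$ of $A^{\mathrm{CMA}}$, the surface $\mathbf S_{A^{\mathrm{CMA}}}$ is homotopic to $\mathbf S_A^{\mathrm{CMA}}$. 2. For every marked surface $\mathbf S$ there is an isomorphism of $k$-algebras $A(\mathbf S)^{\mathrm{CMA}}\cong A(\mathbf S^{\mathrm{CMA}})$. -/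

import Mathlib

open scoped unitInterval DirectSum

universe u v

/-! ## Bound quivers and gentle algebras

Paths are composed from left to right: `a * b` is `a` followed by `b`, and it is zero in the path
algebra unless `t a = s b`.  -/

/-- A finite quiver `(V, E, s, t)` with a set of paths of length two:
`rel a b` says that the path `ab` is one of the generators of the ideal `I`. -/
structure BoundQuiver where
  V : Type
  E : Type
  [finV : Finite V]
  [finE : Finite E]
  s : E → V
  t : E → V
  rel : E → E → Prop
  rel_comp : ∀ a b, rel a b → t a = s b

namespace BoundQuiver

attribute [instance] BoundQuiver.finV BoundQuiver.finE

variable (k : Type u) [Field k] (Q : BoundQuiver)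

/-- The trivial path `ε_v` as a generator. -/
def triv (v : Q.V) : FreeAlgebra k (Q.V ⊕ Q.E) := FreeAlgebra.ι k (Sum.inl v)

/-- An arrow as a generator. -/
def arr (a : Q.E) : FreeAlgebra k (Q.V ⊕ Q.E) := FreeAlgebra.ι k (Sum.inr a)

/-- The defining relations of the bound quiver algebra `kQ / I` (those of the path algebra `kQ`,
and the generators of `I`). -/
inductive Relation : FreeAlgebra k (Q.V ⊕ Q.E) → FreeAlgebra k (Q.V ⊕ Q.E) → Prop
  | idem (v : Q.V) : Relation (triv k Q v * triv k Q v) (triv k Q v)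
  | orth (v w : Q.V) : v ≠ w → Relation (triv k Q v * triv k Q w) 0
  | one : Relation (∑ᶠ v, triv k Q v) 1
  | source (a : Q.E) : Relation (triv k Q (Q.s a) * arr k Q a) (arr k Q a)
  | target (a : Q.E) : Relation (arr k Q a * triv k Q (Q.t a)) (arr k Q a)
  | zero (a b : Q.E) : Q.rel a b → Relation (arr k Q a * arr k Q b) 0

/-- The bound quiver algebra `kQ / I`. -/
abbrev algebra : Type u := RingQuot (Relation k Q)

/-- The quiver is non-empty and connected. -/
def Connected : Prop :=
  Nonempty Q.V ∧ ∀ x y, Relation.EqvGen (fun x y => ∃ a, Q.s a = x ∧ Q.t a = y) x y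

/-- `(Q, I)` is a gentle bound quiver (with `I` generated by paths of length two, so that a path
`ab` of length two lies in `I` exactly when it is one of the generators). -/
structure IsGentle : Prop where
  connected : Q.Connected
  finite : Module.Finite k (Q.algebra k)
  out_le : ∀ v, {a | Q.s a = v}.ncard ≤ 2
  in_le : ∀ v, {a | Q.t a = v}.ncard ≤ 2
  right_not : ∀ a b b', Q.t a = Q.s b → Q.t a = Q.s b' → ¬ Q.rel a b → ¬ Q.rel a b' → b = b'
  left_not : ∀ b a a', Q.t a = Q.s b → Q.t a' = Q.s b → ¬ Q.rel a b → ¬ Q.rel a' b → a = a'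
  right_rel : ∀ a b b', Q.rel a b → Q.rel a b' → b = b'
  left_rel : ∀ b a a', Q.rel a b → Q.rel a' b → a = a'

end BoundQuiver

/-- A gentle `k`-algebra: one which is isomorphic to `kQ / I` for a gentle bound quiver. -/
def IsGentleAlgebra (k : Type u) [Field k] (A : Type v) [Ring A] [Algebra k A] : Prop :=
  ∃ Q : BoundQuiver, Q.IsGentle k ∧ Nonempty (A ≃ₐ[k] Q.algebra k)

/-! ## Gorenstein-projective modules and the Cohen–Macaulay–Auslander algebra -/

/-- A finitely generated Gorenstein-projective module: a module `G` that is the image of a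
differential of an exact complex of finitely generated projective modules which stays exact under
`Hom_R(-, R)`. -/
def IsGorensteinProjective (R : Type v) [Ring R] (G : Type v) [AddCommGroup G] [Module R G] :
    Prop :=
  ∃ (P : ℤ → ModuleCat.{v} R) (d : ∀ i, P i →ₗ[R] P (i + 1)),
    (∀ i, Module.Finite R (P i)) ∧ (∀ i, Module.Projective R (P i)) ∧
    (∀ i, Function.Exact (d i) (d (i + 1))) ∧
    (∀ i (f : P (i + 1) →ₗ[R] R), f ∘ₗ d i = 0 →
      ∃ g : P (i + 1 + 1) →ₗ[R] R, f = g ∘ₗ d (i + 1)) ∧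
    Nonempty (G ≃ₗ[R] LinearMap.range (d 0))

/-- An indecomposable module. -/
def IsIndecomposableModule (R : Type v) [Ring R] (G : Type v) [AddCommGroup G] [Module R G] :
    Prop :=
  Nontrivial G ∧ ∀ N N' : Submodule R G, IsCompl N N' → N = ⊥ ∨ N' = ⊥

section CMA

/-- Presentations of finitely generated right `A`-modules as quotients of `Aⁿ`
(a right `A`-module is a module over `Aᵐᵒᵖ`). -/
def FGPresentation (A : Type v) [Ring A] : Type v := Σ n : ℕ, Submodule Aᵐᵒᵖ (Fin n → A)

/-- The right module given by a presentation. -/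
abbrev FGPresentation.module {A : Type v} [Ring A] (G : FGPresentation A) : Type v :=
  (Fin G.1 → A) ⧸ G.2

/-- Isomorphism of indecomposable finitely generated Gorenstein-projective right `A`-modules. -/
instance gprojSetoid (A : Type v) [Ring A] :
    Setoid {G : FGPresentation A //
      IsIndecomposableModule Aᵐᵒᵖ G.module ∧ IsGorensteinProjective Aᵐᵒᵖ G.module} where
  r G G' := Nonempty (G.1.module ≃ₗ[Aᵐᵒᵖ] G'.1.module)
  iseqv :=
    ⟨fun _ => ⟨LinearEquiv.refl _ _⟩, fun ⟨e⟩ => ⟨e.symm⟩, fun ⟨e⟩ ⟨f⟩ => ⟨e.trans f⟩⟩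

/-- `ind (Gproj A)`: the isomorphism classes of indecomposable finitely generated
Gorenstein-projective right `A`-modules. -/
def IndGproj (A : Type v) [Ring A] : Type v := Quotient (gprojSetoid A)

/-- A representative of an isomorphism class. -/
def IndGproj.rep {A : Type v} [Ring A] (G : IndGproj A) : Type v := (Quotient.out G).1.module

noncomputable instance {A : Type v} [Ring A] (G : IndGproj A) : AddCommGroup G.rep :=
  inferInstanceAs (AddCommGroup (Quotient.out G).1.module)

noncomputable instance {A : Type v} [Ring A] (G : IndGproj A) : Module Aᵐᵒᵖ G.rep :=
  inferInstanceAs (Module Aᵐᵒᵖ (Quotient.out G).1.module)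

noncomputable instance (k : Type u) [Field k] {A : Type v} [Ring A] [Algebra k A]
    (G : IndGproj A) : Module k G.rep :=
  inferInstanceAs (Module k (Quotient.out G).1.module)

instance (k : Type u) [Field k] {A : Type v} [Ring A] [Algebra k A] (G : IndGproj A) :
    IsScalarTower k Aᵐᵒᵖ G.rep :=
  inferInstanceAs (IsScalarTower k Aᵐᵒᵖ (Quotient.out G).1.module)

/-- The Cohen–Macaulay–Auslander algebra: the endomorphism algebra of the direct sum of the
indecomposable Gorenstein-projective right `A`-modules, one from each isomorphism class.

The product of `Module.End` is `f * g = f ∘ g`.  For this product `End (A_A) ≅ A`; it is the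
opposite of the product "first `f`, then `g`" on the endomorphisms. -/
abbrev CMAuslander (A : Type v) [Ring A] : Type v :=
  Module.End Aᵐᵒᵖ (⨁ G : IndGproj A, G.rep)

end CMA

/-! ## Surfaces with arcs -/

/-- A topological space with a set of marked points and a finite system of arcs.  The arcs are
given through their sides, an arc with a chosen side being the same as a directed arc (the side
is on the left of the directed arc): `curve e` is the directed arc, `inv e` is the same arc with
the other side, and `next e`, if there is one, is the side that follows `e` in anticlockwise order
in the boundary of the elementary polygon on the left of `e` (there is none if, at the end of
`e`, this boundary continues in the boundary of the surface). -/
structure ArcSurface where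
  Surf : Type
  [top : TopologicalSpace Surf]
  marked : Set Surf
  Side : Type
  [finSide : Finite Side]
  inv : Side → Side
  next : Side → Option Side
  curve : Side → C(I, Surf)

namespace ArcSurface

attribute [instance] ArcSurface.top ArcSurface.finSide

/-- Equality of surfaces with arcs up to homotopy: there is a homeomorphism between the surfaces
which sends the marked points onto the marked points and, up to homotopy of curves with fixed
end points, the arcs onto the arcs, and which preserves the orientation, that is,
the anticlockwise order of the sides of the elementary polygons. -/
def Homotopic (S T : ArcSurface) : Prop :=
  ∃ (h : S.Surf ≃ₜ T.Surf) (φ : S.Side ≃ T.Side),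
    h '' S.marked = T.marked ∧
    (∀ e, φ (S.inv e) = T.inv (φ e)) ∧
    (∀ e, (S.next e).map φ = T.next (φ e)) ∧
    ∀ e, ContinuousMap.HomotopicRel ((h : C(S.Surf, T.Surf)).comp (S.curve e))
      (T.curve (φ e)) {0, 1}

/-- The arcs: two sides belong to the same arc if they are exchanged by `inv`. -/
def Arc (S : ArcSurface) : Type := Quot fun e f : S.Side => f = S.inv e

instance (S : ArcSurface) : Finite S.Arc := Quot.finite _

/-- The bound quiver of a surface with arcs.  The vertices are the arcs, the arrows are the interior
angles between consecutive arcs of an elementary polygon, and the relations are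
the pairs of consecutive angles in the same elementary polygon. -/
def boundQuiver (S : ArcSurface) : BoundQuiver where
  V := S.Arc
  E := {p : S.Side × S.Side // S.next p.1 = some p.2}
  s p := Quot.mk _ p.1.1
  t p := Quot.mk _ p.1.2
  rel p q := p.1.2 = q.1.1
  rel_comp _ _ h := congrArg (Quot.mk _) h

/-- The algebra `A(𝐒)` of a surface with arcs. -/
abbrev algebra (k : Type u) [Field k] (S : ArcSurface) : Type u := S.boundQuiver.algebra k

end ArcSurface

/-! ## Marked surfaces -/

/-- A marked surface, given by gluing `∘`-polygons.  There are `s` oriented polygons.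
The `j`-th one has `m j + 1` edges: one is a boundary segment of the surface, with one `•`-marked
point on it, and the others are the `∘`-arcs `(j, 0), …, (j, m j - 1)`, in anticlockwise order and
starting after the boundary segment.  Each `∘`-arc `e` is glued to the `∘`-arc `glue e`,
compatibly with the orientations of the polygons.  (The polygons with `m j = 1` are the `2`-gons
that are glued to the otherwise unglued `∘`-arcs.) -/
structure MarkedSurface where
  s : ℕ
  m : Fin s → ℕ
  m_pos : ∀ j, 0 < m j
  glue : (Σ j, Fin (m j)) → (Σ j, Fin (m j))
  glue_glue : ∀ e, glue (glue e) = e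
  glue_ne : ∀ e, glue e ≠ e
  s_pos : 0 < s
  connected : ∀ j j', Relation.EqvGen (fun a b => ∃ x y, glue ⟨a, x⟩ = ⟨b, y⟩) j j'

namespace MarkedSurface

variable (S : MarkedSurface)

/-- The sides of the `•`-arcs.  The `•`-arc dual to the `∘`-arc `(j, i)`, when directed away from
the `•`-marked point of the `j`-th `∘`-polygon, is identified with `(j, i)`. -/
abbrev Side : Type := Σ j, Fin (S.m j)

/-- The next `∘`-arc in anticlockwise order in the same `∘`-polygon, unless the boundary segment
comes next. -/
def succ (e : S.Side) : Option S.Side :=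
  if h : e.2.1 + 1 < S.m e.1 then some ⟨e.1, ⟨e.2.1 + 1, h⟩⟩ else none

/-- The next side in the `•`-elementary polygon on the left of the directed `•`-arc `e`:
`e` ends at the `•`-marked point of the `∘`-polygon that contains `glue e`, and the polygon on the
left of `e` continues with the successor of `glue e` in this `∘`-polygon. -/
def next (e : S.Side) : Option S.Side := S.succ (S.glue e)

/-- The side `e` belongs to an `∞`-elementary polygon: going around the elementary polygon from `e`
one returns to `e` without meeting a boundary segment, so that the polygon contains a `∘`-marked
point in its interior. -/
def OnInfinityPolygon (e : S.Side) : Prop :=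
  Relation.TransGen (fun x y => S.next x = some y) e e

/-- The gluing of the squares `{e} × [0,1]²`, one for each side `e` of a `•`-arc, of which
`{e} × [0,1] × {0}` is the directed `•`-arc and the rest is on its left.  The two squares
at a `•`-arc are glued along it, and consecutive squares of the same elementary polygon are
glued along a vertical edge.  The squares of an elementary polygon which contains a boundary segment
make a disc, whose boundary consists of the arcs and of one boundary segment.  The squares of
an `∞`-elementary polygon make an annulus, whose inner boundary (where the `∘`-marked point has been
replaced by a boundary component) consists of the upper edges of the squares.
The `∘`-arc dual to the `•`-arc of `e` is made of the segments `x = 1/2` of the squares of `e` and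
of `glue e`. -/
inductive Glue : (Σ _ : S.Side, I × I) → (Σ _ : S.Side, I × I) → Prop
  | arc (e : S.Side) (x : I) : Glue ⟨e, (x, 0)⟩ ⟨S.glue e, (unitInterval.symm x, 0)⟩
  | polygon (e e' : S.Side) (y : I) : S.next e = some e' → Glue ⟨e, (1, y)⟩ ⟨e', (0, y)⟩

/-- The underlying topological space of the surface. -/
abbrev Surf : Type := Quot S.Glue

/-- The point with coordinates `(x, y)` in the square of `e`. -/
def point (e : S.Side) (p : I × I) : S.Surf := Quot.mk _ ⟨e, p⟩

theorem continuous_point (e : S.Side) : Continuous (S.point e) :=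
  continuous_quot_mk.comp continuous_sigmaMk

/-- The surface with its `•`-marked points and its `•`-arcs (the `∘`-arcs being ignored, and
the `∘`-marked points in the interior being replaced by boundary components). -/
def toArcSurface : ArcSurface where
  Surf := S.Surf
  marked := {x | ∃ e, x = S.point e (0, 0)}
  Side := S.Side
  inv := S.glue
  next := S.next
  curve e := ⟨fun x => S.point e (x, 0), (S.continuous_point e).comp (by fun_prop)⟩

open Classical in
/-- The surface `𝐒^CMA`.  It is the same surface with additional marked points and arcs.  For each
`∞`-elementary polygon with sides `e₁, …, e_ℓ` in anticlockwise order, where `eᵢ` ends at the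
vertex `vᵢ`, there are `ℓ` new marked points `wᵢ` on the inner boundary, in the same cyclic order,
and `ℓ` new arcs from `vᵢ` to `wᵢ` which cut the polygon into `ℓ` quadrilaterals.
In the coordinates of the square of `eᵢ` the new point is `(1, 1)` and the new arc is
`{1} × [0,1]`.  The side `(eᵢ, false)` is the new arc directed from `vᵢ` to `wᵢ`, with `eᵢ` on its
left, and the side `(eᵢ, true)` is directed from `wᵢ` to `vᵢ`, with `eᵢ₊₁` on its left.
The sides of the quadrilateral of `eᵢ` are `(eᵢ₋₁, true)`, `eᵢ`, `(eᵢ, false)`, and a segment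
of the inner boundary. -/
noncomputable def cma : ArcSurface where
  Surf := S.Surf
  marked := {x | ∃ e, x = S.point e (0, 0)} ∪
    {x | ∃ e, S.OnInfinityPolygon e ∧ x = S.point e (1, 1)}
  Side := S.Side ⊕ {e : S.Side // S.OnInfinityPolygon e} × Bool
  inv
    | Sum.inl e => Sum.inl (S.glue e)
    | Sum.inr (e, b) => Sum.inr (e, !b)
  next
    | Sum.inl e => if h : S.OnInfinityPolygon e then some (Sum.inr (⟨e, h⟩, false))
        else (S.next e).map Sum.inl
    | Sum.inr (_, false) => none
    | Sum.inr (e, true) => (S.next e.1).map Sum.inl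
  curve
    | Sum.inl e => ⟨fun x => S.point e (x, 0), (S.continuous_point e).comp (by fun_prop)⟩
    | Sum.inr (e, false) => ⟨fun x => S.point e.1 (1, x), (S.continuous_point e.1).comp (by fun_prop)⟩
    | Sum.inr (e, true) => ⟨fun x => S.point e.1 (1, unitInterval.symm x),
        (S.continuous_point e.1).comp (by fun_prop)⟩

/-- The algebra `A(𝐒)` of a marked surface. -/
abbrev algebra (k : Type u) [Field k] : Type u := S.toArcSurface.algebra k

/-- `𝐒` is the marked surface of the algebra `A`, that is, `A` is the algebra of `𝐒`. -/
def IsSurfaceOf (k : Type u) [Field k] (A : Type v) [Ring A] [Algebra k A] : Prop :=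
  Nonempty (S.algebra k ≃ₐ[k] A)

end MarkedSurface

/-!
All the combinatorics is carried by the sides of the `•`-arcs: an involution `inv` exchanges the two
sides of an arc, and a partial injection `succ` leads to the next side in the same `∘`-polygon
(`SideSystem`). The arrows of the quiver are the pairs `(x, succ x)`, a product of two composable
arrows vanishes exactly when the first one ends and the second one starts on different sides of an
arc, and the composition `succ ∘ inv` goes around the elementary polygons. Every gentle bound quiver
arises from such a system (`BoundQuiver.IsGentle.exists_presents`; finite dimension excludes cycles
of `succ`), and every connected system comes from a marked surface, whose polygons are the chains of
`succ` (`SideSystem.Connected.exists_markedSurface`). The algebra `kQ/I` of the system is the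
algebra `SideSystem.matAlg` of upper triangular matrices, with respect to the order of these chains,
whose diagonal entries at the two sides of an arc agree (`Presents.algEquiv`).

**The Gorenstein-projective modules.** In this matrix model one sees that an indecomposable
submodule of a free module is the right ideal of an arc (`projIdeal`) or of an arrow (`arrowIdeal`):
`SideSystem.exists_equiv_of_indecomposable`. The syzygy of the ideal of an arrow is the ideal of the
next arrow in the same elementary polygon. If this polygon has a boundary segment, then either the
arrow is the last one and its ideal is projective, or some higher extension by the regular module
does not vanish. On an `∞`-elementary polygon the arrows form a periodic totally acyclic complex.
Hence the indecomposable Gorenstein-projective modules are the ideals of the arcs and of the arrows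
on `∞`-elementary polygons (`SideSystem.exists_indGproj_equiv`).

**Their endomorphism algebra.** The rows of all these ideals are the columns, at the old sides, of
the matrices in the algebra of `SideSystem.cma`, the side system of `𝐒^CMA`: the new side at the end
of `e` is inserted between `inv e` and its successor, and it contributes the ideal of the arrow from
`inv e`. The matrices of `SideSystem.cma` act on these columns from the left, and this gives all
endomorphisms (`SideSystem.CMAModule.endEquiv`). So the Cohen–Macaulay–Auslander algebra has the
side system `SideSystem.cma` (`SideSystem.nonempty_cmAuslander_equiv`), which is the second
assertion and the existence of the surfaces in the first one.

**Uniqueness.** An isomorphism of matrix algebras comes with an isomorphism of side systems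
(`SideSystem.nonempty_iso`). The characters of such an algebra are the diagonal entries, which gives
the correspondence of the arcs. The coefficients of the images of the arrows at the arrows form an
invertible matrix, a non-zero term of its determinant gives a bijection of the arrows, and vanishing
products go to vanishing products; the converse holds since there are finitely many of them, and the
same is true for the inverse. The relations then determine the sides. Finally an isomorphism of side
systems onto the one of `𝐒^CMA` is realized by a homeomorphism, which subdivides the square of each
side on an `∞`-elementary polygon into the three squares of this side and of the two adjacent new
sides (`MarkedSurface.homotopic_cma`).
-/

/-! ### Side systems and their matrix algebras -/

/-- The combinatorics of a gentle bound quiver.  The two sides of an arc (a vertex of the quiver)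
are exchanged by `inv`; `succ` is the next side around the same `•`-marked point (in the same
`∘`-polygon).  The arrows of the quiver are the pairs `(x, succ x)`, and the non-zero paths are the
intervals of the chains of `succ`. -/
structure SideSystem where
  Side : Type
  [fin : Finite Side]
  inv : Side → Side
  succ : Side → Option Side
  inv_inv : ∀ x, inv (inv x) = x
  inv_ne : ∀ x, inv x ≠ x
  succ_inj : ∀ x y z, succ x = some z → succ y = some z → x = y
  acyclic : ∀ x, ¬ Relation.TransGen (fun a b => succ a = some b) x x

namespace SideSystem

attribute [instance] SideSystem.fin
attribute [simp] SideSystem.inv_inv SideSystem.inv_ne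

variable (C : SideSystem)

noncomputable instance : Fintype C.Side := Fintype.ofFinite _

noncomputable instance : DecidableEq C.Side := Classical.decEq _

/-- The order of the chains of `succ`: `x ≤ y` if `y` is an iterated successor of `x`. -/
instance : PartialOrder C.Side where
  le := Relation.ReflTransGen fun a b => C.succ a = some b
  lt := Relation.TransGen fun a b => C.succ a = some b
  le_refl _ := .refl
  le_trans _ _ _ := .trans
  lt_iff_le_not_ge x y := by
    constructor
    · intro h
      exact ⟨h.to_reflTransGen, fun h' => C.acyclic x (Relation.TransGen.trans_left h h')⟩
    · rintro ⟨h, h'⟩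
      rcases Relation.reflTransGen_iff_eq_or_transGen.1 h with rfl | h
      · exact (h' .refl).elim
      · exact h
  le_antisymm x y h h' := by
    rcases Relation.reflTransGen_iff_eq_or_transGen.1 h with rfl | h
    · rfl
    · exact (C.acyclic x (Relation.TransGen.trans_left h h')).elim

variable {C}

theorem inv_injective : Function.Injective C.inv :=
  Function.LeftInverse.injective C.inv_inv

theorem inv_eq_iff {x y : C.Side} : C.inv x = y ↔ x = C.inv y :=
  ⟨fun h => by rw [← h, C.inv_inv], fun h => by rw [h, C.inv_inv]⟩

@[simp] theorem ne_inv (x : C.Side) : x ≠ C.inv x := (C.inv_ne x).symm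

theorem lt_of_succ {x y : C.Side} (h : C.succ x = some y) : x < y :=
  Relation.TransGen.single h

theorem exists_succ_le {x y : C.Side} (h : x < y) : ∃ z, C.succ x = some z ∧ z ≤ y :=
  Relation.TransGen.head'_iff.1 h

theorem exists_le_pred {x y : C.Side} (h : x < y) : ∃ z, x ≤ z ∧ C.succ z = some y :=
  Relation.TransGen.tail'_iff.1 h

theorem le_of_lt_succ {x y z : C.Side} (h : C.succ y = some z) (hx : x < z) : x ≤ y := by
  obtain ⟨w, hw, hwz⟩ := exists_le_pred hx
  rwa [C.succ_inj y w z h hwz]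

theorem succ_le_of_lt {x y z : C.Side} (h : C.succ x = some z) (hx : x < y) : z ≤ y := by
  obtain ⟨w, hw, hwz⟩ := exists_succ_le hx
  rw [h] at hw
  rwa [Option.some.inj hw]

/-- Two sides below a third one are comparable. -/
theorem le_or_lt_of_le {x y z : C.Side} (hx : x ≤ z) (hy : y ≤ z) : x ≤ y ∨ y < x := by
  have hx' : Relation.ReflTransGen (fun a b => C.succ a = some b) x z := hx
  induction hx' with
  | refl => exact (eq_or_lt_of_le hy).imp (fun h => h.ge) id
  | tail h1 h2 ih =>
    rcases eq_or_lt_of_le hy with rfl | hy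
    · exact Or.inl hx
    · exact ih h1 (le_of_lt_succ h2 hy)

/-- Two sides above a third one are comparable. -/
theorem le_or_lt_of_ge {x y z : C.Side} (hx : z ≤ x) (hy : z ≤ y) : x ≤ y ∨ y < x := by
  have hx' : Relation.ReflTransGen (fun a b => C.succ a = some b) z x := hx
  induction hx' using Relation.ReflTransGen.head_induction_on with
  | refl => exact Or.inl hy
  | head h1 h2 ih =>
    rcases eq_or_lt_of_le hy with rfl | hy
    · exact (eq_or_lt_of_le hx).imp (fun h => h.ge) id
    · exact ih h2 (succ_le_of_lt h1 hy)

/-- The side that follows `e` anticlockwise in the elementary polygon of `e`; `none` if a boundary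
segment follows.  The angle between the two sides is the arrow from `inv e` to `next e`. -/
def next (C : SideSystem) (e : C.Side) : Option C.Side := C.succ (C.inv e)

/-- The side `e` lies on an `∞`-elementary polygon: `next` leads back to it. -/
def Inf (C : SideSystem) (e : C.Side) : Prop :=
  Relation.TransGen (fun x y => C.next x = some y) e e

theorem next_inj {x y z : C.Side} (h : C.next x = some z) (h' : C.next y = some z) : x = y :=
  inv_injective (C.succ_inj _ _ _ h h')

theorem Inf.exists_next {e : C.Side} (h : C.Inf e) : ∃ f, C.next e = some f ∧ C.Inf f := by
  obtain ⟨f, hf, hfe⟩ := Relation.TransGen.head'_iff.1 h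
  exact ⟨f, hf, Relation.TransGen.tail' hfe hf⟩

theorem Inf.of_next {e f : C.Side} (h : C.Inf f) (hf : C.next e = some f) : C.Inf e := by
  obtain ⟨g, hg, hgf⟩ := Relation.TransGen.tail'_iff.1 h
  obtain rfl := next_inj hgf hf
  exact Relation.TransGen.head' hf hg

variable (C) (k : Type u) [Field k]

/-- The matrix model of the algebra of a side system: the matrices which are upper triangular
for the order of the chains, and whose diagonal entries at the two sides of an arc agree.
The matrix unit at `(x, y)` with `x < y` is the path from `x` to `y`. -/
def matAlg : Subalgebra k (Matrix C.Side C.Side k) where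
  carrier := {M | (∀ x y, ¬ x ≤ y → M x y = 0) ∧ ∀ x, M (C.inv x) (C.inv x) = M x x}
  mul_mem' {M N} hM hN := by
    have hdiag : ∀ x, (M * N) x x = M x x * N x x := by
      intro x
      rw [Matrix.mul_apply, Finset.sum_eq_single x]
      · intro y _ hy
        by_cases h : x ≤ y
        · rw [hN.1 y x (fun h' => hy (le_antisymm h' h)), mul_zero]
        · rw [hM.1 x y h, zero_mul]
      · simp
    refine ⟨fun x y hxy => ?_, fun x => by rw [hdiag, hdiag, hM.2, hN.2]⟩
    rw [Matrix.mul_apply]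
    refine Finset.sum_eq_zero fun z _ => ?_
    by_cases h : x ≤ z
    · rw [hN.1 z y (fun h' => hxy (h.trans h')), mul_zero]
    · rw [hM.1 x z h, zero_mul]
  add_mem' {M N} hM hN :=
    ⟨fun x y h => by simp [hM.1 x y h, hN.1 x y h], fun x => by simp [hM.2 x, hN.2 x]⟩
  algebraMap_mem' r := by
    refine ⟨fun x y h => ?_, fun x => ?_⟩
    · rw [Matrix.algebraMap_matrix_apply, if_neg (fun h' => h h'.le)]
    · simp [Matrix.algebraMap_matrix_apply]

variable {C k}

/-- The diagonal entries of a product. -/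
theorem matAlg_apply_self (M N : C.matAlg k) (x : C.Side) :
    (M * N).1 x x = M.1 x x * N.1 x x := by
  change (M.1 * N.1) x x = _
  rw [Matrix.mul_apply, Finset.sum_eq_single x]
  · intro y _ hy
    by_cases h : x ≤ y
    · rw [N.2.1 y x (fun h' => hy (le_antisymm h' h)), mul_zero]
    · rw [M.2.1 x y h, zero_mul]
  · simp

/-- The superdiagonal entries of a product. -/
theorem matAlg_apply_succ (M N : C.matAlg k) {x y : C.Side} (h : C.succ x = some y) :
    (M * N).1 x y = M.1 x x * N.1 x y + M.1 x y * N.1 y y := by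
  change (M.1 * N.1) x y = _
  have hxy := lt_of_succ h
  rw [Matrix.mul_apply, ← Finset.sum_subset (Finset.subset_univ {x, y}),
    Finset.sum_pair hxy.ne]
  intro z _ hz
  simp only [Finset.mem_insert, Finset.mem_singleton, not_or] at hz
  by_cases h1 : x ≤ z
  · rw [N.2.1 z y, mul_zero]
    intro h2
    exact hz.2 (le_antisymm h2 (succ_le_of_lt h (lt_of_le_of_ne h1 (Ne.symm hz.1))))
  · rw [M.2.1 x z h1, zero_mul]

/-- The idempotent of the arc with side `x`. -/
noncomputable def idemMat (x : C.Side) : C.matAlg k :=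
  ⟨Matrix.diagonal fun y => if y = x ∨ y = C.inv x then 1 else 0, by
    refine ⟨fun y z h => Matrix.diagonal_apply_ne _ (fun h' => h h'.le), fun y => ?_⟩
    simp only [Matrix.diagonal_apply_eq, inv_injective.eq_iff, inv_eq_iff, or_comm]⟩

/-- The path from `x` to `y`, for `x < y`. -/
noncomputable def unitMat {x y : C.Side} (h : x < y) : C.matAlg k :=
  ⟨Matrix.single x y 1, by
    refine ⟨fun z w hzw => ?_, fun z => ?_⟩
    · apply Matrix.single_apply_of_ne
      rintro ⟨rfl, rfl⟩
      exact hzw h.le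
    · rw [Matrix.single_apply_of_ne, Matrix.single_apply_of_ne]
      · rintro ⟨rfl, h'⟩
        exact h.ne h'.symm
      · rintro ⟨h1, h2⟩
        exact h.ne (h1.trans h2.symm)⟩

theorem idemMat_apply (x y z : C.Side) :
    (idemMat x : C.matAlg k).1 y z = if y = z ∧ (y = x ∨ y = C.inv x) then 1 else 0 := by
  by_cases h : y = z
  · subst h; simp [idemMat]
  · simp [idemMat, Matrix.diagonal_apply_ne, h]

theorem unitMat_apply {x y : C.Side} (h : x < y) (z w : C.Side) :
    (unitMat h : C.matAlg k).1 z w = if x = z ∧ y = w then 1 else 0 := by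
  simp [unitMat, Matrix.single_apply]

theorem idemMat_mul_apply (x : C.Side) (M : C.matAlg k) (y z : C.Side) :
    (idemMat x * M).1 y z = if y = x ∨ y = C.inv x then M.1 y z else 0 := by
  change (Matrix.diagonal _ * M.1 : Matrix C.Side C.Side k) y z = _
  rw [Matrix.diagonal_mul]
  split_ifs <;> simp

theorem mul_idemMat_apply (x : C.Side) (M : C.matAlg k) (y z : C.Side) :
    (M * idemMat x).1 y z = if z = x ∨ z = C.inv x then M.1 y z else 0 := by
  change (M.1 * Matrix.diagonal _ : Matrix C.Side C.Side k) y z = _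
  rw [Matrix.mul_diagonal]
  split_ifs <;> simp

theorem unitMat_mul_apply {x y : C.Side} (h : x < y) (M : C.matAlg k) (z w : C.Side) :
    (unitMat h * M).1 z w = if z = x then M.1 y w else 0 := by
  change (Matrix.single x y 1 * M.1 : Matrix C.Side C.Side k) z w = _
  split_ifs with hz
  · subst hz; simp
  · rw [Matrix.single_mul_apply_of_ne (h := hz)]

theorem mul_unitMat_apply {x y : C.Side} (h : x < y) (M : C.matAlg k) (z w : C.Side) :
    (M * unitMat h).1 z w = if w = y then M.1 z x else 0 := by
  change (M.1 * Matrix.single x y 1 : Matrix C.Side C.Side k) z w = _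
  split_ifs with hz
  · subst hz; simp
  · rw [Matrix.mul_single_apply_of_ne (hbj := hz)]

end SideSystem

/-! ### Presentation of the bound quiver algebra by matrices -/

/-- The side system `C` describes the bound quiver `Q`: each vertex has two sides, exchanged by
`inv`, and the arrow `a` leads from the side `out a` to its successor `inn a`.  A path `ab` of
length two is zero exactly when `a` enters and `b` leaves the vertex on different sides. -/
structure Presents (C : SideSystem) (Q : BoundQuiver) where
  vtx : C.Side → Q.V
  vtx_surj : Function.Surjective vtx
  vtx_eq : ∀ x y, vtx x = vtx y ↔ x = y ∨ x = C.inv y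
  out : Q.E → C.Side
  inn : Q.E → C.Side
  succ_out : ∀ a, C.succ (out a) = some (inn a)
  out_inj : Function.Injective out
  out_surj : ∀ x y, C.succ x = some y → ∃ a, out a = x
  s_eq : ∀ a, Q.s a = vtx (out a)
  t_eq : ∀ a, Q.t a = vtx (inn a)
  rel_iff : ∀ a b, Q.rel a b ↔ inn a = C.inv (out b)

noncomputable instance (Q : BoundQuiver) : DecidableEq Q.V := Classical.decEq _

namespace Presents

open SideSystem

variable {C : SideSystem} {Q : BoundQuiver} (P : Presents C Q) (k : Type u) [Field k]

/-- A side of a vertex. -/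
noncomputable def rep (v : Q.V) : C.Side := Function.surjInv P.vtx_surj v

@[simp] theorem vtx_rep (v : Q.V) : P.vtx (P.rep v) = v := Function.surjInv_eq P.vtx_surj v

theorem out_lt_inn (a : Q.E) : P.out a < P.inn a := lt_of_succ (P.succ_out a)

theorem idemMat_rep_apply (v : Q.V) (y z : C.Side) :
    (idemMat (P.rep v) : C.matAlg k).1 y z = if y = z ∧ P.vtx y = v then 1 else 0 := by
  simp only [idemMat_apply, ← P.vtx_eq, vtx_rep]

/-- The images of the vertices and of the arrows in the matrix algebra. -/
noncomputable def genMap : FreeAlgebra k (Q.V ⊕ Q.E) →ₐ[k] C.matAlg k :=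
  FreeAlgebra.lift k (Sum.elim (fun v => idemMat (P.rep v)) (fun a => unitMat (P.out_lt_inn a)))

@[simp] theorem genMap_triv (v : Q.V) :
    P.genMap k (BoundQuiver.triv k Q v) = idemMat (P.rep v) := by
  simp [genMap, BoundQuiver.triv]

@[simp] theorem genMap_arr (a : Q.E) :
    P.genMap k (BoundQuiver.arr k Q a) = unitMat (P.out_lt_inn a) := by
  simp [genMap, BoundQuiver.arr]

/-- The matrices of the vertices and arrows satisfy the relations of the bound quiver algebra. -/
theorem genMap_rel ⦃x y : FreeAlgebra k (Q.V ⊕ Q.E)⦄ (h : BoundQuiver.Relation k Q x y) :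
    P.genMap k x = P.genMap k y := by
  have hmem : ∀ v x, (x = P.rep v ∨ x = C.inv (P.rep v)) ↔ P.vtx x = v := fun v x => by
    rw [← P.vtx_eq, vtx_rep]
  cases h with
  | idem v =>
    rw [map_mul, genMap_triv]
    ext y z
    simp only [idemMat_mul_apply, idemMat_rep_apply, hmem]
    split_ifs with h1 h2 h2
    · rfl
    · rfl
    · exact absurd h2.2 h1
    · rfl
  | orth v w h =>
    rw [map_mul, genMap_triv, genMap_triv, map_zero]
    ext y z
    simp only [idemMat_mul_apply, idemMat_rep_apply, hmem]
    split_ifs with h1 h2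
    · exact absurd (h1.symm.trans h2.2) h
    · rfl
    · rfl
  | one =>
    have := Fintype.ofFinite Q.V
    rw [finsum_eq_sum_of_fintype, map_sum, map_one]
    ext y z
    simp only [genMap_triv, AddSubmonoidClass.coe_finsetSum, Matrix.sum_apply,
      idemMat_rep_apply]
    rw [show ((1 : C.matAlg k) : Matrix C.Side C.Side k) = 1 from rfl, Matrix.one_apply]
    split_ifs with h
    · simp [h]
    · simp [h]
  | source a =>
    rw [map_mul, genMap_triv, genMap_arr]
    ext y z
    simp only [idemMat_mul_apply, hmem, unitMat_apply, P.s_eq]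
    split_ifs <;> simp_all
  | target a =>
    rw [map_mul, genMap_triv, genMap_arr]
    ext y z
    simp only [mul_idemMat_apply, hmem, unitMat_apply, P.t_eq]
    split_ifs <;> simp_all
  | zero a b h =>
    rw [map_mul, genMap_arr, genMap_arr, map_zero]
    ext y z
    rw [unitMat_mul_apply, unitMat_apply, if_neg (c := _ ∧ _)]
    · simp
    · rintro ⟨h', -⟩
      rw [P.rel_iff, ← h'] at h
      exact C.inv_ne _ h.symm

/-- The homomorphism from the bound quiver algebra to the matrix algebra. -/
noncomputable def toMat : Q.algebra k →ₐ[k] C.matAlg k :=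
  RingQuot.liftAlgHom k ⟨P.genMap k, P.genMap_rel k⟩

/-- The quotient map from the free algebra. -/
noncomputable abbrev quotMap (k : Type u) [Field k] (Q : BoundQuiver) :
    FreeAlgebra k (Q.V ⊕ Q.E) →ₐ[k] Q.algebra k :=
  RingQuot.mkAlgHom k (BoundQuiver.Relation k Q)

/-- The trivial path at `v` in the bound quiver algebra. -/
noncomputable def qv (k : Type u) [Field k] (Q : BoundQuiver) (v : Q.V) : Q.algebra k :=
  quotMap k Q (BoundQuiver.triv k Q v)

/-- The arrow `a` in the bound quiver algebra. -/
noncomputable def qa (k : Type u) [Field k] (Q : BoundQuiver) (a : Q.E) : Q.algebra k :=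
  quotMap k Q (BoundQuiver.arr k Q a)

theorem toMat_quotMap (z : FreeAlgebra k (Q.V ⊕ Q.E)) :
    P.toMat k (quotMap k Q z) = P.genMap k z := by
  simp [toMat]

variable {k}

theorem qv_mul_qv (v w : Q.V) :
    qv k Q v * qv k Q w = if v = w then qv k Q v else 0 := by
  unfold qv
  rw [← map_mul]
  split_ifs with h
  · subst h
    exact RingQuot.mkAlgHom_rel k (.idem v)
  · rw [← map_zero (quotMap k Q)]
    exact RingQuot.mkAlgHom_rel k (.orth v w h)

theorem qv_mul_qa (a : Q.E) : qv k Q (Q.s a) * qa k Q a = qa k Q a := by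
  unfold qv qa
  rw [← map_mul]
  exact RingQuot.mkAlgHom_rel k (.source a)

theorem qa_mul_qv (a : Q.E) : qa k Q a * qv k Q (Q.t a) = qa k Q a := by
  unfold qv qa
  rw [← map_mul]
  exact RingQuot.mkAlgHom_rel k (.target a)

theorem qa_mul_qa (a b : Q.E) (h : Q.rel a b) : qa k Q a * qa k Q b = 0 := by
  unfold qa
  rw [← map_mul, ← map_zero (quotMap k Q)]
  exact RingQuot.mkAlgHom_rel k (.zero a b h)

theorem sum_qv [Fintype Q.V] : ∑ v, qv k Q v = 1 := by
  unfold qv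
  rw [← map_sum, ← map_one (quotMap k Q), ← finsum_eq_sum_of_fintype]
  exact RingQuot.mkAlgHom_rel k .one

variable (k)

open Classical in
/-- The path from `x` to `y` in the bound quiver algebra (zero unless `x < y`).  The recursion stops
as the chain of `succ` that starts at `x` is finite. -/
noncomputable def path (x y : C.Side) : Q.algebra k :=
  if h : ∃ a, P.out a = x then
    qa k Q h.choose * (if P.inn h.choose = y then 1 else path (P.inn h.choose) y) else 0
termination_by {z | x < z}.ncard
decreasing_by
  have h1 : x < P.inn h.choose := by
    have h1 := P.out_lt_inn h.choose
    rwa [h.choose_spec] at h1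
  refine Set.ncard_lt_ncard ⟨fun z hz => h1.trans hz, fun h2 => ?_⟩ (Set.toFinite _)
  exact lt_irrefl (P.inn h.choose) (h2 h1)

open Classical in
theorem path_out (a : Q.E) (y : C.Side) :
    P.path k (P.out a) y = qa k Q a * (if P.inn a = y then 1 else P.path k (P.inn a) y) := by
  have h : ∃ b, P.out b = P.out a := ⟨a, rfl⟩
  rw [Presents.path, dif_pos h, P.out_inj h.choose_spec]

theorem path_of_not_out {x : C.Side} (h : ¬ ∃ a, P.out a = x) (y : C.Side) :
    P.path k x y = 0 := by
  rw [Presents.path, dif_neg h]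

theorem path_eq_zero (x y : C.Side) (h : ¬ x < y) : P.path k x y = 0 := by
  induction x using (wellFounded_gt (α := C.Side)).induction with
  | _ x ih =>
    by_cases hx : ∃ a, P.out a = x
    · obtain ⟨a, rfl⟩ := hx
      have h1 : ¬ P.inn a < y := fun h' => h ((P.out_lt_inn a).trans h')
      rw [path_out, if_neg (fun h' : P.inn a = y => h (h' ▸ P.out_lt_inn a)),
        ih _ (P.out_lt_inn a) h1, mul_zero]
    · exact P.path_of_not_out k hx y

theorem qv_mul_path (v : Q.V) (x y : C.Side) :
    qv k Q v * P.path k x y = if v = P.vtx x then P.path k x y else 0 := by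
  by_cases hx : ∃ a, P.out a = x
  · obtain ⟨a, rfl⟩ := hx
    have h1 : qv k Q v * qa k Q a = if v = P.vtx (P.out a) then qa k Q a else 0 := by
      rw [← qv_mul_qa, ← mul_assoc, qv_mul_qv, P.s_eq]
      split_ifs with h
      · rw [h]
      · rw [zero_mul]
    rw [path_out, ← mul_assoc, h1]
    split_ifs <;> simp
  · rw [P.path_of_not_out k hx y]
    simp

open Classical in
/-- An arrow annihilates all paths except those which start on the side where it ends. -/
theorem qa_mul_path (a : Q.E) (x y : C.Side) :
    qa k Q a * P.path k x y = if x = P.inn a then qa k Q a * P.path k x y else 0 := by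
  split_ifs with h
  · rfl
  · by_cases hx : ∃ b, P.out b = x
    · obtain ⟨b, rfl⟩ := hx
      by_cases hv : Q.t a = P.vtx (P.out b)
      · rw [P.t_eq, P.vtx_eq] at hv
        have hr : Q.rel a b := by
          rw [P.rel_iff]
          exact hv.resolve_left (fun h' => h h'.symm)
        rw [path_out, ← mul_assoc, qa_mul_qa a b hr, zero_mul]
      · rw [← qa_mul_qv, mul_assoc, qv_mul_path, if_neg hv, mul_zero]
    · rw [P.path_of_not_out k hx y, mul_zero]

/-- The inverse of `toMat`, as a linear map: a matrix is written in the basis of the paths. -/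
noncomputable def ofMat [Fintype Q.V] : C.matAlg k →ₗ[k] Q.algebra k :=
  (∑ v, (LinearMap.toSpanSingleton k _ (qv k Q v)) ∘ₗ
    (Matrix.entryLinearMap k k (P.rep v) (P.rep v)) ∘ₗ (C.matAlg k).val.toLinearMap) +
  ∑ x, ∑ y, (LinearMap.toSpanSingleton k _ (P.path k x y)) ∘ₗ
    (Matrix.entryLinearMap k k x y) ∘ₗ (C.matAlg k).val.toLinearMap

theorem ofMat_apply [Fintype Q.V] (M : C.matAlg k) :
    P.ofMat k M = ∑ v, M.1 (P.rep v) (P.rep v) • qv k Q v +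
      ∑ x, ∑ y, M.1 x y • P.path k x y := by
  simp [ofMat, LinearMap.sum_apply]

theorem ofMat_idem_mul [Fintype Q.V] (v : Q.V) (M : C.matAlg k) :
    P.ofMat k (idemMat (P.rep v) * M) = qv k Q v * P.ofMat k M := by
  classical
  have hmem : ∀ v x, (x = P.rep v ∨ x = C.inv (P.rep v)) ↔ v = P.vtx x := fun v x => by
    rw [← P.vtx_eq, vtx_rep, eq_comm]
  simp only [ofMat_apply, idemMat_mul_apply, hmem, mul_add, Finset.mul_sum, mul_smul_comm,
    qv_mul_path, qv_mul_qv, vtx_rep]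
  congr 1
  · refine Finset.sum_congr rfl fun w _ => ?_
    split_ifs with h
    · rw [h]
    · simp
  · refine Finset.sum_congr rfl fun x _ => Finset.sum_congr rfl fun y _ => ?_
    split_ifs <;> simp

theorem diag_eq (M : C.matAlg k) {x y : C.Side} (h : P.vtx x = P.vtx y) : M.1 x x = M.1 y y := by
  rcases (P.vtx_eq x y).1 h with rfl | rfl
  · rfl
  · exact M.2.2 y

theorem ofMat_unit_mul [Fintype Q.V] (a : Q.E) (M : C.matAlg k) :
    P.ofMat k (unitMat (P.out_lt_inn a) * M) = qa k Q a * P.ofMat k M := by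
  classical
  simp only [ofMat_apply, unitMat_mul_apply, mul_add, Finset.mul_sum, mul_smul_comm]
  have h1 : ∀ v, (if P.rep v = P.out a then M.1 (P.inn a) (P.rep v) else 0) • qv k Q v = 0 := by
    intro v
    split_ifs with h
    · rw [M.2.1, zero_smul]
      rw [h]
      exact (P.out_lt_inn a).not_ge
    · rw [zero_smul]
  have h2 : ∀ v, M.1 (P.rep v) (P.rep v) • (qa k Q a * qv k Q v) =
      if v = Q.t a then M.1 (P.inn a) (P.inn a) • qa k Q a else 0 := by
    intro v
    split_ifs with h
    · rw [h, qa_mul_qv, P.diag_eq k M (y := P.inn a)]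
      rw [vtx_rep, P.t_eq]
    · rw [← qa_mul_qv, mul_assoc, qv_mul_qv, if_neg (Ne.symm h), mul_zero, smul_zero]
  obtain ⟨g, hg⟩ : ∃ g : C.Side → Q.algebra k, ∀ y, g y = qa k Q a * P.path k (P.inn a) y :=
    ⟨_, fun _ => rfl⟩
  have h3 : ∀ x y, M.1 x y • (qa k Q a * P.path k x y) =
      if x = P.inn a then M.1 (P.inn a) y • g y else 0 := by
    intro x y
    rw [qa_mul_path]
    split_ifs with h
    · rw [h, hg]
    · rw [smul_zero]
  have h4 : ∀ x y, (if x = P.out a then M.1 (P.inn a) y else 0) • P.path k x y =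
      if x = P.out a then M.1 (P.inn a) y • P.path k (P.out a) y else 0 := by
    intro x y
    split_ifs with h
    · rw [h]
    · rw [zero_smul]
  simp only [h1, h2, h3, h4, Finset.sum_const_zero, zero_add, Finset.sum_ite_eq',
    Finset.mem_univ, if_true]
  rw [Finset.sum_comm, Finset.sum_comm (s := Finset.univ) (t := Finset.univ)
    (f := fun x y => if x = P.inn a then _ else _)]
  simp only [Finset.sum_ite_eq', Finset.mem_univ, if_true]
  rw [← Finset.add_sum_erase _ _ (Finset.mem_univ (P.inn a)),
    ← Finset.add_sum_erase (Finset.univ) (fun y => M.1 (P.inn a) y • g y)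
      (Finset.mem_univ (P.inn a)), hg, P.path_eq_zero k (P.inn a) (P.inn a) (lt_irrefl _),
    mul_zero, smul_zero, zero_add, path_out, if_pos rfl, mul_one]
  congr 1
  refine Finset.sum_congr rfl fun y hy => ?_
  rw [path_out, if_neg (Finset.ne_of_mem_erase hy).symm, hg]

/-- The map `ofMat` is linear over the free algebra; this gives that it is a left inverse of
`toMat`, without a basis of the bound quiver algebra. -/
theorem ofMat_genMap_mul [Fintype Q.V] (z : FreeAlgebra k (Q.V ⊕ Q.E)) :
    ∀ M : C.matAlg k, P.ofMat k (P.genMap k z * M) = quotMap k Q z * P.ofMat k M := by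
  induction z using FreeAlgebra.induction with
  | grade0 r =>
    intro M
    rw [AlgHom.commutes, AlgHom.commutes, ← Algebra.smul_def, map_smul, Algebra.smul_def]
  | grade1 x =>
    intro M
    rcases x with v | a
    · exact (congrArg (fun N => P.ofMat k (N * M)) (P.genMap_triv k v)).trans
        (P.ofMat_idem_mul k v M)
    · exact (congrArg (fun N => P.ofMat k (N * M)) (P.genMap_arr k a)).trans
        (P.ofMat_unit_mul k a M)
  | mul x y hx hy =>
    intro M
    rw [map_mul (P.genMap k), map_mul (quotMap k Q), mul_assoc, hx, hy, mul_assoc]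
  | add x y hx hy => intro M; rw [map_add, map_add, add_mul, add_mul, map_add, hx, hy]

theorem ofMat_one [Fintype Q.V] : P.ofMat k 1 = 1 := by
  rw [ofMat_apply, ← sum_qv]
  have h : ((1 : C.matAlg k) : Matrix C.Side C.Side k) = 1 := rfl
  simp only [h, Matrix.one_apply_eq, one_smul, add_eq_left]
  refine Finset.sum_eq_zero fun x _ => Finset.sum_eq_zero fun y _ => ?_
  by_cases hxy : x = y
  · rw [hxy, P.path_eq_zero k y y (lt_irrefl _), smul_zero]
  · rw [Matrix.one_apply_ne hxy, zero_smul]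

theorem ofMat_toMat [Fintype Q.V] (z : Q.algebra k) : P.ofMat k (P.toMat k z) = z := by
  obtain ⟨z, rfl⟩ := RingQuot.mkAlgHom_surjective k _ z
  have := P.ofMat_genMap_mul k z 1
  rw [mul_one, ofMat_one, mul_one] at this
  exact (congrArg _ (P.toMat_quotMap k z)).trans this

theorem toMat_path (x y : C.Side) (h : x < y) : P.toMat k (P.path k x y) = unitMat h := by
  induction x using (wellFounded_gt (α := C.Side)).induction with
  | _ x ih =>
    obtain ⟨z, hz, hzy⟩ := exists_succ_le h
    obtain ⟨a, rfl⟩ := P.out_surj _ _ hz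
    obtain rfl : P.inn a = z := Option.some.inj ((P.succ_out a).symm.trans hz)
    have ha : P.toMat k (qa k Q a) = unitMat (P.out_lt_inn a) := by
      rw [qa, toMat_quotMap, genMap_arr]
    rw [path_out, map_mul, ha]
    split_ifs with h1
    · subst h1; rw [map_one, mul_one]
    · rw [ih _ (P.out_lt_inn a) (lt_of_le_of_ne hzy h1)]
      ext w w'
      rw [unitMat_mul_apply, unitMat_apply, unitMat_apply]
      by_cases h2 : w = P.out a
      · simp [h2]
      · simp [h2, Ne.symm h2]

theorem toMat_ofMat [Fintype Q.V] (M : C.matAlg k) : P.toMat k (P.ofMat k M) = M := by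
  classical
  have hv : ∀ v, P.toMat k (qv k Q v) = idemMat (P.rep v) := fun v => by
    rw [qv, toMat_quotMap, genMap_triv]
  have hp : ∀ x y z w, (P.toMat k (P.path k x y)).1 z w =
      if z = x then if w = y then if x < y then 1 else 0 else 0 else 0 := by
    intro x y z w
    by_cases h : x < y
    · rw [toMat_path P k x y h, unitMat_apply, if_pos h, ite_and]
      simp only [eq_comm]
    · rw [P.path_eq_zero k x y h, map_zero]
      simp [h]
  ext z w
  rw [ofMat_apply, map_add, map_sum, map_sum]
  simp only [map_sum, map_smul, hv]
  simp only [AddMemClass.coe_add, AddSubmonoidClass.coe_finsetSum, SetLike.val_smul,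
    Matrix.add_apply, Matrix.sum_apply, Matrix.smul_apply, hp, idemMat_rep_apply, smul_eq_mul,
    mul_ite, mul_one, mul_zero, Finset.sum_ite_eq, Finset.mem_univ, if_true,
    Finset.sum_ite_irrel, Finset.sum_const_zero]
  by_cases hzw : z = w
  · subst hzw
    simp only [true_and, Finset.sum_ite_eq, Finset.mem_univ, if_true, lt_irrefl, if_false,
      add_zero]
    exact P.diag_eq k M (by simp)
  · simp only [hzw, false_and, if_false, Finset.sum_const_zero, zero_add]
    split_ifs with h
    · rfl
    · exact (M.2.1 z w fun h' => h (lt_of_le_of_ne h' hzw)).symm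

/-- The bound quiver algebra is isomorphic to the matrix algebra of its side system. -/
noncomputable def algEquiv : Q.algebra k ≃ₐ[k] C.matAlg k :=
  letI := Fintype.ofFinite Q.V
  AlgEquiv.ofBijective (P.toMat k)
    ⟨Function.LeftInverse.injective (P.ofMat_toMat k),
      Function.RightInverse.surjective (P.toMat_ofMat k)⟩

end Presents

/-! ### Right ideals of the algebra of a side system -/

open MulOpposite

section RightModules

variable {A : Type v} [Ring A]

/-- Left multiplication, as a homomorphism of right modules. -/
def lmul (c : A) : A →ₗ[Aᵐᵒᵖ] A where
  toFun a := c * a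
  map_add' := mul_add c
  map_smul' r a := by simp [mul_assoc]

/-- The regular right module, in its two guises. -/
def regularEquiv (A : Type v) [Ring A] : A ≃ₗ[Aᵐᵒᵖ] Aᵐᵒᵖ where
  toFun := op
  invFun := unop
  map_add' _ _ := rfl
  map_smul' _ _ := rfl
  left_inv _ := rfl
  right_inv _ := rfl

instance : Module.Free Aᵐᵒᵖ A := Module.Free.of_equiv (regularEquiv A).symm

instance : Module.Finite Aᵐᵒᵖ A := Module.Finite.equiv (regularEquiv A).symm

/-- A module in which every element outside the kernel of a non-zero additive map is a generator
is indecomposable. -/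
theorem isIndecomposableModule_of_generators {R : Type v} [Ring R] {G : Type v} [AddCommGroup G]
    [Module R G] {B : Type*} [AddCommGroup B] (π : G →+ B) (g : G) (hg : π g ≠ 0)
    (h : ∀ m, π m ≠ 0 → ∀ m', ∃ r : R, m' = r • m) : IsIndecomposableModule R G := by
  refine ⟨⟨g, 0, fun h0 => hg (by rw [h0, map_zero])⟩, fun N N' hN => ?_⟩
  have htop : ∀ N : Submodule R G, ∀ n ∈ N, π n ≠ 0 → N = ⊤ := by
    intro N n hn hπ
    rw [eq_top_iff]
    intro m _
    obtain ⟨r, rfl⟩ := h n hπ m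
    exact N.smul_mem r hn
  obtain ⟨n, hn, n', hn', rfl⟩ := Submodule.mem_sup.1
    (show g ∈ N ⊔ N' by rw [hN.sup_eq_top]; trivial)
  by_cases h1 : π n = 0
  · left
    have h2 : π n' ≠ 0 := fun h2 => hg (by rw [map_add, h1, h2, add_zero])
    have := hN.inf_eq_bot
    rwa [htop N' n' hn' h2, inf_top_eq] at this
  · right
    have := hN.inf_eq_bot
    rwa [htop N n hn h1, top_inf_eq] at this

theorem IsIndecomposableModule.of_equiv {R : Type v} [Ring R] {G G' : Type v} [AddCommGroup G]
    [Module R G] [AddCommGroup G'] [Module R G'] (e : G ≃ₗ[R] G')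
    (h : IsIndecomposableModule R G) : IsIndecomposableModule R G' := by
  have := h.1
  refine ⟨e.symm.toEquiv.nontrivial, fun N N' hN => ?_⟩
  have h1 : IsCompl (N.map e.symm.toLinearMap) (N'.map e.symm.toLinearMap) :=
    (Submodule.orderIsoMapComap e.symm).isCompl hN
  refine (h.2 _ _ h1).imp (fun h => ?_) (fun h => ?_)
  · exact (Submodule.map_eq_bot_iff (e := e.symm)).1 h
  · exact (Submodule.map_eq_bot_iff (e := e.symm)).1 h

theorem IsGorensteinProjective.of_equiv {R : Type v} [Ring R] {G G' : Type v} [AddCommGroup G]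
    [Module R G] [AddCommGroup G'] [Module R G'] (e : G ≃ₗ[R] G')
    (h : IsGorensteinProjective R G) : IsGorensteinProjective R G' := by
  obtain ⟨P, d, h1, h2, h3, h4, ⟨f⟩⟩ := h
  exact ⟨P, d, h1, h2, h3, h4, ⟨e.symm.trans f⟩⟩

/-- Finitely generated projective modules are Gorenstein-projective: use the complex with
terms `P × P` and the differential `(a, b) ↦ (0, a)`. -/
theorem IsGorensteinProjective.of_projective {R : Type v} [Ring R] (G : Type v) [AddCommGroup G]
    [Module R G] [Module.Finite R G] [Module.Projective R G] : IsGorensteinProjective R G := by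
  let D : G × G →ₗ[R] G × G := LinearMap.inr R G G ∘ₗ LinearMap.fst R G G
  have hD : ∀ a, D a = (0, a.1) := fun _ => rfl
  refine ⟨fun _ => ModuleCat.of R (G × G), fun _ => D, fun _ => ?_, fun _ => ?_, fun _ => ?_,
    fun _ f hf => ?_, ?_⟩
  · exact inferInstanceAs (Module.Finite R (G × G))
  · exact inferInstanceAs (Module.Projective R (G × G))
  · intro a
    constructor
    · intro h
      have h' : ((0, a.1) : G × G) = 0 := h
      exact ⟨(a.2, 0), Prod.ext (Prod.ext_iff.1 h').2.symm rfl⟩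
    · rintro ⟨b, rfl⟩
      rfl
  · let f' : G × G →ₗ[R] R := f
    refine ⟨f' ∘ₗ LinearMap.inl R G G ∘ₗ LinearMap.snd R G G, ?_⟩
    refine LinearMap.ext fun a => ?_
    have h1 : f' (0, a.2) = 0 := LinearMap.congr_fun hf (a.2, 0)
    change f' a = f' (a.1, 0)
    have : a = (a.1, 0) + (0, a.2) := by simp
    conv_lhs => rw [this, map_add, h1, add_zero]
  · refine ⟨LinearEquiv.ofBijective ((LinearMap.inr R G G).codRestrict (LinearMap.range D)
      fun a => ⟨(a, 0), rfl⟩)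
      ⟨fun a b h => ?_, ?_⟩⟩
    · exact (Prod.ext_iff.1 (Subtype.ext_iff.1 h)).2
    · rintro ⟨_, ⟨a, rfl⟩⟩
      exact ⟨a.1, rfl⟩

/-- Every finite right module has a presentation. -/
theorem exists_fgPresentation (G : Type v) [AddCommGroup G] [Module Aᵐᵒᵖ G]
    [Module.Finite Aᵐᵒᵖ G] : ∃ F : FGPresentation A, Nonempty (F.module ≃ₗ[Aᵐᵒᵖ] G) := by
  obtain ⟨n, f, hf⟩ := Module.Finite.exists_fin' Aᵐᵒᵖ G
  let e : (Fin n → A) ≃ₗ[Aᵐᵒᵖ] (Fin n → Aᵐᵒᵖ) := LinearEquiv.piCongrRight fun _ => regularEquiv A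
  let g := f ∘ₗ e.toLinearMap
  refine ⟨⟨n, LinearMap.ker g⟩, ⟨g.quotKerEquivOfSurjective ?_⟩⟩
  exact hf.comp e.surjective

end RightModules

namespace SideSystem

variable {C : SideSystem} {k : Type u} [Field k] {A : Type v} [Ring A] [Algebra k A]
  (ρ : A ≃ₐ[k] C.matAlg k)

theorem apply_mul_entry (a b : A) (x y : C.Side) :
    (ρ (a * b)).1 x y = ∑ z, (ρ a).1 x z * (ρ b).1 z y := by
  rw [map_mul]
  exact Matrix.mul_apply

theorem ext_entry {a b : A} (h : ∀ x y, (ρ a).1 x y = (ρ b).1 x y) : a = b :=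
  ρ.injective (Subtype.ext (Matrix.ext h))

/-- The element of `A` with a given matrix. -/
noncomputable def ofMatrix (M : Matrix C.Side C.Side k) (h : M ∈ C.matAlg k) : A := ρ.symm ⟨M, h⟩

@[simp] theorem ofMatrix_apply (M : Matrix C.Side C.Side k) (h : M ∈ C.matAlg k) (x y : C.Side) :
    (ρ (ofMatrix ρ M h)).1 x y = M x y := by
  simp [ofMatrix]

/-- The idempotent of the arc with side `x`. -/
noncomputable def idem (x : C.Side) : A := ρ.symm (idemMat x)

/-- The path from `x` to `y`. -/
noncomputable def unit {x y : C.Side} (h : x < y) : A := ρ.symm (unitMat h)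

theorem idem_apply (x y z : C.Side) :
    (ρ (idem ρ x)).1 y z = if y = z ∧ (y = x ∨ y = C.inv x) then 1 else 0 := by
  simp only [idem, AlgEquiv.apply_symm_apply, idemMat_apply]

theorem unit_apply {x y : C.Side} (h : x < y) (z w : C.Side) :
    (ρ (unit ρ h)).1 z w = if x = z ∧ y = w then 1 else 0 := by
  simp only [unit, AlgEquiv.apply_symm_apply, unitMat_apply]

theorem idem_mul_apply (x : C.Side) (a : A) (y z : C.Side) :
    (ρ (idem ρ x * a)).1 y z = if y = x ∨ y = C.inv x then (ρ a).1 y z else 0 := by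
  simp only [idem, map_mul, AlgEquiv.apply_symm_apply, idemMat_mul_apply]

theorem mul_idem_apply (x : C.Side) (a : A) (y z : C.Side) :
    (ρ (a * idem ρ x)).1 y z = if z = x ∨ z = C.inv x then (ρ a).1 y z else 0 := by
  simp only [idem, map_mul, AlgEquiv.apply_symm_apply, mul_idemMat_apply]

theorem unit_mul_apply {x y : C.Side} (h : x < y) (a : A) (z w : C.Side) :
    (ρ (unit ρ h * a)).1 z w = if z = x then (ρ a).1 y w else 0 := by
  simp only [unit, map_mul, AlgEquiv.apply_symm_apply, unitMat_mul_apply]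

theorem mul_unit_apply {x y : C.Side} (h : x < y) (a : A) (z w : C.Side) :
    (ρ (a * unit ρ h)).1 z w = if w = y then (ρ a).1 z x else 0 := by
  simp only [unit, map_mul, AlgEquiv.apply_symm_apply, mul_unitMat_apply]

/-- The indecomposable projective right ideal of the arc with side `x`: the elements which are
supported in the rows `x` and `inv x`. -/
def projIdeal (x : C.Side) : Submodule Aᵐᵒᵖ A where
  carrier := {a | ∀ y z, y ≠ x → y ≠ C.inv x → (ρ a).1 y z = 0}
  add_mem' ha hb y z h1 h2 := by simp [ha y z h1 h2, hb y z h1 h2]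
  zero_mem' := by simp
  smul_mem' c a ha y z h1 h2 := by
    rw [← MulOpposite.op_unop c, op_smul_eq_mul, apply_mul_entry]
    exact Finset.sum_eq_zero fun w _ => by rw [ha y w h1 h2, zero_mul]

/-- The right ideal generated by the arrow from `x` to its successor: the elements which are
supported in the row `x`, off the diagonal. -/
def arrowIdeal (x : C.Side) : Submodule Aᵐᵒᵖ A where
  carrier := {a | ∀ y z, ¬ (y = x ∧ x < z) → (ρ a).1 y z = 0}
  add_mem' ha hb y z h := by simp [ha y z h, hb y z h]
  zero_mem' := by simp
  smul_mem' c a ha y z h := by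
    rw [← MulOpposite.op_unop c, op_smul_eq_mul, apply_mul_entry]
    refine Finset.sum_eq_zero fun w _ => ?_
    by_cases h1 : y = x ∧ x < w
    · rw [(ρ _).2.1 w z, mul_zero]
      exact fun h2 => h ⟨h1.1, h1.2.trans_le h2⟩
    · rw [ha y w h1, zero_mul]

variable {ρ}

theorem mem_projIdeal {x : C.Side} {a : A} :
    a ∈ projIdeal ρ x ↔ ∀ y z, y ≠ x → y ≠ C.inv x → (ρ a).1 y z = 0 := Iff.rfl

theorem idem_mul_of_mem {x : C.Side} {a : A} (h : a ∈ projIdeal ρ x) : idem ρ x * a = a := by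
  refine ext_entry ρ fun y z => ?_
  rw [idem_mul_apply]
  split_ifs with h1
  · rfl
  · rw [not_or] at h1
    exact (h y z h1.1 h1.2).symm

theorem idem_mul_mem (x : C.Side) (a : A) : idem ρ x * a ∈ projIdeal ρ x := by
  intro y z h1 h2
  rw [idem_mul_apply, if_neg (not_or.2 ⟨h1, h2⟩)]

theorem idem_mem (x : C.Side) : idem ρ x ∈ projIdeal ρ x := by
  have := idem_mul_mem (ρ := ρ) x 1
  rwa [mul_one] at this

theorem projIdeal_inv (x : C.Side) : projIdeal ρ (C.inv x) = projIdeal ρ x := by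
  ext a
  simp only [mem_projIdeal, C.inv_inv]
  exact ⟨fun h y z h1 h2 => h y z h2 h1, fun h y z h1 h2 => h y z h2 h1⟩

theorem arrowIdeal_le (x : C.Side) : arrowIdeal ρ x ≤ projIdeal ρ x :=
  fun _ ha y z h1 _ => ha y z fun h => h1 h.1

theorem unit_mul_mem {x y : C.Side} (h : C.succ x = some y) (a : A) :
    unit ρ (lt_of_succ h) * a ∈ arrowIdeal ρ x := by
  intro z w hzw
  rw [unit_mul_apply]
  split_ifs with h1
  · refine (ρ a).2.1 y w fun h2 => hzw ⟨h1, (lt_of_succ h).trans_le h2⟩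
  · rfl

theorem unit_mem {x y : C.Side} (h : C.succ x = some y) :
    unit ρ (lt_of_succ h) ∈ arrowIdeal ρ x := by
  have := unit_mul_mem (ρ := ρ) h 1
  rwa [mul_one] at this

/-- Elements of the right ideal of an arrow are multiples of the arrow. -/
theorem exists_eq_unit_mul {x y : C.Side} (h : C.succ x = some y) {a : A}
    (ha : a ∈ arrowIdeal ρ x) :
    ∃ d ∈ projIdeal ρ y, a = unit ρ (lt_of_succ h) * d ∧ (ρ d).1 y y = (ρ a).1 x y := by
  let M : Matrix C.Side C.Side k := fun z w =>
    if z = y then (ρ a).1 x w else if z = C.inv y ∧ w = C.inv y then (ρ a).1 x y else 0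
  have hM : M ∈ C.matAlg k := by
    refine ⟨fun z w hzw => ?_, fun z => ?_⟩
    · simp only [M]
      split_ifs with h1 h2
      · subst h1
        exact ha x w fun h3 => hzw (succ_le_of_lt h h3.2)
      · exact (hzw (h2.1.trans h2.2.symm).le).elim
      · rfl
    · simp only [M, inv_eq_iff, C.inv_inv]
      by_cases h1 : z = y
      · subst h1; simp
      · by_cases h2 : z = C.inv y
        · subst h2; simp
        · simp [h1, h2]
  refine ⟨ofMatrix ρ M hM, fun z w h1 h2 => ?_, ext_entry ρ fun z w => ?_, ?_⟩
  · rw [ofMatrix_apply]; simp [M, h1, h2]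
  · rw [unit_mul_apply, ofMatrix_apply]
    split_ifs with h1
    · simp [M, h1]
    · exact ha z w fun h2 => h1 h2.1
  · rw [ofMatrix_apply]; simp [M]

/-- An element supported in the column of a successor `x = succ p` is a left multiple of the
arrow from `p` to `x`. -/
theorem exists_eq_mul_unit {p x : C.Side} (h : C.succ p = some x) {a : A}
    (ha : ∀ y z, z ≠ x → (ρ a).1 y z = 0) : ∃ d, a = d * unit ρ (lt_of_succ h) := by
  let M : Matrix C.Side C.Side k := fun z w =>
    if w = p then (ρ a).1 z x else if z = C.inv p ∧ w = C.inv p then (ρ a).1 p x else 0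
  -- the diagonal entry of `a` at `x` vanishes, as the one at `inv x` does
  have hx : (ρ a).1 x x = 0 := by rw [← (ρ a).2.2 x, ha _ _ (C.inv_ne x)]
  have hM : M ∈ C.matAlg k := by
    refine ⟨fun z w hzw => ?_, fun z => ?_⟩
    · simp only [M]
      split_ifs with h1 h2
      · subst h1
        by_cases h3 : z = x
        · rw [h3, hx]
        · exact (ρ a).2.1 z x fun h4 => hzw (le_of_lt_succ h (lt_of_le_of_ne h4 h3))
      · exact (hzw (h2.1.trans h2.2.symm).le).elim
      · rfl
    · simp only [M, inv_eq_iff, C.inv_inv]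
      by_cases h1 : z = p
      · subst h1; simp
      · by_cases h2 : z = C.inv p
        · subst h2; simp
        · simp [h1, h2]
  refine ⟨ofMatrix ρ M hM, ext_entry ρ fun z w => ?_⟩
  rw [mul_unit_apply, ofMatrix_apply]
  split_ifs with h1
  · simp [M, h1]
  · exact ha z w h1

include ρ in
theorem finite_of_equiv : Module.Finite k A :=
  Module.Finite.equiv ρ.symm.toLinearEquiv

/-- An element with non-zero diagonal entries has a right inverse. -/
theorem exists_mul_eq {u : A} (hu : ∀ x, (ρ u).1 x x ≠ 0) (d : A) : ∃ b, u * b = d := by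
  have := finite_of_equiv (ρ := ρ)
  have hinj : Function.Injective (LinearMap.mulLeft k u) := by
    rw [injective_iff_map_eq_zero]
    intro b hb
    rw [LinearMap.mulLeft_apply] at hb
    refine ext_entry ρ fun x z => ?_
    rw [map_zero]
    change _ = (0 : k)
    -- descending induction on the row
    induction x using (wellFounded_gt (α := C.Side)).induction with
    | _ x ih =>
      have h1 : (ρ (u * b)).1 x z = 0 := by rw [hb, map_zero]; rfl
      rw [apply_mul_entry, Finset.sum_eq_single x] at h1
      · exact (mul_eq_zero.1 h1).resolve_left (hu x)
      · intro y _ hy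
        by_cases h2 : x ≤ y
        · rw [ih y (lt_of_le_of_ne h2 hy.symm), mul_zero]
        · rw [(ρ u).2.1 x y h2, zero_mul]
      · simp
  exact (LinearMap.injective_iff_surjective.1 hinj) d

/-- An element of `e A`, for the idempotent `e` of an arc, generates `e A` if its diagonal entry
does not vanish. -/
theorem projIdeal_generator {x : C.Side} {a : A} (ha : a ∈ projIdeal ρ x)
    (h : (ρ a).1 x x ≠ 0) {d : A} (hd : d ∈ projIdeal ρ x) : ∃ b, d = a * b := by
  obtain ⟨b, hb⟩ := exists_mul_eq (ρ := ρ) (u := a + (1 - idem ρ x)) (fun y => by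
    rw [map_add, map_sub, map_one]
    change (ρ a).1 y y + ((1 : Matrix C.Side C.Side k) y y - (ρ (idem ρ x)).1 y y) ≠ 0
    rw [idem_apply, Matrix.one_apply_eq]
    by_cases h1 : y = x
    · subst h1; simpa using h
    · by_cases h2 : y = C.inv x
      · subst h2
        rw [(ρ a).2.2]
        simpa using h
      · rw [ha y y h1 h2]; simp [h1, h2]) d
  refine ⟨b, ?_⟩
  have h2 : idem ρ x * (a + (1 - idem ρ x)) = a := by
    rw [mul_add, mul_sub, mul_one, idem_mul_of_mem ha, idem_mul_of_mem (idem_mem x), sub_self,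
      add_zero]
  rw [← idem_mul_of_mem hd, ← hb, ← mul_assoc, h2]

/-- An element of the right ideal of an arrow generates it if its first entry does not vanish. -/
theorem arrowIdeal_generator {x y : C.Side} (h : C.succ x = some y) {a : A}
    (ha : a ∈ arrowIdeal ρ x) (hxy : (ρ a).1 x y ≠ 0) {d : A} (hd : d ∈ arrowIdeal ρ x) :
    ∃ b, d = a * b := by
  obtain ⟨a', ha', rfl, h1⟩ := exists_eq_unit_mul h ha
  obtain ⟨d', hd', rfl, -⟩ := exists_eq_unit_mul h hd
  obtain ⟨b, rfl⟩ := projIdeal_generator ha' (by rwa [h1]) hd'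
  exact ⟨b, (mul_assoc _ _ _).symm⟩

theorem projIdeal_indecomposable (x : C.Side) :
    IsIndecomposableModule Aᵐᵒᵖ (projIdeal ρ x) := by
  refine isIndecomposableModule_of_generators
    (π := { toFun := fun a => (ρ a.1).1 x x, map_zero' := by simp, map_add' := by simp })
    ⟨idem ρ x, idem_mem x⟩ ?_ ?_
  · simp [idem_apply]
  · rintro ⟨a, ha⟩ h ⟨d, hd⟩
    obtain ⟨b, rfl⟩ := projIdeal_generator ha h hd
    exact ⟨op b, rfl⟩

theorem arrowIdeal_indecomposable {x y : C.Side} (h : C.succ x = some y) :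
    IsIndecomposableModule Aᵐᵒᵖ (arrowIdeal ρ x) := by
  refine isIndecomposableModule_of_generators
    (π := { toFun := fun a => (ρ a.1).1 x y, map_zero' := by simp, map_add' := by simp })
    ⟨_, unit_mem h⟩ ?_ ?_
  · simp [unit_apply]
  · rintro ⟨a, ha⟩ h1 ⟨d, hd⟩
    obtain ⟨b, rfl⟩ := arrowIdeal_generator h ha h1 hd
    exact ⟨op b, rfl⟩

/-- The projection of `A` onto the right ideal of an arc. -/
noncomputable def projMap (ρ : A ≃ₐ[k] C.matAlg k) (x : C.Side) : A →ₗ[Aᵐᵒᵖ] projIdeal ρ x :=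
  (lmul (idem ρ x)).codRestrict _ fun a => idem_mul_mem x a

instance (x : C.Side) : Module.Projective Aᵐᵒᵖ (projIdeal ρ x) :=
  Module.Projective.of_split (projIdeal ρ x).subtype (projMap ρ x) (by
    ext a
    exact idem_mul_of_mem a.2)

instance (x : C.Side) : Module.Finite Aᵐᵒᵖ (projIdeal ρ x) :=
  Module.Finite.of_surjective (projMap ρ x) fun a => ⟨a.1, Subtype.ext (idem_mul_of_mem a.2)⟩

/-- Left multiplication by the arrow from `inv e` to `f = next e`. -/
noncomputable def arrowMap (ρ : A ≃ₐ[k] C.matAlg k) {e f : C.Side} (h : C.next e = some f) :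
    projIdeal ρ f →ₗ[Aᵐᵒᵖ] projIdeal ρ e :=
  ((lmul (unit ρ (lt_of_succ h))).comp (projIdeal ρ f).subtype).codRestrict _ fun a => by
    rw [← projIdeal_inv]
    exact arrowIdeal_le _ (unit_mul_mem h a.1)

theorem arrowMap_apply {e f : C.Side} (h : C.next e = some f) (a : projIdeal ρ f) :
    (arrowMap ρ h a).1 = unit ρ (lt_of_succ h) * a.1 := rfl

/-- The kernel of the multiplication by an arrow of an elementary polygon is the ideal of the next
arrow of this polygon. -/
theorem arrowMap_eq_zero_iff {e f : C.Side} (h : C.next e = some f) (a : projIdeal ρ f) :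
    arrowMap ρ h a = 0 ↔ a.1 ∈ arrowIdeal ρ (C.inv f) := by
  have h1 : arrowMap ρ h a = 0 ↔ ∀ z, (ρ a.1).1 f z = 0 := by
    rw [← Submodule.coe_eq_zero, arrowMap_apply]
    constructor
    · intro h1 z
      have h2 := unit_mul_apply ρ (lt_of_succ h) a.1 (C.inv e) z
      rw [h1, map_zero, if_pos rfl] at h2
      exact h2.symm
    · intro h1
      refine ext_entry ρ fun y z => ?_
      rw [unit_mul_apply, h1, ite_self, map_zero]
      rfl
  rw [h1]
  constructor
  · intro h2 y z hyz
    by_cases h3 : y = f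
    · rw [h3, h2]
    · by_cases h4 : y = C.inv f
      · by_cases h5 : y = z
        · rw [← h5, h4, (ρ a.1).2.2, h2]
        · exact (ρ a.1).2.1 y z fun h6 => hyz ⟨h4, h4 ▸ lt_of_le_of_ne h6 h5⟩
      · exact a.2 y z h3 h4
  · intro h2 z
    exact h2 f z fun h3 => C.ne_inv f h3.1

theorem exists_arrowMap_eq {e f : C.Side} (h : C.next e = some f) {a : A}
    (ha : a ∈ arrowIdeal ρ (C.inv e)) : ∃ b, (arrowMap ρ h b).1 = a := by
  obtain ⟨d, hd, rfl, -⟩ := exists_eq_unit_mul h ha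
  exact ⟨⟨d, hd⟩, rfl⟩

/-- Linear maps from the right ideal of an arc to the algebra are left multiplications. -/
theorem exists_lmul {x : C.Side} (f : projIdeal ρ x →ₗ[Aᵐᵒᵖ] Aᵐᵒᵖ) :
    ∃ c, c * idem ρ x = c ∧ ∀ a, f a = op (c * a.1) := by
  have h : ∀ a : projIdeal ρ x, f a = op ((f ⟨idem ρ x, idem_mem x⟩).unop * a.1) := by
    intro a
    have h1 : a = op a.1 • (⟨idem ρ x, idem_mem x⟩ : projIdeal ρ x) :=
      Subtype.ext (idem_mul_of_mem a.2).symm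
    conv_lhs => rw [h1, map_smul]
    rfl
  refine ⟨_, ?_, h⟩
  exact congrArg unop (h ⟨idem ρ x, idem_mem x⟩).symm

/-- The right ideal of an arrow on an `∞`-elementary polygon is Gorenstein-projective: the arrows
of this polygon give a periodic totally acyclic complex. -/
theorem arrowIdeal_gproj {e : C.Side} (he : C.Inf e) :
    IsGorensteinProjective Aᵐᵒᵖ (arrowIdeal ρ (C.inv e)) := by
  let τ' : {e // C.Inf e} → {e // C.Inf e} := fun e =>
    ⟨e.2.exists_next.choose, e.2.exists_next.choose_spec.2⟩
  have hτ' : ∀ e, C.next e.1 = some (τ' e).1 := fun e => e.2.exists_next.choose_spec.1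
  have hinj : Function.Injective τ' := fun a b h =>
    Subtype.ext (next_inj (hτ' a) (by rw [hτ' b, h]))
  let τ : Equiv.Perm {e // C.Inf e} := Equiv.ofBijective τ' (Finite.injective_iff_bijective.1 hinj)
  -- the complex runs backwards through the polygon, and its differential in degree zero is the
  -- multiplication by the arrow from `inv e`
  let s : ℤ → C.Side := fun i => ((τ ^ (1 - i)) ⟨e, he⟩).1
  have hs : ∀ i, C.next (s (i + 1)) = some (s i) := by
    intro i
    rw [hτ']
    have : τ' ((τ ^ (1 - (i + 1))) ⟨e, he⟩) = (τ * τ ^ (1 - (i + 1))) ⟨e, he⟩ := rfl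
    rw [this, ← zpow_one_add]
    simp only [s]
    congr 3
    ring_nf
  have hs1 : s (0 + 1) = e := by simp [s]
  refine ⟨fun i => ModuleCat.of Aᵐᵒᵖ (projIdeal ρ (s i)), fun i => arrowMap ρ (hs i), fun i => ?_,
    fun i => ?_, fun i => ?_, fun i f hf => ?_, ?_⟩
  · exact inferInstanceAs (Module.Finite Aᵐᵒᵖ (projIdeal ρ (s i)))
  · exact inferInstanceAs (Module.Projective Aᵐᵒᵖ (projIdeal ρ (s i)))
  · intro a
    refine (arrowMap_eq_zero_iff (hs (i + 1)) a).trans ⟨fun h => ?_, ?_⟩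
    · obtain ⟨b, hb⟩ := exists_arrowMap_eq (hs i) h
      exact ⟨b, Subtype.ext hb⟩
    · rintro ⟨b, rfl⟩
      exact unit_mul_mem (hs i) b.1
  · obtain ⟨c, hc, hfc⟩ := exists_lmul f
    have h1 : c * unit ρ (lt_of_succ (hs i)) = 0 := by
      have h2 := LinearMap.congr_fun hf ⟨idem ρ (s i), idem_mem _⟩
      have h3 := hfc (arrowMap ρ (hs i) ⟨idem ρ (s i), idem_mem _⟩)
      have h4 : c * (unit ρ (lt_of_succ (hs i)) * idem ρ (s i)) = 0 :=
        congrArg unop (h3.symm.trans h2)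
      rw [← h4]
      congr 1
      refine ext_entry ρ fun y z => ?_
      rw [mul_idem_apply, unit_apply]
      split_ifs <;> simp_all
    obtain ⟨d, hd⟩ := exists_eq_mul_unit (ρ := ρ) (hs (i + 1)) (a := c) (by
      intro y z hz
      rw [← hc, mul_idem_apply]
      split_ifs with h2
      · obtain rfl := h2.resolve_left hz
        have h3 := mul_unit_apply ρ (lt_of_succ (hs i)) c y (s i)
        rw [h1, map_zero, if_pos rfl] at h3
        exact h3.symm
      · rfl)
    refine ⟨(regularEquiv A).toLinearMap ∘ₗ lmul d ∘ₗ (projIdeal ρ (s (i + 1 + 1))).subtype, ?_⟩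
    refine LinearMap.ext fun a => (hfc a).trans ?_
    refine congrArg op ?_
    rw [hd, mul_assoc]
    rfl
  · have h1 : (LinearMap.range (arrowMap ρ (hs 0))).map (projIdeal ρ (s (0 + 1))).subtype =
        arrowIdeal ρ (C.inv e) := by
      rw [← hs1]
      ext a
      constructor
      · rintro ⟨_, ⟨b, rfl⟩, rfl⟩
        exact unit_mul_mem (hs 0) b.1
      · intro ha
        obtain ⟨b, hb⟩ := exists_arrowMap_eq (hs 0) ha
        exact ⟨_, ⟨b, rfl⟩, hb⟩
    exact ⟨(LinearEquiv.ofEq _ _ h1.symm).trans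
      (Submodule.equivMapOfInjective _ Subtype.val_injective _).symm⟩

theorem equiv_apply_mul {N N' : Submodule Aᵐᵒᵖ A} (e : N ≃ₗ[Aᵐᵒᵖ] N') (a : N) (b : A) :
    (e (op b • a)).1 = (e a).1 * b := by
  rw [map_smul]
  rfl

/-- The image of a generator of a module isomorphic to `e A` has a non-zero diagonal entry. -/
theorem apply_ne_zero_of_equiv_projIdeal {x : C.Side} {N : Submodule Aᵐᵒᵖ A}
    (e : N ≃ₗ[Aᵐᵒᵖ] projIdeal ρ x) (a : N) (ha : ∀ d ∈ N, ∃ b, d = a.1 * b) :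
    (ρ (e a).1).1 x x ≠ 0 := by
  obtain ⟨d, hd⟩ := e.surjective ⟨idem ρ x, idem_mem x⟩
  obtain ⟨b, hb⟩ := ha d.1 d.2
  have h1 : (e a).1 * b = idem ρ x := by
    rw [← equiv_apply_mul]
    rw [show op b • a = d from Subtype.ext hb.symm, hd]
  have h2 : (ρ (e a).1).1 x x * (ρ b).1 x x = 1 := by
    rw [← matAlg_apply_self, ← map_mul, h1, idem_apply]
    simp
  exact left_ne_zero_of_mul_eq_one h2

/-- The image of a generator of a module isomorphic to the ideal of an arrow has a non-zero
first entry. -/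
theorem apply_ne_zero_of_equiv_arrowIdeal {x y : C.Side} (h : C.succ x = some y)
    {N : Submodule Aᵐᵒᵖ A} (e : N ≃ₗ[Aᵐᵒᵖ] arrowIdeal ρ x) (a : N)
    (ha : ∀ d ∈ N, ∃ b, d = a.1 * b) : (ρ (e a).1).1 x y ≠ 0 := by
  obtain ⟨d, hd⟩ := e.surjective ⟨_, unit_mem h⟩
  obtain ⟨b, hb⟩ := ha d.1 d.2
  have h1 : (e a).1 * b = unit ρ (lt_of_succ h) := by
    rw [← equiv_apply_mul]
    rw [show op b • a = d from Subtype.ext hb.symm, hd]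
  have h2 : (ρ (e a).1).1 x y * (ρ b).1 y y = 1 := by
    have h3 := matAlg_apply_succ (ρ (e a).1) (ρ b) h
    rw [← map_mul, h1, unit_apply, (e a).2 x x fun h4 => lt_irrefl _ h4.2] at h3
    simpa using h3.symm
  exact left_ne_zero_of_mul_eq_one h2

theorem eq_of_projIdeal_equiv {x y : C.Side}
    (e : projIdeal ρ x ≃ₗ[Aᵐᵒᵖ] projIdeal ρ y) : y = x ∨ y = C.inv x := by
  have h1 := apply_ne_zero_of_equiv_projIdeal e ⟨idem ρ x, idem_mem x⟩
    fun d hd => ⟨d, (idem_mul_of_mem hd).symm⟩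
  have h2 : (e ⟨idem ρ x, idem_mem x⟩).1 * idem ρ x = (e ⟨idem ρ x, idem_mem x⟩).1 := by
    rw [← equiv_apply_mul]
    congr 2
    exact Subtype.ext (idem_mul_of_mem (idem_mem x))
  by_contra h3
  rw [← h2, mul_idem_apply, if_neg h3] at h1
  exact h1 rfl

/-- The generator of the ideal of an arrow on an `∞`-elementary polygon is annihilated by the next
arrow of this polygon, and so are its images; hence such an image is supported in one column of
the two columns of the end of the arrow. -/
theorem arrow_image_apply {p y z : C.Side} (h : C.succ p = some y) (h' : C.next y = some z)
    {N : Submodule Aᵐᵒᵖ A} (e : arrowIdeal ρ p ≃ₗ[Aᵐᵒᵖ] N) (w w' : C.Side) (hw' : w' ≠ y) :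
    (ρ (e ⟨_, unit_mem h⟩).1).1 w w' = 0 := by
  have h2 : (e ⟨_, unit_mem h⟩).1 * idem ρ y = (e ⟨_, unit_mem h⟩).1 := by
    rw [← equiv_apply_mul]
    congr 2
    refine Subtype.ext (ext_entry ρ fun w w' => ?_)
    change (ρ (unit ρ (lt_of_succ h) * idem ρ y)).1 w w' = _
    rw [mul_idem_apply, unit_apply]
    split_ifs <;> simp_all
  have h3 : (e ⟨_, unit_mem h⟩).1 * unit ρ (lt_of_succ h') = 0 := by
    have h4 : op (unit ρ (lt_of_succ h')) • (⟨_, unit_mem h⟩ : arrowIdeal ρ p) = 0 := by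
      refine Subtype.ext (ext_entry ρ fun w w' => ?_)
      change (ρ (unit ρ (lt_of_succ h) * unit ρ (lt_of_succ h'))).1 w w' = (ρ 0).1 w w'
      rw [mul_unit_apply, unit_apply, if_neg (c := _ ∧ _) (fun h4 => C.ne_inv _ h4.2), ite_self,
        map_zero]
      rfl
    rw [← equiv_apply_mul, h4, map_zero]
    rfl
  by_cases h4 : w' = C.inv y
  · have h5 := mul_unit_apply ρ (lt_of_succ h') (e ⟨_, unit_mem h⟩).1 w z
    rw [h3, map_zero, if_pos rfl] at h5
    rw [h4, ← h5]
    rfl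
  · rw [← h2, mul_idem_apply, if_neg (not_or.2 ⟨hw', h4⟩)]

/-- The ideal of an arrow on an `∞`-elementary polygon is not isomorphic to the ideal of an arc: the
image of a generator would have non-zero diagonal entries at both sides of the arc, but it is
supported in one column. -/
theorem arrowIdeal_not_equiv_projIdeal {e : C.Side} (he : C.Inf e) (x : C.Side) :
    IsEmpty (arrowIdeal ρ (C.inv e) ≃ₗ[Aᵐᵒᵖ] projIdeal ρ x) := by
  refine ⟨fun φ => ?_⟩
  obtain ⟨y, hy, hy'⟩ := he.exists_next
  obtain ⟨z, hz, -⟩ := hy'.exists_next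
  have h1 := apply_ne_zero_of_equiv_projIdeal φ ⟨_, unit_mem hy⟩
    fun d hd => (exists_eq_unit_mul hy hd).imp fun _ h => h.2.1
  by_cases hx : x = y
  · refine h1 ?_
    rw [← (ρ _).2.2]
    refine arrow_image_apply hy hz φ _ _ ?_
    rw [hx]
    exact C.inv_ne y
  · exact h1 (arrow_image_apply hy hz φ _ _ hx)

theorem eq_of_arrowIdeal_equiv {e f : C.Side} (he : C.Inf e) (hf : C.Inf f)
    (φ : arrowIdeal ρ (C.inv e) ≃ₗ[Aᵐᵒᵖ] arrowIdeal ρ (C.inv f)) : e = f := by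
  obtain ⟨y, hy, hy'⟩ := he.exists_next
  obtain ⟨z, hz, -⟩ := hy'.exists_next
  obtain ⟨w, hw, -⟩ := hf.exists_next
  have h1 := apply_ne_zero_of_equiv_arrowIdeal hw φ ⟨_, unit_mem hy⟩
    fun d hd => (exists_eq_unit_mul hy hd).imp fun _ h => h.2.1
  have h2 : w = y := by
    by_contra h2
    exact h1 (arrow_image_apply hy hz φ _ _ h2)
  exact next_inj hy (h2 ▸ hw)

end SideSystem

/-! ### Vanishing of extensions by the regular module -/

section ExtVanishing

open CategoryTheory

variable {R : Type v} [Ring R]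

/-- `Ext^n(G, R) = 0` for all `n ≥ 1`. -/
def ExtVanishing (R : Type v) [Ring R] (G : Type v) [AddCommGroup G] [Module R G] : Prop :=
  ∀ (n : ℕ) (e : Abelian.Ext.{v} (ModuleCat.of R G) (ModuleCat.of R R) (n + 1)), e = 0

theorem ExtVanishing.of_equiv {G G' : Type v} [AddCommGroup G] [Module R G] [AddCommGroup G']
    [Module R G'] (f : G ≃ₗ[R] G') (h : ExtVanishing R G) : ExtVanishing R G' := by
  intro n e
  have h1 : (Abelian.Ext.mk₀ (ModuleCat.ofHom f.toLinearMap)).comp e (zero_add _) = 0 := h n _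
  have h2 : (Abelian.Ext.mk₀ (ModuleCat.ofHom f.symm.toLinearMap)).comp
      ((Abelian.Ext.mk₀ (ModuleCat.ofHom f.toLinearMap)).comp e (zero_add _)) (zero_add _) = e := by
    rw [Abelian.Ext.mk₀_comp_mk₀_assoc]
    have h3 : ModuleCat.ofHom f.symm.toLinearMap ≫ ModuleCat.ofHom f.toLinearMap = 𝟙 _ := by
      ext a
      simp
    rw [h3, Abelian.Ext.mk₀_id_comp]
  rw [← h2, h1, Abelian.Ext.comp_zero]

/-- The short complex of an exact sequence of modules. -/
abbrev moduleComplex {K P G : Type v} [AddCommGroup K] [Module R K] [AddCommGroup P] [Module R P]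
    [AddCommGroup G] [Module R G] (f : K →ₗ[R] P) (g : P →ₗ[R] G) (h : g ∘ₗ f = 0) :
    ShortComplex (ModuleCat.{v} R) :=
  ShortComplex.mk (ModuleCat.ofHom f) (ModuleCat.ofHom g)
    (by rw [← ModuleCat.ofHom_comp, h]; rfl)

variable {K P G : Type v} [AddCommGroup K] [Module R K] [AddCommGroup P] [Module R P]
  [AddCommGroup G] [Module R G] {f : K →ₗ[R] P} {g : P →ₗ[R] G}

theorem moduleComplex_shortExact (hf : Function.Injective f) (hg : Function.Surjective g)
    (hfg : Function.Exact f g) : (moduleComplex f g hfg.linearMap_comp_eq_zero).ShortExact where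
  exact := (ShortComplex.ShortExact.moduleCat_exact_iff_function_exact _).2 hfg
  mono_f := (ModuleCat.mono_iff_injective _).2 hf
  epi_g := (ModuleCat.epi_iff_surjective _).2 hg

theorem ext_projective_eq_zero [Module.Projective R P] (Y : ModuleCat.{v} R) (n : ℕ)
    (e : Abelian.Ext.{v} (ModuleCat.of R P) Y (n + 1)) : e = 0 := by
  have : Projective (ModuleCat.of R P) := (IsProjective.iff_projective P).1 inferInstance
  exact e.eq_zero_of_projective

/-- The vanishing of extensions passes to syzygies. -/
theorem ExtVanishing.syzygy [Module.Projective R P] (hf : Function.Injective f)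
    (hg : Function.Surjective g) (hfg : Function.Exact f g) (h : ExtVanishing R G) :
    ExtVanishing R K := by
  intro n e
  have hS := moduleComplex_shortExact hf hg hfg
  obtain ⟨x, rfl⟩ := Abelian.Ext.contravariant_sequence_exact₁ hS (ModuleCat.of R R) e
    (add_comm 1 (n + 1)) (h (n + 1) _)
  rw [ext_projective_eq_zero _ n x, Abelian.Ext.comp_zero]

/-- If the extensions vanish, then functionals extend from the syzygy. -/
theorem ExtVanishing.exists_extend (hf : Function.Injective f) (hg : Function.Surjective g)
    (hfg : Function.Exact f g) (h : ExtVanishing R G) (φ : K →ₗ[R] R) :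
    ∃ ψ : P →ₗ[R] R, ψ ∘ₗ f = φ := by
  have hS := moduleComplex_shortExact hf hg hfg
  obtain ⟨x, hx⟩ := Abelian.Ext.contravariant_sequence_exact₁ hS (ModuleCat.of R R)
    (Abelian.Ext.mk₀ (ModuleCat.ofHom φ)) (add_zero 1) (h 0 _)
  obtain ⟨ψ, rfl⟩ := Abelian.Ext.homEquiv₀.symm.surjective x
  refine ⟨ψ.hom, ?_⟩
  have h1 : Abelian.Ext.mk₀ (ModuleCat.ofHom f ≫ ψ) = Abelian.Ext.mk₀ (ModuleCat.ofHom φ) := by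
    rw [← hx, Abelian.Ext.homEquiv₀_symm_apply, Abelian.Ext.mk₀_comp_mk₀]
  have h2 := (Abelian.Ext.mk₀_bijective _ _).1 h1
  exact congrArg ModuleCat.Hom.hom h2

/-- `Ext^(n+1)(G, R)` vanishes if every class in `Ext^n(K, R)` extends from the syzygy `K` of `G` to
the projective module `P`. -/
theorem ext_eq_zero_of_syzygy [Module.Projective R P] (hf : Function.Injective f)
    (hg : Function.Surjective g) (hfg : Function.Exact f g) (n : ℕ)
    (h : ∀ e : Abelian.Ext.{v} (ModuleCat.of R K) (ModuleCat.of R R) n,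
      ∃ e', (Abelian.Ext.mk₀ (ModuleCat.ofHom f)).comp e' (zero_add n) = e)
    (e : Abelian.Ext.{v} (ModuleCat.of R G) (ModuleCat.of R R) (n + 1)) : e = 0 := by
  have hS := moduleComplex_shortExact hf hg hfg
  obtain ⟨x, rfl⟩ := Abelian.Ext.contravariant_sequence_exact₃ hS (ModuleCat.of R R) e
    (ext_projective_eq_zero _ n _) (add_comm 1 n)
  obtain ⟨y, rfl⟩ := h x
  exact hS.extClass_comp_assoc y

/-- A Gorenstein-projective module has no extensions by the regular module. The induction is over
all the images of the complex: a functional on one of them extends by total acyclicity, and in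
higher degrees the classes on the syzygy vanish. -/
theorem IsGorensteinProjective.extVanishing {G : Type v} [AddCommGroup G] [Module R G]
    (h : IsGorensteinProjective R G) : ExtVanishing R G := by
  obtain ⟨P, d, -, hP, hd, hd', ⟨φ⟩⟩ := h
  have key : ∀ (n : ℕ) (i : ℤ) (e : Abelian.Ext.{v} (ModuleCat.of R (LinearMap.range (d i)))
      (ModuleCat.of R R) (n + 1)), e = 0 := by
    intro n
    induction n with
    | zero =>
      intro i e
      obtain ⟨j, rfl⟩ : ∃ j, i = j + 1 + 1 := ⟨i - 2, by ring⟩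
      have := hP (j + 1 + 1)
      refine ext_eq_zero_of_syzygy (f := (LinearMap.range (d (j + 1))).subtype)
        (g := (d (j + 1 + 1)).rangeRestrict) Subtype.val_injective
        (LinearMap.surjective_rangeRestrict _) ?_ 0 ?_ e
      · intro a
        rw [← Submodule.coe_eq_zero]
        exact (hd (j + 1) a).trans (by simp)
      · intro e
        obtain ⟨α, rfl⟩ := Abelian.Ext.homEquiv₀.symm.surjective e
        obtain ⟨β, hβ⟩ := hd' j (α.hom ∘ₗ (d (j + 1)).rangeRestrict) (by
          refine LinearMap.ext fun a => ?_
          have h1 : (d (j + 1)).rangeRestrict (d j a) = 0 :=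
            Subtype.ext ((hd j (d j a)).2 ⟨a, rfl⟩)
          rw [LinearMap.comp_apply, LinearMap.comp_apply, h1, map_zero, LinearMap.zero_apply])
        refine ⟨Abelian.Ext.mk₀ (ModuleCat.ofHom β), ?_⟩
        rw [Abelian.Ext.homEquiv₀_symm_apply, Abelian.Ext.mk₀_comp_mk₀]
        congr 1
        ext ⟨_, ⟨a, rfl⟩⟩
        exact (LinearMap.congr_fun hβ a).symm
    | succ n ih =>
      intro i e
      obtain ⟨j, rfl⟩ : ∃ j, i = j + 1 := ⟨i - 1, by ring⟩
      have := hP (j + 1)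
      refine ext_eq_zero_of_syzygy (f := (LinearMap.range (d j)).subtype)
        (g := (d (j + 1)).rangeRestrict) Subtype.val_injective
        (LinearMap.surjective_rangeRestrict _) ?_ (n + 1) ?_ e
      · intro a
        rw [← Submodule.coe_eq_zero]
        exact (hd j a).trans (by simp)
      · intro e
        exact ⟨0, by rw [Abelian.Ext.comp_zero, ih j e]⟩
  exact ExtVanishing.of_equiv φ.symm (fun n => key n 0)

end ExtVanishing

/-! ### Indecomposable submodules of free modules -/

open MulOpposite

/-- A non-zero direct summand of an indecomposable module is the whole module. -/
theorem IsIndecomposableModule.equiv_of_retract {R : Type v} [Ring R] {G : Type v} [AddCommGroup G]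
    [Module R G] (h : IsIndecomposableModule R G) {M : Type v} [AddCommGroup M] [Module R M]
    [Nontrivial M] (i : M →ₗ[R] G) (r : G →ₗ[R] M) (hri : ∀ m, r (i m) = m) :
    Nonempty (G ≃ₗ[R] M) := by
  have hc : IsCompl (LinearMap.range i) (LinearMap.ker r) := by
    constructor
    · rw [Submodule.disjoint_def]
      rintro _ ⟨m, rfl⟩ hm
      rw [LinearMap.mem_ker, hri] at hm
      rw [hm, map_zero]
    · rw [codisjoint_iff, eq_top_iff]
      intro g _
      rw [← add_sub_cancel (i (r g)) g]
      exact Submodule.add_mem_sup ⟨_, rfl⟩ (by rw [LinearMap.mem_ker, map_sub, hri, sub_self])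
  refine ⟨LinearEquiv.ofBijective r ⟨?_, fun m => ⟨i m, hri m⟩⟩⟩
  rcases h.2 _ _ hc with h1 | h1
  · obtain ⟨m, hm⟩ := exists_ne (0 : M)
    refine (hm ?_).elim
    have : i m ∈ (⊥ : Submodule R G) := h1 ▸ ⟨m, rfl⟩
    rw [← hri m, (Submodule.mem_bot R).1 this, map_zero]
  · exact LinearMap.ker_eq_bot.1 h1

namespace SideSystem

variable {C : SideSystem} {k : Type u} [Field k] {A : Type v} [Ring A] [Algebra k A]
  {ρ : A ≃ₐ[k] C.matAlg k} {n : ℕ}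

/-- The column `z` of a vector of matrices, which are stacked on top of each other. -/
noncomputable def col (ρ : A ≃ₐ[k] C.matAlg k) (n : ℕ) (z : C.Side) :
    (Fin n → A) →ₗ[k] (Fin n × C.Side → k) where
  toFun m i := (ρ (m i.1)).1 i.2 z
  map_add' a b := by ext i; simp
  map_smul' c a := by ext i; simp

theorem col_apply (z : C.Side) (m : Fin n → A) (i : Fin n × C.Side) :
    col ρ n z m i = (ρ (m i.1)).1 i.2 z := rfl

theorem ext_col {m m' : Fin n → A} (h : ∀ z, col ρ n z m = col ρ n z m') : m = m' :=
  funext fun i => ext_entry ρ fun x y => congrFun (h y) (i, x)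

theorem col_smul (z : C.Side) (b : A) (m : Fin n → A) :
    col ρ n z (op b • m) = ∑ w, (ρ b).1 w z • col ρ n w m := by
  ext i
  rw [col_apply, Pi.smul_apply, op_smul_eq_mul, apply_mul_entry, Finset.sum_apply]
  exact Finset.sum_congr rfl fun w _ => mul_comm _ _

theorem col_smul_unit {x y : C.Side} (h : x < y) (z : C.Side) (m : Fin n → A) :
    col ρ n z (op (unit ρ h) • m) = if z = y then col ρ n x m else 0 := by
  ext i
  rw [col_apply, Pi.smul_apply, op_smul_eq_mul, mul_unit_apply]
  split_ifs <;> rfl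

theorem col_smul_idem (x z : C.Side) (m : Fin n → A) :
    col ρ n z (op (idem ρ x) • m) = if z = x ∨ z = C.inv x then col ρ n z m else 0 := by
  ext i
  rw [col_apply, Pi.smul_apply, op_smul_eq_mul, mul_idem_apply]
  split_ifs <;> rfl

variable (N : Submodule Aᵐᵒᵖ (Fin n → A))

/-- The columns at `y` of the elements of `N` which are supported in the column `y`. -/
def pureCol (ρ : A ≃ₐ[k] C.matAlg k) (y : C.Side) : Submodule k (Fin n × C.Side → k) where
  carrier := {a | ∃ m ∈ N, col ρ n y m = a ∧ ∀ w, w ≠ y → col ρ n w m = 0}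
  add_mem' := by
    rintro _ _ ⟨m, hm, rfl, h⟩ ⟨m', hm', rfl, h'⟩
    exact ⟨m + m', N.add_mem hm hm', map_add _ _ _, fun w hw => by
      rw [map_add, h w hw, h' w hw, add_zero]⟩
  zero_mem' := ⟨0, N.zero_mem, map_zero _, fun w _ => map_zero _⟩
  smul_mem' := by
    rintro c _ ⟨m, hm, rfl, h⟩
    exact ⟨c • m, (N.restrictScalars k).smul_mem c hm, map_smul _ _ _, fun w hw => by
      rw [map_smul, h w hw, smul_zero]⟩

/-- The span of the columns of the elements of `N` at the places before `y`. -/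
def priorCol (ρ : A ≃ₐ[k] C.matAlg k) (y : C.Side) : Submodule k (Fin n × C.Side → k) :=
  Submodule.span k {a | ∃ z < y, ∃ m ∈ N, a = col ρ n z m}

variable {N}

theorem col_mem_priorCol {z y : C.Side} (h : z < y) {m : Fin n → A} (hm : m ∈ N) :
    col ρ n z m ∈ priorCol N ρ y :=
  Submodule.subset_span ⟨z, h, m, hm, rfl⟩

/-- A functional on the columns which vanishes on the columns before `x` gives a homomorphism
of right modules from `N` to row vectors that start at `x`. -/
theorem row_smul {x : C.Side} (φ : (Fin n × C.Side → k) →ₗ[k] k)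
    (hφ : ∀ a ∈ priorCol N ρ x, φ a = 0) [DecidableRel (α := C.Side) (· ≤ ·)]
    {m : Fin n → A} (hm : m ∈ N) (b : A)
    (z : C.Side) : (if x ≤ z then φ (col ρ n z (op b • m)) else 0) =
      ∑ w, (if x ≤ w then φ (col ρ n w m) else 0) * (ρ b).1 w z := by
  have h1 : ∀ w, x ≤ z → (ρ b).1 w z * φ (col ρ n w m) =
      (if x ≤ w then φ (col ρ n w m) else 0) * (ρ b).1 w z := by
    intro w hxz
    by_cases hw : w ≤ z
    · rcases le_or_lt_of_le hxz hw with h2 | h2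
      · rw [if_pos h2, mul_comm]
      · rw [hφ _ (col_mem_priorCol h2 hm), mul_zero, ite_self, zero_mul]
    · rw [(ρ b).2.1 w z hw, zero_mul, mul_zero]
  split_ifs with hxz
  · rw [col_smul, map_sum]
    simp only [map_smul, smul_eq_mul]
    exact Finset.sum_congr rfl fun w _ => h1 w hxz
  · symm
    refine Finset.sum_eq_zero fun w _ => ?_
    split_ifs with hw
    · rw [(ρ b).2.1 w z fun h2 => hxz (hw.trans h2), mul_zero]
    · rw [zero_mul]

open Classical in
/-- The matrix with a single row `p`, which consists of the values of a functional on the columns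
of `m` from `x` on. -/
noncomputable def rowMat (ρ : A ≃ₐ[k] C.matAlg k) (p x : C.Side)
    (φ : (Fin n × C.Side → k) →ₗ[k] k) (m : Fin n → A) : Matrix C.Side C.Side k :=
  Matrix.of fun y z => if y = p then if x ≤ z then φ (col ρ n z m) else 0 else 0

open Classical in
theorem rowMat_apply (p x : C.Side) (φ : (Fin n × C.Side → k) →ₗ[k] k) (m : Fin n → A)
    (y z : C.Side) : rowMat ρ p x φ m y z =
      if y = p then if x ≤ z then φ (col ρ n z m) else 0 else 0 := rfl

theorem rowMat_add (p x : C.Side) (φ : (Fin n × C.Side → k) →ₗ[k] k) (m m' : Fin n → A) :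
    rowMat ρ p x φ (m + m') = rowMat ρ p x φ m + rowMat ρ p x φ m' := by
  ext y z
  simp only [rowMat_apply, Matrix.add_apply, map_add]
  split_ifs <;> simp

theorem rowMat_smul (p x : C.Side) (φ : (Fin n × C.Side → k) →ₗ[k] k)
    (hφ : ∀ a ∈ priorCol N ρ x, φ a = 0) {m : Fin n → A} (hm : m ∈ N) (b : A) :
    rowMat ρ p x φ (op b • m) = rowMat ρ p x φ m * (ρ b).1 := by
  classical
  ext y z
  rw [rowMat_apply, row_smul φ hφ hm, Matrix.mul_apply]
  simp only [rowMat_apply]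
  by_cases hy : y = p <;> simp [hy]

theorem rowMat_eq_zero {p x : C.Side} (h : p ≤ x) (φ : (Fin n × C.Side → k) →ₗ[k] k)
    (m : Fin n → A) {y z : C.Side} (hyz : ¬ y ≤ z) : rowMat ρ p x φ m y z = 0 := by
  rw [rowMat_apply, ← ite_and, if_neg]
  rintro ⟨rfl, h1⟩
  exact hyz (h.trans h1)

theorem rowMat_mem {p x : C.Side} (h : p < x) (φ : (Fin n × C.Side → k) →ₗ[k] k)
    (m : Fin n → A) : rowMat ρ p x φ m ∈ C.matAlg k := by
  have hp : ∀ y, rowMat ρ p x φ m y y = 0 := by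
    intro y
    rw [rowMat_apply, ← ite_and, if_neg]
    rintro ⟨rfl, h1⟩
    exact h.not_ge h1
  exact ⟨fun y z => rowMat_eq_zero h.le φ m, fun y => by rw [hp, hp]⟩

theorem rowMat_add_rowMat_mem (x : C.Side) (φ φ' : (Fin n × C.Side → k) →ₗ[k] k) (m : Fin n → A)
    (h : φ (col ρ n x m) = φ' (col ρ n (C.inv x) m)) :
    rowMat ρ x x φ m + rowMat ρ (C.inv x) (C.inv x) φ' m ∈ C.matAlg k := by
  refine ⟨fun y z hyz => ?_, fun y => ?_⟩
  · rw [Matrix.add_apply, rowMat_eq_zero le_rfl φ m hyz, rowMat_eq_zero le_rfl φ' m hyz, add_zero]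
  · simp only [Matrix.add_apply, rowMat_apply, inv_eq_iff, C.inv_inv]
    by_cases h1 : y = x
    · subst h1; simp [h]
    · by_cases h2 : y = C.inv x
      · subst h2; simp [h]
      · simp [h1, h2]

theorem ofMatrix_add (M M' : Matrix C.Side C.Side k) (h : M ∈ C.matAlg k) (h' : M' ∈ C.matAlg k) :
    ofMatrix ρ M h + ofMatrix ρ M' h' = ofMatrix ρ (M + M') (add_mem h h') :=
  (map_add ρ.symm _ _).symm

theorem ofMatrix_mul (M : Matrix C.Side C.Side k) (h : M ∈ C.matAlg k) (b : A) :
    ofMatrix ρ M h * b = ofMatrix ρ (M * (ρ b).1) (mul_mem h (ρ b).2) := by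
  have h1 := map_mul ρ.symm ⟨M, h⟩ (ρ b)
  rw [ρ.symm_apply_apply] at h1
  exact h1.symm

/-- The homomorphism from `N` to the ideal of the arrow from `p` to `x` given by a functional. -/
noncomputable def toArrowIdeal {p x : C.Side} (h : C.succ p = some x)
    (φ : (Fin n × C.Side → k) →ₗ[k] k) (hφ : ∀ a ∈ priorCol N ρ x, φ a = 0) :
    N →ₗ[Aᵐᵒᵖ] arrowIdeal ρ p where
  toFun m := ⟨ofMatrix ρ (rowMat ρ p x φ m.1) (rowMat_mem (lt_of_succ h) φ m.1), fun y z hyz => by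
    rw [ofMatrix_apply, rowMat_apply, ← ite_and, if_neg]
    exact fun h1 => hyz ⟨h1.1, (lt_of_succ h).trans_le h1.2⟩⟩
  map_add' m m' := by
    refine Subtype.ext ?_
    simp only [Submodule.coe_add, rowMat_add, ofMatrix_add]
  map_smul' b m := by
    refine Subtype.ext ?_
    rw [← op_unop b]
    simp only [RingHom.id_apply, Submodule.coe_smul, op_smul_eq_mul, rowMat_smul p x φ hφ m.2,
      ofMatrix_mul]

theorem toArrowIdeal_apply {p x : C.Side} (h : C.succ p = some x)
    (φ : (Fin n × C.Side → k) →ₗ[k] k) (hφ : ∀ a ∈ priorCol N ρ x, φ a = 0) (m : N)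
    (y z : C.Side) : (ρ (toArrowIdeal h φ hφ m).1).1 y z = rowMat ρ p x φ m.1 y z :=
  ofMatrix_apply ρ _ _ y z

/-- The homomorphism from `N` to the ideal of the arc of `x` given by two functionals. -/
noncomputable def toProjIdeal (x : C.Side) (φ φ' : (Fin n × C.Side → k) →ₗ[k] k)
    (hφ : ∀ a ∈ priorCol N ρ x, φ a = 0) (hφ' : ∀ a ∈ priorCol N ρ (C.inv x), φ' a = 0)
    (h : ∀ m ∈ N, φ (col ρ n x m) = φ' (col ρ n (C.inv x) m)) :
    N →ₗ[Aᵐᵒᵖ] projIdeal ρ x where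
  toFun m := ⟨ofMatrix ρ (rowMat ρ x x φ m.1 + rowMat ρ (C.inv x) (C.inv x) φ' m.1)
      (rowMat_add_rowMat_mem x φ φ' m.1 (h m.1 m.2)), fun y z h1 h2 => by
    rw [ofMatrix_apply, Matrix.add_apply, rowMat_apply, rowMat_apply, if_neg h1, if_neg h2,
      add_zero]⟩
  map_add' m m' := by
    refine Subtype.ext ?_
    simp only [Submodule.coe_add, rowMat_add, ofMatrix_add]
    congr 1
    abel
  map_smul' b m := by
    refine Subtype.ext ?_
    rw [← op_unop b]
    simp only [RingHom.id_apply, Submodule.coe_smul, op_smul_eq_mul, rowMat_smul _ _ φ hφ m.2,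
      rowMat_smul _ _ φ' hφ' m.2, ofMatrix_mul, add_mul]

theorem toProjIdeal_apply_self (x : C.Side) (φ φ' : (Fin n × C.Side → k) →ₗ[k] k)
    (hφ : ∀ a ∈ priorCol N ρ x, φ a = 0) (hφ' : ∀ a ∈ priorCol N ρ (C.inv x), φ' a = 0)
    (h : ∀ m ∈ N, φ (col ρ n x m) = φ' (col ρ n (C.inv x) m)) (m : N) :
    (ρ (toProjIdeal x φ φ' hφ hφ' h m).1).1 x x = φ (col ρ n x m.1) := by
  refine (ofMatrix_apply ρ _ _ x x).trans ?_
  rw [Matrix.add_apply, rowMat_apply, rowMat_apply]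
  simp

/-- If some element of an indecomposable `N` is supported in the column `y`, and is new at this
place, then `N` is isomorphic to the right ideal of an arrow ending at `y`. -/
theorem exists_equiv_arrowIdeal (hN : IsIndecomposableModule Aᵐᵒᵖ N) {y : C.Side}
    (h : ¬ pureCol N ρ y ≤ priorCol N ρ y) :
    ∃ p, C.succ p = some y ∧ Nonempty (N ≃ₗ[Aᵐᵒᵖ] arrowIdeal ρ p) := by
  obtain ⟨a, ⟨m, hm, rfl, hm0⟩, ha⟩ := Set.not_subset.1 h
  obtain ⟨φ, hφ1, hφ⟩ := Submodule.exists_dual_map_eq_bot_of_notMem ha inferInstance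
  have hφ' : ∀ a ∈ priorCol N ρ y, φ a = 0 := fun a ha => by
    have : φ a ∈ (priorCol N ρ y).map φ := ⟨a, ha, rfl⟩
    rwa [hφ] at this
  -- the non-zero column of `m` has an entry in a row before `y`
  obtain ⟨p, hp⟩ : ∃ p, C.succ p = some y := by
    have h1 : col ρ n y m ≠ 0 := fun h1 => hφ1 (by rw [h1, map_zero])
    obtain ⟨⟨i, x⟩, hi⟩ := Function.ne_iff.1 h1
    rw [col_apply] at hi
    have hxy : x < y := by
      refine lt_of_le_of_ne (by_contra fun h2 => hi ((ρ _).2.1 x y h2)) fun h2 => hi ?_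
      subst h2
      rw [← (ρ _).2.2]
      exact congrFun (hm0 (C.inv x) (C.inv_ne x)) (i, C.inv x)
    obtain ⟨p, -, hp⟩ := exists_le_pred hxy
    exact ⟨p, hp⟩
  refine ⟨p, hp, ?_⟩
  have := (arrowIdeal_indecomposable (ρ := ρ) hp).1
  have hd : ∀ i, ∃ d, m i = d * unit ρ (lt_of_succ hp) := fun i =>
    exists_eq_mul_unit hp fun x z hz => congrFun (hm0 z hz) (i, x)
  choose d hd using hd
  have hmem : ∀ r : arrowIdeal ρ p, (fun i => d i * r.1) ∈ N := by
    rintro ⟨r, hr⟩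
    obtain ⟨b, -, rfl, -⟩ := exists_eq_unit_mul hp hr
    convert N.smul_mem (op b) hm using 1
    ext i
    rw [Pi.smul_apply, op_smul_eq_mul, hd i, mul_assoc]
  let c : k := φ (col ρ n y m)
  let i : arrowIdeal ρ p →ₗ[Aᵐᵒᵖ] N :=
    (LinearMap.pi fun i => (lmul (d i)).comp (arrowIdeal ρ p).subtype).codRestrict N hmem
  let r := toArrowIdeal (ρ := ρ) (N := N) hp (c⁻¹ • φ) (fun a ha => by simp [hφ' a ha])
  refine hN.equiv_of_retract i r ?_
  have h0 : r (i ⟨_, unit_mem hp⟩) = ⟨_, unit_mem hp⟩ := by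
    have h1 : (i ⟨_, unit_mem hp⟩).1 = m := funext fun i => (hd i).symm
    refine Subtype.ext (ext_entry ρ fun w z => ?_)
    rw [toArrowIdeal_apply, h1, rowMat_apply, unit_apply]
    by_cases hz : z = y
    · subst hz
      have : c⁻¹ * φ (col ρ n z m) = 1 := inv_mul_cancel₀ hφ1
      simp [this, eq_comm]
    · simp [hm0 z hz, Ne.symm hz]
  rintro ⟨s, hs⟩
  obtain ⟨b, -, rfl, -⟩ := exists_eq_unit_mul hp hs
  have h1 : (⟨_, hs⟩ : arrowIdeal ρ p) = op b • ⟨_, unit_mem hp⟩ := rfl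
  rw [h1, map_smul, map_smul, h0]

/-- An indecomposable submodule of a free right module is isomorphic to the right ideal of an arc
or of an arrow.  (If no column of an element of `N` gives an arrow ideal as a direct summand, a
column which is non-zero as early as possible gives the ideal of an arc.) -/
theorem exists_equiv_of_indecomposable (ρ : A ≃ₐ[k] C.matAlg k)
    (hN : IsIndecomposableModule Aᵐᵒᵖ N) :
    (∃ x, Nonempty (N ≃ₗ[Aᵐᵒᵖ] projIdeal ρ x)) ∨
      ∃ p x, C.succ p = some x ∧ Nonempty (N ≃ₗ[Aᵐᵒᵖ] arrowIdeal ρ p) := by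
  by_cases hA : ∀ y, pureCol N ρ y ≤ priorCol N ρ y
  swap
  · push Not at hA
    obtain ⟨y, hy⟩ := hA
    obtain ⟨p, hp, e⟩ := exists_equiv_arrowIdeal hN hy
    exact Or.inr ⟨p, y, hp, e⟩
  left
  have hne : {x | ∃ m ∈ N, col ρ n x m ≠ 0}.Nonempty := by
    have := hN.1
    obtain ⟨⟨m, hm⟩, hm0⟩ := exists_ne (0 : N)
    by_contra h
    refine hm0 (Subtype.ext (ext_col (ρ := ρ) fun z => ?_))
    by_contra h1
    exact h ⟨z, m, hm, fun h2 => h1 (by rw [h2]; exact (map_zero _).symm)⟩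
  obtain ⟨x, ⟨m, hm, hm0⟩, hx⟩ :=
    (wellFounded_lt (α := C.Side)).has_min _ hne
  have hprior : ∀ a ∈ priorCol N ρ x, a = 0 := by
    intro a ha
    have h1 : priorCol N ρ x ≤ ⊥ := by
      refine Submodule.span_le.2 ?_
      rintro _ ⟨z, hz, m, hm, rfl⟩
      by_contra h2
      exact hx z ⟨m, hm, h2⟩ hz
    exact h1 ha
  have hx0 : ∀ a ∈ pureCol N ρ x, a = 0 := fun a ha => hprior a (hA x ha)
  -- the columns of the elements of `N` at `x` and `inv x`
  have hmem : ∀ m ∈ N, ∀ y, (∀ w, w ≠ y → (w = x ∨ w = C.inv x) → col ρ n w m = 0) →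
      (y = x ∨ y = C.inv x) → col ρ n y m ∈ pureCol N ρ y := by
    intro m hm y h1 h2
    refine ⟨op (idem ρ x) • m, N.smul_mem _ hm, by rw [col_smul_idem, if_pos h2], fun w hw => ?_⟩
    rw [col_smul_idem]
    split_ifs with h3
    · exact h1 w hw h3
    · rfl
  have hb : col ρ n (C.inv x) m ∉ priorCol N ρ (C.inv x) := by
    intro h1
    -- otherwise the column at `inv x` can be cancelled
    have h2 : priorCol N ρ (C.inv x) ≤ pureCol N ρ (C.inv x) := by
      refine Submodule.span_le.2 ?_
      rintro _ ⟨z, hz, m, hm, rfl⟩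
      refine ⟨op (unit ρ hz) • m, N.smul_mem _ hm, by rw [col_smul_unit, if_pos rfl],
        fun w hw => by rw [col_smul_unit, if_neg hw]⟩
    obtain ⟨m', hm', h3, h4⟩ := h2 h1
    have h5 := hmem (m - m') (N.sub_mem hm hm') x (fun w hw h5 => by
      rw [h5.resolve_left hw, map_sub, h3, sub_self]) (Or.inl rfl)
    rw [map_sub, h4 x (C.ne_inv x), sub_zero] at h5
    exact hm0 (hx0 _ h5)
  obtain ⟨φ', hφ1, hφ⟩ := Submodule.exists_dual_map_eq_bot_of_notMem hb inferInstance
  have hφ' : ∀ a ∈ priorCol N ρ (C.inv x), φ' a = 0 := fun a ha => by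
    have : φ' a ∈ (priorCol N ρ (C.inv x)).map φ' := ⟨a, ha, rfl⟩
    rwa [hφ] at this
  obtain ⟨φ, hφφ'⟩ : ∃ φ : (Fin n × C.Side → k) →ₗ[k] k,
      ∀ m ∈ N, φ (col ρ n x m) = φ' (col ρ n (C.inv x) m) := by
    let N' := N.restrictScalars k
    let f : N' →ₗ[k] (Fin n × C.Side → k) := col ρ n x ∘ₗ N'.subtype
    let g : Module.Dual k N' := φ' ∘ₗ col ρ n (C.inv x) ∘ₗ N'.subtype
    have hg : g ∈ LinearMap.range f.dualMap := by
      rw [LinearMap.range_dualMap_eq_dualAnnihilator_ker, Submodule.mem_dualAnnihilator]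
      rintro ⟨m, hm⟩ h1
      refine hφ' _ (hA _ (hmem m hm _ (fun w hw h2 => ?_) (Or.inr rfl)))
      rw [h2.resolve_right hw]
      exact h1
    obtain ⟨φ, hφ⟩ := hg
    exact ⟨φ, fun m hm => LinearMap.congr_fun hφ ⟨m, hm⟩⟩
  let r := toProjIdeal (ρ := ρ) (N := N) x φ φ' (fun a ha => by rw [hprior a ha, map_zero]) hφ' hφφ'
  have hr : Function.Surjective r := by
    rintro ⟨d, hd⟩
    obtain ⟨b, rfl⟩ := projIdeal_generator (r ⟨m, hm⟩).2 (by
      rw [toProjIdeal_apply_self, hφφ' m hm]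
      exact hφ1) hd
    refine ⟨op b • ⟨m, hm⟩, ?_⟩
    rw [map_smul]
    rfl
  obtain ⟨i, hi⟩ := Module.projective_lifting_property r LinearMap.id hr
  have := (projIdeal_indecomposable (ρ := ρ) x).1
  exact ⟨x, hN.equiv_of_retract i r fun m => LinearMap.congr_fun hi m⟩

end SideSystem

/-! ### Classification of the indecomposable Gorenstein-projective modules -/

open MulOpposite

/-- A Gorenstein-projective right module embeds into a free module of finite rank. -/
theorem IsGorensteinProjective.exists_embedding {A : Type v} [Ring A] {G : Type v} [AddCommGroup G]
    [Module Aᵐᵒᵖ G] (h : IsGorensteinProjective Aᵐᵒᵖ G) :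
    ∃ (n : ℕ) (N : Submodule Aᵐᵒᵖ (Fin n → A)), Nonempty (G ≃ₗ[Aᵐᵒᵖ] N) := by
  obtain ⟨P, d, hfin, hproj, -, -, ⟨φ⟩⟩ := h
  have := hfin (0 + 1)
  have := hproj (0 + 1)
  obtain ⟨n, f, hf⟩ := Module.Finite.exists_fin' Aᵐᵒᵖ (P (0 + 1))
  obtain ⟨s, hs⟩ := Module.projective_lifting_property f LinearMap.id hf
  let e : (Fin n → A) ≃ₗ[Aᵐᵒᵖ] (Fin n → Aᵐᵒᵖ) := LinearEquiv.piCongrRight fun _ => regularEquiv A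
  have hinj : Function.Injective (e.symm.toLinearMap ∘ₗ s) :=
    e.symm.injective.comp (Function.LeftInverse.injective fun a => LinearMap.congr_fun hs a)
  exact ⟨n, _, ⟨φ.trans (Submodule.equivMapOfInjective _ hinj _)⟩⟩

namespace SideSystem

variable {C : SideSystem} {k : Type u} [Field k] {A : Type v} [Ring A] [Algebra k A]
  {ρ : A ≃ₐ[k] C.matAlg k}

/-- The projective cover of the right ideal of the arrow from `inv e` to `f = next e`. -/
noncomputable def arrowCover (ρ : A ≃ₐ[k] C.matAlg k) {e f : C.Side} (h : C.next e = some f) :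
    projIdeal ρ f →ₗ[Aᵐᵒᵖ] arrowIdeal ρ (C.inv e) :=
  ((lmul (unit ρ (lt_of_succ h))).comp (projIdeal ρ f).subtype).codRestrict _ fun a =>
    unit_mul_mem h a.1

theorem arrowCover_surjective {e f : C.Side} (h : C.next e = some f) :
    Function.Surjective (arrowCover ρ h) := by
  rintro ⟨a, ha⟩
  obtain ⟨d, hd, rfl, -⟩ := exists_eq_unit_mul h ha
  exact ⟨⟨d, hd⟩, rfl⟩

theorem arrowCover_eq_zero_iff {e f : C.Side} (h : C.next e = some f) (a : projIdeal ρ f) :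
    arrowCover ρ h a = 0 ↔ a.1 ∈ arrowIdeal ρ (C.inv f) := by
  rw [← arrowMap_eq_zero_iff h, ← Submodule.coe_eq_zero, ← Submodule.coe_eq_zero]
  rfl

/-- The syzygy of the ideal of an arrow is the ideal of the next arrow in the elementary
polygon. -/
noncomputable def arrowSyzygy (ρ : A ≃ₐ[k] C.matAlg k) (f : C.Side) :
    arrowIdeal ρ (C.inv f) →ₗ[Aᵐᵒᵖ] projIdeal ρ f :=
  Submodule.inclusion (by rw [← projIdeal_inv]; exact arrowIdeal_le _)

theorem arrowSyzygy_injective (f : C.Side) : Function.Injective (arrowSyzygy ρ f) :=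
  Submodule.inclusion_injective _

theorem arrow_exact {e f : C.Side} (h : C.next e = some f) :
    Function.Exact (arrowSyzygy ρ f) (arrowCover ρ h) := by
  intro a
  rw [arrowCover_eq_zero_iff]
  constructor
  · intro ha
    exact ⟨⟨a.1, ha⟩, rfl⟩
  · rintro ⟨b, rfl⟩
    exact b.2

/-- The projective cover of the ideal of the last arrow of an elementary polygon with a boundary
segment is injective, as there is no arrow in the kernel. -/
theorem arrowCover_injective {e f : C.Side} (h : C.next e = some f) (h' : C.next f = none) :
    Function.Injective (arrowCover ρ h) := by
  rw [injective_iff_map_eq_zero]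
  intro a ha
  rw [arrowCover_eq_zero_iff] at ha
  refine Subtype.ext (ext_entry ρ fun y z => ?_)
  refine (ha y z ?_).trans (by rw [Submodule.coe_zero, map_zero]; rfl)
  rintro ⟨rfl, h1⟩
  obtain ⟨w, hw, -⟩ := exists_succ_le h1
  rw [next, hw] at h'
  exact Option.some_ne_none _ h'

/-- The ideal of the last arrow of an elementary polygon with a boundary segment is projective. -/
noncomputable def arrowCoverEquiv (ρ : A ≃ₐ[k] C.matAlg k) {e f : C.Side} (h : C.next e = some f)
    (h' : C.next f = none) : projIdeal ρ f ≃ₗ[Aᵐᵒᵖ] arrowIdeal ρ (C.inv e) :=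
  LinearEquiv.ofBijective (arrowCover ρ h) ⟨arrowCover_injective h h', arrowCover_surjective h⟩

theorem arrowCoverEquiv_symm_apply {e f : C.Side} (h : C.next e = some f)
    (h' : C.next f = none) (a : projIdeal ρ f) :
    (arrowCoverEquiv ρ h h').symm (arrowCover ρ h a) = a :=
  (arrowCoverEquiv ρ h h').symm_apply_apply a

/-- The functional on the ideal of the last but one arrow which is inverse to left multiplication
by the last arrow does not extend to the projective ideal that contains it. -/
theorem not_exists_extend {f g : C.Side} (h' : C.next f = some g)
    (h'' : C.next g = none) (ψ : projIdeal ρ f →ₗ[Aᵐᵒᵖ] Aᵐᵒᵖ)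
    (hψ : ψ ∘ₗ arrowSyzygy ρ f = (regularEquiv A).toLinearMap ∘ₗ
    (projIdeal ρ g).subtype ∘ₗ (arrowCoverEquiv ρ h' h'').symm.toLinearMap) : False := by
  obtain ⟨c, -, hc⟩ := exists_lmul ψ
  have h1 : ψ (arrowSyzygy ρ f (arrowCover ρ h' ⟨idem ρ g, idem_mem g⟩)) = op (idem ρ g) :=
    (LinearMap.congr_fun hψ (arrowCover ρ h' ⟨idem ρ g, idem_mem g⟩)).trans
      (congrArg (fun b : projIdeal ρ g => op b.1) (arrowCoverEquiv_symm_apply h' h'' _))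
  rw [hc] at h1
  have h2 : c * (unit ρ (lt_of_succ h') * idem ρ g) = idem ρ g := op_injective h1
  have h3 : (ρ (c * (unit ρ (lt_of_succ h') * idem ρ g))).1 g g = 0 := by
    rw [← mul_assoc, mul_idem_apply, mul_unit_apply, if_pos (Or.inl rfl), if_pos rfl,
      (ρ c).2.1 _ _ (lt_of_succ h').not_ge]
  rw [h2, idem_apply, if_pos ⟨rfl, Or.inl rfl⟩] at h3
  exact one_ne_zero h3

/-- The ideal of an arrow which is followed by exactly one more arrow and then a boundary segment
has a non-zero extension by the regular module. -/
theorem not_extVanishing {e f g : C.Side} (h : C.next e = some f) (h' : C.next f = some g)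
    (h'' : C.next g = none) (hE : ExtVanishing Aᵐᵒᵖ (arrowIdeal ρ (C.inv e))) : False := by
  obtain ⟨ψ, hψ⟩ := ExtVanishing.exists_extend (arrowSyzygy_injective (ρ := ρ) f)
    (arrowCover_surjective h) (arrow_exact h) hE ((regularEquiv A).toLinearMap ∘ₗ
    (projIdeal ρ g).subtype ∘ₗ (arrowCoverEquiv ρ h' h'').symm.toLinearMap)
  exact not_exists_extend h' h'' ψ hψ

/-- If every side in `s` has a next side, which is again in `s`, then all of them lie on
`∞`-elementary polygons. -/
theorem inf_of_forall_next (s : Set C.Side) (hs : ∀ e ∈ s, ∃ f ∈ s, C.next e = some f)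
    {e : C.Side} (he : e ∈ s) : C.Inf e := by
  choose f hf hnext using hs
  let τ' : s → s := fun e => ⟨f e.1 e.2, hf e.1 e.2⟩
  have hinj : Function.Injective τ' := fun a b h =>
    Subtype.ext (next_inj (hnext a.1 a.2) (by rw [hnext b.1 b.2]; exact congrArg (some ·.1) h.symm))
  let τ : Equiv.Perm s := Equiv.ofBijective τ' (Finite.injective_iff_bijective.1 hinj)
  have hτ : ∀ a, C.next a.1 = some (τ a).1 := fun a => hnext a.1 a.2
  have hpow : ∀ (n : ℕ) (a : s),
      Relation.TransGen (fun x y => C.next x = some y) a.1 ((τ ^ (n + 1)) a).1 := by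
    intro n
    induction n with
    | zero => intro a; exact Relation.TransGen.single (hτ a)
    | succ n ih =>
      intro a
      rw [pow_succ' τ (n + 1)]
      exact (ih a).tail (hτ _)
  have h1 := hpow (orderOf τ - 1) ⟨e, he⟩
  rwa [Nat.sub_add_cancel (orderOf_pos τ), pow_orderOf_eq_one] at h1

/-- If the extensions of the ideal of an arrow by the regular module vanish, then this ideal is
projective or the arrow lies on an `∞`-elementary polygon. -/
theorem inf_or_equiv_of_extVanishing {e f : C.Side} (h : C.next e = some f)
    (hE : ExtVanishing Aᵐᵒᵖ (arrowIdeal ρ (C.inv e))) :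
    C.Inf e ∨ Nonempty (arrowIdeal ρ (C.inv e) ≃ₗ[Aᵐᵒᵖ] projIdeal ρ f) := by
  by_cases h' : C.next f = none
  · exact Or.inr ⟨(arrowCoverEquiv ρ h h').symm⟩
  left
  refine inf_of_forall_next {e | (∃ f, C.next e = some f ∧ C.next f ≠ none) ∧
    ExtVanishing Aᵐᵒᵖ (arrowIdeal ρ (C.inv e))} ?_ ⟨⟨f, h, h'⟩, hE⟩
  rintro e ⟨⟨f, hf, hf'⟩, hE⟩
  obtain ⟨g, hg⟩ := Option.ne_none_iff_exists'.1 hf'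
  refine ⟨f, ⟨⟨g, hg, fun hg' => not_extVanishing hf hg hg' hE⟩, ?_⟩, hf⟩
  exact hE.syzygy (arrowSyzygy_injective f) (arrowCover_surjective hf) (arrow_exact hf)

/-- The indecomposable Gorenstein-projective right modules are the right ideals of the arcs and of
the arrows on `∞`-elementary polygons. -/
theorem exists_equiv_of_gproj (ρ : A ≃ₐ[k] C.matAlg k) {G : Type v} [AddCommGroup G]
    [Module Aᵐᵒᵖ G] (hG : IsIndecomposableModule Aᵐᵒᵖ G) (hG' : IsGorensteinProjective Aᵐᵒᵖ G) :
    (∃ x, Nonempty (G ≃ₗ[Aᵐᵒᵖ] projIdeal ρ x)) ∨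
      ∃ e, C.Inf e ∧ Nonempty (G ≃ₗ[Aᵐᵒᵖ] arrowIdeal ρ (C.inv e)) := by
  obtain ⟨n, N, ⟨φ⟩⟩ := hG'.exists_embedding
  rcases exists_equiv_of_indecomposable ρ (hG.of_equiv φ) with ⟨x, ⟨ψ⟩⟩ | ⟨p, x, hp, ⟨ψ⟩⟩
  · exact Or.inl ⟨x, ⟨φ.trans ψ⟩⟩
  · obtain ⟨e, rfl⟩ : ∃ e, C.inv e = p := ⟨C.inv p, C.inv_inv p⟩
    have hE := hG'.extVanishing.of_equiv (φ.trans ψ)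
    rcases inf_or_equiv_of_extVanishing hp hE with h | ⟨⟨χ⟩⟩
    · exact Or.inr ⟨e, h, ⟨φ.trans ψ⟩⟩
    · exact Or.inl ⟨x, ⟨(φ.trans ψ).trans χ⟩⟩

/-- The predicate that `x` is the chosen one of the two sides of its arc.  The ideals of the two
sides coincide, so the chosen sides index the indecomposable projective modules. -/
def IsRep (C : SideSystem) (x : C.Side) : Prop :=
  Quot.out (Quot.mk (fun x y => y = C.inv x) x) = x

theorem isRep_or (x : C.Side) : C.IsRep x ∨ C.IsRep (C.inv x) := by
  have h1 : Quot.mk (fun x y => y = C.inv x) (C.inv x) = Quot.mk (fun x y => y = C.inv x) x :=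
    (Quot.sound (r := fun x y => y = C.inv x) rfl).symm
  have h2 : ∀ a b, Quot.mk (fun x y => y = C.inv x) a = Quot.mk (fun x y => y = C.inv x) b →
      a = b ∨ a = C.inv b := by
    intro a b h
    have h3 := congrArg (Quot.lift (fun x => ({x, C.inv x} : Set C.Side)) (by
      rintro a _ rfl
      rw [C.inv_inv, Set.pair_comm])) h
    have h4 : a ∈ ({b, C.inv b} : Set C.Side) := by
      have h5 : a ∈ ({a, C.inv a} : Set C.Side) := Set.mem_insert _ _
      exact (show ({a, C.inv a} : Set C.Side) = {b, C.inv b} from h3) ▸ h5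
    exact h4
  rcases h2 _ x (Quot.out_eq (Quot.mk (fun x y => y = C.inv x) x)) with h | h
  · exact Or.inl h
  · right
    rw [IsRep, h1]
    exact h

theorem IsRep.not_inv {x : C.Side} (h : C.IsRep x) : ¬ C.IsRep (C.inv x) := by
  intro h'
  rw [IsRep, ← show Quot.mk (fun x y => y = C.inv x) x =
    Quot.mk (fun x y => y = C.inv x) (C.inv x) from
      Quot.sound (r := fun x y => y = C.inv x) rfl] at h'
  exact C.ne_inv x (h.symm.trans h')

/-- The index set of the indecomposable Gorenstein-projective modules: the arcs, and the sides of
arcs on `∞`-elementary polygons. -/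
abbrev GIndex (C : SideSystem) : Type := {x // C.IsRep x} ⊕ {e // C.Inf e}

/-- The indecomposable Gorenstein-projective modules, as right ideals. -/
def gIdeal (ρ : A ≃ₐ[k] C.matAlg k) : C.GIndex → Submodule Aᵐᵒᵖ A
  | Sum.inl x => projIdeal ρ x.1
  | Sum.inr e => arrowIdeal ρ (C.inv e.1)

theorem gIdeal_indecomposable (i : C.GIndex) : IsIndecomposableModule Aᵐᵒᵖ (gIdeal ρ i) := by
  rcases i with x | e
  · exact projIdeal_indecomposable x.1
  · obtain ⟨f, hf, -⟩ := e.2.exists_next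
    exact arrowIdeal_indecomposable hf

theorem gIdeal_gproj (i : C.GIndex) : IsGorensteinProjective Aᵐᵒᵖ (gIdeal ρ i) := by
  rcases i with x | e
  · have h : IsGorensteinProjective Aᵐᵒᵖ (projIdeal ρ x.1) := .of_projective _
    exact h
  · exact arrowIdeal_gproj e.2

theorem gIdeal_finite (i : C.GIndex) : Module.Finite Aᵐᵒᵖ (gIdeal ρ i) := by
  rcases i with x | e
  · exact inferInstanceAs (Module.Finite Aᵐᵒᵖ (projIdeal ρ x.1))
  · obtain ⟨f, hf, -⟩ := e.2.exists_next
    exact Module.Finite.of_surjective _ (arrowCover_surjective (ρ := ρ) hf)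

/-- The listed modules are pairwise non-isomorphic. -/
theorem gIdeal_injective {i j : C.GIndex} (φ : gIdeal ρ i ≃ₗ[Aᵐᵒᵖ] gIdeal ρ j) : i = j := by
  rcases i with x | e <;> rcases j with y | f
  · rcases eq_of_projIdeal_equiv φ with h | h
    · exact congrArg Sum.inl (Subtype.ext h.symm)
    · exact (x.2.not_inv (h ▸ y.2)).elim
  · exact ((arrowIdeal_not_equiv_projIdeal f.2 x.1).false φ.symm).elim
  · exact ((arrowIdeal_not_equiv_projIdeal e.2 y.1).false φ).elim
  · exact congrArg Sum.inr (Subtype.ext (eq_of_arrowIdeal_equiv e.2 f.2 φ))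

theorem exists_gIdeal_equiv (ρ : A ≃ₐ[k] C.matAlg k) {G : Type v} [AddCommGroup G]
    [Module Aᵐᵒᵖ G] (hG : IsIndecomposableModule Aᵐᵒᵖ G) (hG' : IsGorensteinProjective Aᵐᵒᵖ G) :
    ∃ i, Nonempty (gIdeal ρ i ≃ₗ[Aᵐᵒᵖ] G) := by
  rcases exists_equiv_of_gproj ρ hG hG' with ⟨x, ⟨φ⟩⟩ | ⟨e, he, ⟨φ⟩⟩
  · rcases isRep_or x with h | h
    · exact ⟨Sum.inl ⟨x, h⟩, ⟨φ.symm⟩⟩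
    · exact ⟨Sum.inl ⟨_, h⟩, ⟨(LinearEquiv.ofEq _ _ (projIdeal_inv x)).trans φ.symm⟩⟩
  · exact ⟨Sum.inr ⟨e, he⟩, ⟨φ.symm⟩⟩

/-- The classification, as a bijection onto `ind (Gproj A)`. -/
theorem exists_indGproj_equiv (ρ : A ≃ₐ[k] C.matAlg k) :
    ∃ Θ : C.GIndex ≃ IndGproj A, ∀ i, Nonempty (gIdeal ρ i ≃ₗ[Aᵐᵒᵖ] (Θ i).rep) := by
  have h : ∀ i : C.GIndex, ∃ G : IndGproj A, Nonempty (gIdeal ρ i ≃ₗ[Aᵐᵒᵖ] G.rep) := by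
    intro i
    have := gIdeal_finite (ρ := ρ) i
    obtain ⟨F, ⟨φ⟩⟩ := exists_fgPresentation (A := A) (gIdeal ρ i)
    let F' : {G : FGPresentation A // IsIndecomposableModule Aᵐᵒᵖ G.module ∧
        IsGorensteinProjective Aᵐᵒᵖ G.module} :=
      ⟨F, (gIdeal_indecomposable i).of_equiv φ.symm, (gIdeal_gproj i).of_equiv φ.symm⟩
    obtain ⟨ψ⟩ : Quotient.out (Quotient.mk (gprojSetoid A) F') ≈ F' := Quotient.mk_out F'
    let G : IndGproj A := Quotient.mk (gprojSetoid A) F'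
    have χ : gIdeal ρ i ≃ₗ[Aᵐᵒᵖ] G.rep := φ.symm.trans ψ.symm
    exact ⟨G, ⟨χ⟩⟩
  choose Θ hΘ using h
  refine ⟨Equiv.ofBijective Θ ⟨fun i j hij => ?_, fun G => ?_⟩, hΘ⟩
  · obtain ⟨φ⟩ := hΘ i
    obtain ⟨ψ⟩ := hΘ j
    rw [← hij] at ψ
    exact gIdeal_injective (φ.trans ψ.symm)
  · obtain ⟨i, ⟨φ⟩⟩ := exists_gIdeal_equiv ρ (Quotient.out G).2.1 (Quotient.out G).2.2
    refine ⟨i, ?_⟩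
    obtain ⟨ψ⟩ := hΘ i
    rw [← Quotient.out_eq G, ← Quotient.out_eq (Θ i)]
    exact Quotient.sound ⟨ψ.symm.trans φ⟩

end SideSystem

/-! ### The side system of `𝐒^CMA` -/

open MulOpposite

namespace SideSystem

/-- The position of the sides in the chains of the system `C.cma`: the new side `(e, false)` is
inserted immediately after `inv e`, and the new sides `(e, true)` are isolated. -/
def cmaLT (C : SideSystem) : C.Side ⊕ {e : C.Side // C.Inf e} × Bool →
    C.Side ⊕ {e : C.Side // C.Inf e} × Bool → Prop
  | Sum.inl x, Sum.inl y => x < y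
  | Sum.inl x, Sum.inr (e, false) => x ≤ C.inv e.1
  | Sum.inr (e, false), Sum.inl y => C.inv e.1 < y
  | Sum.inr (e, false), Sum.inr (f, false) => C.inv e.1 < C.inv f.1
  | _, _ => False

open Classical in
/-- The successor function of `C.cma`. -/
noncomputable def cmaSucc (C : SideSystem) : C.Side ⊕ {e : C.Side // C.Inf e} × Bool →
    Option (C.Side ⊕ {e : C.Side // C.Inf e} × Bool)
  | Sum.inl x => if h : C.Inf (C.inv x) then some (Sum.inr (⟨C.inv x, h⟩, false))
      else (C.succ x).map Sum.inl
  | Sum.inr (e, false) => (C.next e.1).map Sum.inl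
  | Sum.inr (_, true) => none

variable {C : SideSystem}

theorem cmaLT_of_cmaSucc {a b : C.Side ⊕ {e : C.Side // C.Inf e} × Bool}
    (h : C.cmaSucc a = some b) : C.cmaLT a b := by
  rcases a with x | ⟨e, _ | _⟩
  · rw [cmaSucc] at h
    split_ifs at h with h1
    · cases h
      simp [cmaLT]
    · obtain ⟨y, hy, rfl⟩ := Option.map_eq_some_iff.1 h
      exact lt_of_succ hy
  · obtain ⟨y, hy, rfl⟩ := Option.map_eq_some_iff.1 h
    exact lt_of_succ hy
  · cases h

theorem cmaLT_trans {a b c : C.Side ⊕ {e : C.Side // C.Inf e} × Bool}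
    (h : C.cmaLT a b) (h' : C.cmaLT b c) : C.cmaLT a c := by
  rcases a with x | ⟨e, _ | _⟩ <;> rcases b with y | ⟨f, _ | _⟩ <;> rcases c with z | ⟨g, _ | _⟩ <;>
    simp only [cmaLT] at h h' ⊢
  · exact h.trans h'
  · exact h.le.trans h'
  · exact h.trans_lt h'
  · exact h.trans h'.le
  · exact h.trans h'
  · exact h.trans_le h'
  · exact h.trans h'
  · exact h.trans h'

theorem cmaLT_irrefl (a : C.Side ⊕ {e : C.Side // C.Inf e} × Bool) : ¬ C.cmaLT a a := by
  rcases a with x | ⟨e, _ | _⟩ <;> simp [cmaLT]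

theorem cmaLT_of_transGen {a b : C.Side ⊕ {e : C.Side // C.Inf e} × Bool}
    (h : Relation.TransGen (fun a b => C.cmaSucc a = some b) a b) : C.cmaLT a b := by
  induction h with
  | single h => exact cmaLT_of_cmaSucc h
  | tail _ h ih => exact cmaLT_trans ih (cmaLT_of_cmaSucc h)

variable (C)

/-- The side system of the surface `𝐒^CMA`.  For each side `e` on an `∞`-elementary polygon there is
a new arc, from the end of `e` to the inner boundary.  Its side `(e, false)` follows `e` in its
quadrilateral, and its side `(e, true)` precedes the side `next e`. -/
noncomputable def cma : SideSystem where
  Side := C.Side ⊕ {e : C.Side // C.Inf e} × Bool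
  inv
    | Sum.inl e => Sum.inl (C.inv e)
    | Sum.inr (e, b) => Sum.inr (e, !b)
  succ := C.cmaSucc
  inv_inv a := by rcases a with x | ⟨e, b⟩ <;> simp
  inv_ne a := by rcases a with x | ⟨e, b⟩ <;> simp
  succ_inj a b c h h' := by
    rcases a with x | ⟨e, _ | _⟩ <;> rcases b with y | ⟨f, _ | _⟩ <;>
      simp only [cmaSucc] at h h' <;> (try split_ifs at h) <;> (try split_ifs at h') <;>
      first
        | (cases h; done)
        | (cases h'; done)
        | skip
    · cases h
      simp only [Option.some.injEq, Sum.inr.injEq, Prod.mk.injEq, Subtype.mk.injEq] at h'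
      rw [inv_injective h'.1]
    · obtain ⟨y, hy, rfl⟩ := Option.map_eq_some_iff.1 h'
      cases h
    · obtain ⟨y, hy, rfl⟩ := Option.map_eq_some_iff.1 h
      cases h'
    · obtain ⟨z, hz, rfl⟩ := Option.map_eq_some_iff.1 h
      obtain ⟨w, hw, hwz⟩ := Option.map_eq_some_iff.1 h'
      cases hwz
      rw [C.succ_inj _ _ _ hz hw]
    · obtain ⟨y, hy, rfl⟩ := Option.map_eq_some_iff.1 h'
      cases h
    · obtain ⟨z, hz, rfl⟩ := Option.map_eq_some_iff.1 h
      obtain ⟨w, hw, hwz⟩ := Option.map_eq_some_iff.1 h'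
      cases hwz
      have hx := C.succ_inj _ _ _ hz hw
      have := f.2
      rw [← C.inv_inv f.1, ← hx] at this
      contradiction
    · obtain ⟨y, hy, rfl⟩ := Option.map_eq_some_iff.1 h
      cases h'
    · obtain ⟨z, hz, rfl⟩ := Option.map_eq_some_iff.1 h
      obtain ⟨w, hw, hwz⟩ := Option.map_eq_some_iff.1 h'
      cases hwz
      have hx := C.succ_inj _ _ _ hz hw
      have := e.2
      rw [← C.inv_inv e.1, hx] at this
      contradiction
    · obtain ⟨z, hz, rfl⟩ := Option.map_eq_some_iff.1 h
      obtain ⟨w, hw, hwz⟩ := Option.map_eq_some_iff.1 h'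
      cases hwz
      rw [Subtype.ext (next_inj hz hw)]
  acyclic a h := cmaLT_irrefl a (cmaLT_of_transGen h)

variable {C}

/-- An old side, as a side of `C.cma`. -/
abbrev oldSide (x : C.Side) : C.cma.Side := Sum.inl x

/-- A new side: `(e, false)` and `(e, true)` are the two sides of the new arc at the end of `e`. -/
abbrev newSide (e : {e : C.Side // C.Inf e}) (b : Bool) : C.cma.Side := Sum.inr (e, b)

theorem cma_cases (a : C.cma.Side) :
    (∃ x, a = oldSide x) ∨ (∃ e, a = newSide e false) ∨ ∃ e, a = newSide e true := by
  rcases a with x | ⟨e, _ | _⟩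
  exacts [Or.inl ⟨x, rfl⟩, Or.inr (Or.inl ⟨e, rfl⟩), Or.inr (Or.inr ⟨e, rfl⟩)]

theorem oldSide_inj {x y : C.Side} : oldSide x = oldSide y ↔ x = y :=
  ⟨fun h => Sum.inl.inj h, congrArg _⟩

theorem newSide_inj {e f : {e // C.Inf e}} {b c : Bool} :
    newSide e b = newSide f c ↔ e = f ∧ b = c :=
  ⟨fun h => by cases h; exact ⟨rfl, rfl⟩, fun h => by rw [h.1, h.2]⟩

theorem newSide_ne_oldSide {e : {e // C.Inf e}} {b : Bool} {x : C.Side} :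
    newSide e b ≠ oldSide x := Sum.inr_ne_inl

theorem cma_succ_apply (a : C.cma.Side) : C.cma.succ a = C.cmaSucc a := rfl

theorem cma_succ_old {e : C.Side} (h : C.Inf e) :
    C.cma.succ (oldSide (C.inv e)) = some (newSide ⟨e, h⟩ false) := by
  rw [cma_succ_apply, cmaSucc, dif_pos (by rwa [C.inv_inv])]
  simp only [C.inv_inv]
  rfl

theorem cma_succ_old_of_not {e : C.Side} (h : ¬ C.Inf e) :
    C.cma.succ (oldSide (C.inv e)) = (C.next e).map oldSide := by
  rw [cma_succ_apply, cmaSucc, dif_neg (by rwa [C.inv_inv])]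
  rfl

theorem cma_succ_new {e f : C.Side} (h : C.Inf e) (hf : C.next e = some f) :
    C.cma.succ (newSide ⟨e, h⟩ false) = some (oldSide f) := by
  rw [cma_succ_apply, cmaSucc, hf]
  rfl

theorem cma_lt_old {x y : C.Side} (h : x < y) :
    oldSide x < oldSide y := by
  refine Relation.TransGen.lift' oldSide ?_ _ _ h
  intro a b hab
  change oldSide a < oldSide b
  by_cases h1 : C.Inf (C.inv a)
  · have h2 := cma_succ_old h1
    rw [C.inv_inv] at h2
    exact (lt_of_succ (C := C.cma) h2).trans
      (lt_of_succ (C := C.cma) (cma_succ_new h1 (by rwa [next, C.inv_inv])))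
  · refine lt_of_succ (C := C.cma) ?_
    rw [cma_succ_apply, cmaSucc, dif_neg h1, hab]
    rfl

theorem cma_le_old {x y : C.Side} (h : x ≤ y) :
    oldSide x ≤ oldSide y := by
  rcases eq_or_lt_of_le h with rfl | h
  · exact le_rfl
  · exact (cma_lt_old h).le

/-- The order of the chains of `C.cma`, in terms of the order of the chains of `C`. -/
theorem cma_lt_iff {a b : C.cma.Side} : a < b ↔ C.cmaLT a b := by
  refine ⟨cmaLT_of_transGen, fun h => ?_⟩
  have key : ∀ (e : {e // C.Inf e}) (y : C.Side), C.inv e.1 < y →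
      newSide e false < oldSide y := by
    intro e y h
    obtain ⟨z, hz, hzy⟩ := exists_succ_le h
    exact (lt_of_succ (C := C.cma) (cma_succ_new e.2 hz)).trans_le (cma_le_old hzy)
  rcases a with x | ⟨e, _ | _⟩ <;> rcases b with y | ⟨f, _ | _⟩ <;>
    simp only [cmaLT] at h
  · exact cma_lt_old h
  · exact (cma_le_old h).trans_lt (lt_of_succ (C := C.cma) (cma_succ_old f.2))
  · exact key _ _ h
  · exact (key _ _ h).trans (lt_of_succ (C := C.cma) (cma_succ_old f.2))

theorem cma_le_iff {a b : C.cma.Side} : a ≤ b ↔ a = b ∨ C.cmaLT a b := by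
  rw [le_iff_eq_or_lt, cma_lt_iff]

theorem cma_old_le_old {x y : C.Side} :
    oldSide x ≤ oldSide y ↔ x ≤ y := by
  refine ⟨fun h => ?_, cma_le_old⟩
  rcases cma_le_iff.1 h with h | h
  · exact (Sum.inl.inj h).le
  · exact le_of_lt h

theorem cma_new_le_old {e : {e // C.Inf e}} {y : C.Side} :
    newSide e false ≤ oldSide y ↔
      C.inv e.1 < y := by
  rw [cma_le_iff]
  exact ⟨fun h => h.resolve_left Sum.inr_ne_inl, Or.inr⟩

theorem cma_not_true_le_old {e : {e // C.Inf e}} {y : C.Side} :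
    ¬ newSide e true ≤ oldSide y := by
  rw [cma_le_iff]
  exact fun h => h.elim Sum.inr_ne_inl id

theorem cma_le_true {e : {e // C.Inf e}} {a : C.cma.Side}
    (h : a ≤ newSide e true) : a = Sum.inr (e, true) := by
  rcases cma_le_iff.1 h with h | h
  · exact h
  · rcases a with x | ⟨f, _ | _⟩ <;> exact h.elim

end SideSystem

/-! ### The endomorphism algebra of the Gorenstein-projective modules -/

open MulOpposite

namespace SideSystem

variable {C : SideSystem} {k : Type u} [Field k]

/-- The bimodule which realizes the sum of the indecomposable Gorenstein-projective modules:
the columns of the matrix algebra of `C.cma` at the old sides. -/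
def cmaColumns (C : SideSystem) (k : Type u) [Field k] :
    Submodule k (Matrix C.cma.Side C.Side k) where
  carrier := {M | (∀ a z, ¬ a ≤ oldSide z → M a z = 0) ∧
    ∀ x, M (oldSide (C.inv x)) (C.inv x) = M (oldSide x) x}
  add_mem' {M N} hM hN :=
    ⟨fun a z h => by simp [hM.1 a z h, hN.1 a z h], fun x => by simp [hM.2 x, hN.2 x]⟩
  zero_mem' := by simp
  smul_mem' c M hM :=
    ⟨fun a z h => by simp [hM.1 a z h], fun x => by simp [hM.2 x]⟩

theorem mul_mem_cmaColumns {M : Matrix C.cma.Side C.Side k} (hM : M ∈ C.cmaColumns k)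
    {N : Matrix C.Side C.Side k} (hN : N ∈ C.matAlg k) : M * N ∈ C.cmaColumns k := by
  have hdiag : ∀ x, (M * N) (oldSide x) x = M (oldSide x) x * N x x := by
    intro x
    rw [Matrix.mul_apply, Finset.sum_eq_single x]
    · intro y _ hy
      by_cases h : x ≤ y
      · rw [hN.1 y x (fun h' => hy (le_antisymm h' h)), mul_zero]
      · rw [hM.1 (oldSide x) y (fun h' => h (cma_old_le_old.1 h')), zero_mul]
    · intro h; exact (h (Finset.mem_univ _)).elim
  refine ⟨fun a z h => ?_, fun x => by rw [hdiag, hdiag, hM.2, hN.2]⟩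
  rw [Matrix.mul_apply]
  refine Finset.sum_eq_zero fun w _ => ?_
  by_cases h1 : w ≤ z
  · rw [hM.1 a w (fun h' => h (h'.trans (cma_le_old h1))), zero_mul]
  · rw [hN.1 w z h1, mul_zero]

theorem mul_mem_cmaColumns' {N : Matrix C.cma.Side C.cma.Side k} (hN : N ∈ C.cma.matAlg k)
    {M : Matrix C.cma.Side C.Side k} (hM : M ∈ C.cmaColumns k) : N * M ∈ C.cmaColumns k := by
  have hdiag : ∀ x, (N * M) (oldSide x) x = N (oldSide x) (oldSide x) * M (oldSide x) x := by
    intro x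
    rw [Matrix.mul_apply, Finset.sum_eq_single (oldSide x)]
    · intro y _ hy
      by_cases h : oldSide x ≤ y
      · rw [hM.1 y x (fun h' => hy (le_antisymm h' h)), mul_zero]
      · rw [hN.1 _ y h, zero_mul]
    · intro h; exact (h (Finset.mem_univ _)).elim
  refine ⟨fun a z h => ?_, fun x => ?_⟩
  · rw [Matrix.mul_apply]
    refine Finset.sum_eq_zero fun w _ => ?_
    by_cases h1 : a ≤ w
    · rw [hM.1 w z (fun h' => h (h1.trans h')), mul_zero]
    · rw [hN.1 a w h1, zero_mul]
  · rw [hdiag, hdiag, hM.2]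
    exact congrArg (· * _) (hN.2 (oldSide x))

variable {A : Type v} [Ring A] [Algebra k A]

/-- `cmaColumns` as a right module over an algebra isomorphic to the matrix algebra of `C`. -/
def CMAModule (_ρ : A ≃ₐ[k] C.matAlg k) : Type u := C.cmaColumns k

namespace CMAModule

variable (ρ : A ≃ₐ[k] C.matAlg k)

instance : AddCommGroup (CMAModule ρ) := inferInstanceAs (AddCommGroup (C.cmaColumns k))

instance : Module k (CMAModule ρ) := inferInstanceAs (Module k (C.cmaColumns k))

variable {ρ}

/-- The matrix of an element. -/
def mat (m : CMAModule ρ) : Matrix C.cma.Side C.Side k := m.1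

theorem mat_mem (m : CMAModule ρ) : m.mat ∈ C.cmaColumns k := m.2

variable (ρ) in
/-- The element with a given matrix. -/
def mk (M : Matrix C.cma.Side C.Side k) (h : M ∈ C.cmaColumns k) : CMAModule ρ := ⟨M, h⟩

@[simp] theorem mat_mk (M : Matrix C.cma.Side C.Side k) (h : M ∈ C.cmaColumns k) :
    (mk ρ M h).mat = M := rfl

@[ext] theorem ext {m m' : CMAModule ρ} (h : m.mat = m'.mat) : m = m' := Subtype.ext h

@[simp] theorem mat_zero : (0 : CMAModule ρ).mat = 0 := rfl

@[simp] theorem mat_add (m m' : CMAModule ρ) : (m + m').mat = m.mat + m'.mat := rfl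

@[simp] theorem mat_smul (c : k) (m : CMAModule ρ) : (c • m).mat = c • m.mat := rfl

noncomputable instance : SMul Aᵐᵒᵖ (CMAModule ρ) where
  smul b m := mk ρ (m.mat * (ρ b.unop).1) (mul_mem_cmaColumns m.mat_mem (ρ b.unop).2)

@[simp] theorem mat_op_smul (b : Aᵐᵒᵖ) (m : CMAModule ρ) :
    (b • m).mat = m.mat * (ρ b.unop).1 := rfl

noncomputable instance : Module Aᵐᵒᵖ (CMAModule ρ) where
  one_smul m := by ext : 1; simp
  mul_smul a b m := by ext : 1; simp [Matrix.mul_assoc]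
  smul_zero a := by ext : 1; simp
  zero_smul m := by ext : 1; simp
  smul_add a m m' := by ext : 1; simp [Matrix.add_mul]
  add_smul a b m := by ext : 1; simp [Matrix.mul_add]

instance : IsScalarTower k Aᵐᵒᵖ (CMAModule ρ) where
  smul_assoc c b m := by ext : 1; simp

variable (ρ) in
/-- The left action of the matrix algebra of `C.cma`. -/
noncomputable def leftMul : C.cma.matAlg k →ₐ[k] Module.End Aᵐᵒᵖ (CMAModule ρ) :=
  AlgHom.ofLinearMap
    { toFun γ :=
        { toFun m := mk ρ (γ.1 * m.mat) (mul_mem_cmaColumns' γ.2 m.mat_mem)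
          map_add' m m' := by ext : 1; simp [Matrix.mul_add]
          map_smul' b m := by ext : 1; simp [Matrix.mul_assoc] }
      map_add' γ γ' := by ext m : 2; simp [Matrix.add_mul]
      map_smul' c γ := by ext m : 2; simp }
    (by ext m : 2; simp) (fun γ γ' => by ext m : 2; simp [Matrix.mul_assoc])

theorem mat_leftMul (γ : C.cma.matAlg k) (m : CMAModule ρ) :
    (leftMul ρ γ m).mat = γ.1 * m.mat := rfl

variable (ρ) in
open Classical in
/-- The generator of the part of `CMAModule` which is isomorphic to the regular module. -/
noncomputable def gen : CMAModule ρ :=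
  mk ρ (Matrix.of fun a z => if a = oldSide z then 1 else 0) (by
    refine ⟨fun a z h => ?_, fun x => ?_⟩ <;> simp only [Matrix.of_apply]
    exact if_neg fun h' => h h'.le)

open Classical in
theorem gen_apply (a : C.cma.Side) (z : C.Side) :
    (gen ρ).mat a z = if a = oldSide z then 1 else 0 := rfl

variable (ρ) in
/-- The generator of the part of `CMAModule` which is isomorphic to the ideal of the arrow
from `inv e` to `f = next e`. -/
noncomputable def genNew (e : {e // C.Inf e}) {f : C.Side} (h : C.next e.1 = some f) :
    CMAModule ρ :=
  mk ρ (Matrix.single (newSide e false) f 1) (by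
    refine ⟨fun a z h' => Matrix.single_apply_of_ne _ _ _ _ _ ?_, fun x => ?_⟩
    · rintro ⟨rfl, rfl⟩
      exact h' (cma_new_le_old.2 (lt_of_succ h))
    · exact (Matrix.single_apply_of_ne _ _ _ _ _ fun h => newSide_ne_oldSide h.1).trans
        (Matrix.single_apply_of_ne _ _ _ _ _ fun h => newSide_ne_oldSide h.1).symm)

open Classical in
theorem genNew_apply (e : {e // C.Inf e}) {f : C.Side} (h : C.next e.1 = some f)
    (a : C.cma.Side) (z : C.Side) :
    (genNew ρ e h).mat a z = if newSide e false = a ∧ f = z then 1 else 0 := by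
  refine (Matrix.single_apply _ _ _ _ _).trans ?_
  congr

theorem mul_gen_apply (γ : Matrix C.cma.Side C.cma.Side k) (a : C.cma.Side) (z : C.Side) :
    (γ * (gen ρ).mat) a z = γ a (oldSide z) := by
  classical
  rw [Matrix.mul_apply, Finset.sum_eq_single (oldSide z)]
  · simp [gen_apply]
  · intro b _ hb
    simp [gen_apply, hb]
  · intro h; exact (h (Finset.mem_univ _)).elim

theorem mul_genNew_apply (γ : Matrix C.cma.Side C.cma.Side k) (e : {e // C.Inf e}) {f : C.Side}
    (h : C.next e.1 = some f) (a : C.cma.Side) (z : C.Side) :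
    (γ * (genNew ρ e h).mat) a z = if z = f then γ a (newSide e false) else 0 := by
  change (γ * Matrix.single (newSide e false) f 1 : Matrix _ _ k) a z = _
  split_ifs with hz
  · subst hz; simp
  · rw [Matrix.mul_single_apply_of_ne (hbj := hz)]

/-- The element of `A` whose row `f` is the row `a` of `m`, where `f = next e` and `a` is the new
side at the end of `e`. -/
theorem exists_row_new (m : CMAModule ρ) (e : {e // C.Inf e}) {f : C.Side}
    (h : C.next e.1 = some f) : ∃ d : A, ∀ z, (ρ d).1 f z = m.mat (newSide e false) z := by
  let M : Matrix C.Side C.Side k := fun z w => if z = f then m.mat (newSide e false) w else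
    if z = C.inv f ∧ w = C.inv f then m.mat (newSide e false) f else 0
  have hM : M ∈ C.matAlg k := by
    refine ⟨fun z w hzw => ?_, fun z => ?_⟩
    · simp only [M]
      split_ifs with h1 h2
      · subst h1
        exact m.mat_mem.1 _ _ fun h3 => hzw (succ_le_of_lt h (cma_new_le_old.1 h3))
      · exact (hzw (h2.1.trans h2.2.symm).le).elim
      · rfl
    · simp only [M, inv_eq_iff, C.inv_inv]
      by_cases h1 : z = f
      · subst h1; simp
      · by_cases h2 : z = C.inv f
        · subst h2; simp
        · simp [h1, h2]
  exact ⟨ofMatrix ρ M hM, fun z => by rw [ofMatrix_apply]; simp [M]⟩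

/-- The old rows of an element of `CMAModule`, as an element of `A`. -/
theorem exists_rows_old (m : CMAModule ρ) : ∃ b : A, ∀ x z, (ρ b).1 x z = m.mat (oldSide x) z :=
  ⟨ofMatrix ρ (Matrix.of fun x z => m.mat (oldSide x) z)
    ⟨fun _ _ h => m.mat_mem.1 _ _ fun h' => h (cma_old_le_old.1 h'), fun x => m.mat_mem.2 x⟩,
    fun x z => ofMatrix_apply ρ _ _ x z⟩

theorem gen_mul_apply (N : Matrix C.Side C.Side k) (x z : C.Side) :
    ((gen ρ).mat * N) (oldSide x) z = N x z := by
  classical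
  rw [Matrix.mul_apply, Finset.sum_eq_single x]
  · simp [gen_apply]
  · intro y _ hy
    rw [gen_apply, if_neg (fun h => hy (oldSide_inj.1 h).symm), zero_mul]
  · simp

theorem gen_mul_apply_new (N : Matrix C.Side C.Side k) (e : {e // C.Inf e}) (b : Bool)
    (z : C.Side) : ((gen ρ).mat * N) (newSide e b) z = 0 := by
  classical
  rw [Matrix.mul_apply]
  refine Finset.sum_eq_zero fun y _ => ?_
  rw [gen_apply, if_neg newSide_ne_oldSide, zero_mul]

theorem genNew_mul_apply (N : Matrix C.Side C.Side k) (e : {e // C.Inf e}) {f : C.Side}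
    (h : C.next e.1 = some f) (a : C.cma.Side) (z : C.Side) [Decidable (a = newSide e false)] :
    ((genNew ρ e h).mat * N) a z = if a = newSide e false then N f z else 0 := by
  change (Matrix.single (newSide e false) f 1 * N : Matrix _ _ k) a z = _
  split_ifs with hz
  · subst hz; simp
  · rw [Matrix.single_mul_apply_of_ne (h := hz)]

/-- The elements `gen` and `genNew` generate the module. -/
theorem hom_ext {φ ψ : Module.End Aᵐᵒᵖ (CMAModule ρ)} (h : φ (gen ρ) = ψ (gen ρ))
    (h' : ∀ (e : {e // C.Inf e}) f (hf : C.next e.1 = some f),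
      φ (genNew ρ e hf) = ψ (genNew ρ e hf)) : φ = ψ := by
  classical
  have := Fintype.ofFinite {e // C.Inf e}
  refine LinearMap.ext fun m => ?_
  obtain ⟨b, hb⟩ := exists_rows_old m
  have hnext : ∀ e : {e // C.Inf e}, ∃ f, C.next e.1 = some f := fun e =>
    e.2.exists_next.imp fun _ h => h.1
  choose f hf using hnext
  choose d hd using fun e => exists_row_new m e (hf e)
  have hm : m = op b • gen ρ + ∑ e, op (d e) • genNew ρ e (hf e) := by
    have hsum : ∀ s : Finset {e // C.Inf e}, (∑ e ∈ s, op (d e) • genNew ρ e (hf e)).mat =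
        ∑ e ∈ s, (genNew ρ e (hf e)).mat * (ρ (d e)).1 := by
      intro s
      induction s using Finset.induction_on with
      | empty => simp
      | insert a s ha ih => rw [Finset.sum_insert ha, Finset.sum_insert ha, mat_add, ih]; rfl
    ext a z
    rw [mat_add, hsum, Matrix.add_apply, Matrix.sum_apply]
    simp only [mat_op_smul, unop_op, genNew_mul_apply]
    obtain ⟨x, rfl⟩ | ⟨e, rfl⟩ | ⟨e, rfl⟩ := cma_cases a
    · rw [gen_mul_apply, hb, Finset.sum_eq_zero, add_zero]
      intro e _
      exact if_neg Sum.inl_ne_inr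
    · rw [gen_mul_apply_new, zero_add, Finset.sum_eq_single e, if_pos rfl, hd]
      · intro e' _ he'
        exact if_neg fun h => he' (newSide_inj.1 h).1.symm
      · simp
    · rw [gen_mul_apply_new, zero_add, Finset.sum_eq_zero]
      · exact m.mat_mem.1 _ _ cma_not_true_le_old
      · intro e' _
        exact if_neg fun h => by simpa using (newSide_inj.1 h).2
  rw [hm, map_add, map_add, map_sum, map_sum, map_smul, map_smul, h]
  simp only [map_smul, h']

theorem leftMul_injective : Function.Injective (leftMul ρ) := by
  rw [injective_iff_map_eq_zero]
  intro γ hγ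
  have h1 : ∀ m, γ.1 * (CMAModule.mat (ρ := ρ) m) = 0 := fun m =>
    congrArg mat (LinearMap.congr_fun hγ m)
  have hnew : ∀ a e, γ.1 a (newSide e false) = 0 := by
    intro a e
    obtain ⟨f, hf, -⟩ := e.2.exists_next
    have := mul_genNew_apply (ρ := ρ) γ.1 e hf a f
    rw [h1, if_pos rfl] at this
    exact this.symm
  refine Subtype.ext (Matrix.ext fun a b => ?_)
  change γ.1 a b = 0
  obtain ⟨x, rfl⟩ | ⟨e, rfl⟩ | ⟨e, rfl⟩ := cma_cases b
  · have := mul_gen_apply (ρ := ρ) γ.1 a x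
    rw [h1] at this
    exact this.symm
  · exact hnew a e
  · by_cases ha : a ≤ newSide e true
    · rw [cma_le_true ha]
      exact (γ.2.2 (newSide e false)).trans (hnew _ e)
    · exact γ.2.1 _ _ ha

/-- The image of `genNew` under an endomorphism is supported in the column `f`: like `genNew`
itself, it is fixed by the idempotent of `f` and annihilated by the arrow that leaves `inv f`. -/
theorem end_genNew_apply (φ : Module.End Aᵐᵒᵖ (CMAModule ρ)) (e : {e // C.Inf e}) {f : C.Side}
    (h : C.next e.1 = some f) (a : C.cma.Side) (z : C.Side) (hz : z ≠ f) :
    (φ (genNew ρ e h)).mat a z = 0 := by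
  classical
  obtain ⟨f', hf', hInf⟩ := e.2.exists_next
  obtain rfl : f' = f := Option.some.inj (hf'.symm.trans h)
  obtain ⟨g, hg, -⟩ := hInf.exists_next
  by_cases h1 : z = C.inv f'
  · have h2 : op (unit ρ (lt_of_succ hg)) • genNew ρ e h = 0 := by
      ext a z
      rw [mat_op_smul, genNew_mul_apply, unop_op, unit_apply, if_neg (c := _ ∧ _)
        fun h => C.inv_ne _ h.1, ite_self]
      rfl
    have h3 : op (unit ρ (lt_of_succ hg)) • φ (genNew ρ e h) = 0 := by
      rw [← map_smul, h2, map_zero]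
    have h4 : ((φ (genNew ρ e h)).mat * (ρ (unit ρ (lt_of_succ hg))).1) a g = 0 := by
      have h5 := congrArg mat h3
      rw [mat_op_smul] at h5
      exact congrFun (congrFun h5 a) g
    rw [unit, AlgEquiv.apply_symm_apply, unitMat, Matrix.mul_single_apply_same, mul_one] at h4
    rw [h1, h4]
  · have h2 : op (idem ρ f') • genNew ρ e h = genNew ρ e h := by
      ext a z
      rw [mat_op_smul, genNew_mul_apply, unop_op, idem_apply, genNew_apply]
      by_cases ha : a = newSide e false
      · simp [ha]
      · simp [ha, Ne.symm ha]
    have h3 : (φ (genNew ρ e h)).mat a z =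
        ((φ (genNew ρ e h)).mat * (ρ (idem ρ f')).1) a z := by
      conv_lhs => rw [← h2, map_smul]
      rfl
    rw [h3, idem, AlgEquiv.apply_symm_apply]
    refine (Matrix.mul_diagonal _ _ _ _).trans ?_
    rw [if_neg (not_or.2 ⟨hz, h1⟩), mul_zero]

/-- Every endomorphism is the multiplication by a matrix: its columns at the old sides are those of
the image of `gen`, and its column at the new side `(e, false)` is the only non-zero column of the
image of `genNew e`.  The side `(e, true)` is isolated, so only its diagonal entry remains. -/
theorem leftMul_surjective : Function.Surjective (leftMul ρ) := by
  classical
  intro φ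
  have hnext : ∀ e : {e // C.Inf e}, ∃ f, C.next e.1 = some f := fun e =>
    e.2.exists_next.imp fun _ h => h.1
  choose f hf using hnext
  let u : {e // C.Inf e} → C.cma.Side → k := fun e a => (φ (genNew ρ e (hf e))).mat a (f e)
  let γ : Matrix C.cma.Side C.cma.Side k := Matrix.of fun a b => match b with
    | Sum.inl z => (φ (gen ρ)).mat a z
    | Sum.inr (e, false) => u e a
    | Sum.inr (e, true) => if a = newSide e true then u e (newSide e false) else 0
  have hγ1 : ∀ a z, γ a (oldSide z) = (φ (gen ρ)).mat a z := fun _ _ => rfl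
  have hγ2 : ∀ a e, γ a (newSide e false) = u e a := fun _ _ => rfl
  have hγ3 : ∀ a e, γ a (newSide e true) =
    if a = newSide e true then u e (newSide e false) else 0 := fun _ _ => rfl
  have hγ : γ ∈ C.cma.matAlg k := by
    refine ⟨fun a b hab => ?_, fun a => ?_⟩
    · obtain ⟨z, rfl⟩ | ⟨e, rfl⟩ | ⟨e, rfl⟩ := cma_cases b
      · exact (φ (gen ρ)).mat_mem.1 a z hab
      · rw [hγ2]
        by_cases ha : a = oldSide (f e)
        · subst ha
          -- the diagonal entry at `f` vanishes, as the one at `inv f` does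
          simp only [u]
          rw [← (φ (genNew ρ e (hf e))).mat_mem.2]
          exact end_genNew_apply φ e (hf e) _ _ (C.inv_ne _)
        · refine (φ (genNew ρ e (hf e))).mat_mem.1 a (f e) fun h => hab ?_
          exact le_of_lt_succ (cma_succ_new e.2 (hf e)) (lt_of_le_of_ne h ha)
      · rw [hγ3]
        exact if_neg fun h => hab h.le
    · have h1 : ∀ e : {e // C.Inf e}, γ (newSide e true) (newSide e true) =
          γ (newSide e false) (newSide e false) := by
        intro e
        rw [hγ3, if_pos rfl, hγ2]
      obtain ⟨z, rfl⟩ | ⟨e, rfl⟩ | ⟨e, rfl⟩ := cma_cases a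
      · exact (φ (gen ρ)).mat_mem.2 z
      · exact h1 e
      · exact (h1 e).symm
  refine ⟨⟨γ, hγ⟩, hom_ext ?_ fun e g hg => ?_⟩
  · ext a z
    exact mul_gen_apply γ a z
  · obtain rfl : f e = g := Option.some.inj ((hf e).symm.trans hg)
    ext a z
    rw [mat_leftMul, mul_genNew_apply]
    split_ifs with hz
    · subst hz
      exact hγ2 a e
    · exact (end_genNew_apply φ e hg a z hz).symm

variable (ρ) in
/-- The endomorphism algebra of `CMAModule` is the matrix algebra of `C.cma`. -/
noncomputable def endEquiv : C.cma.matAlg k ≃ₐ[k] Module.End Aᵐᵒᵖ (CMAModule ρ) :=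
  AlgEquiv.ofBijective (leftMul ρ) ⟨leftMul_injective, leftMul_surjective⟩

end CMAModule

end SideSystem

/-! ### The Cohen–Macaulay–Auslander algebra of a side system -/

open MulOpposite

namespace SideSystem

variable {C : SideSystem} {k : Type u} [Field k] {A : Type v} [Ring A] [Algebra k A]

open Classical in
/-- The chosen side of the arc of `x`. -/
noncomputable def repSide (x : C.Side) : {x // C.IsRep x} :=
  if h : C.IsRep x then ⟨x, h⟩ else ⟨C.inv x, (isRep_or x).resolve_left h⟩

theorem repSide_eq (x : C.Side) : (repSide x : C.Side) = x ∨ (repSide x : C.Side) = C.inv x := by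
  rw [repSide]
  split_ifs <;> simp

theorem repSide_of_isRep {x : C.Side} (h : C.IsRep x) : repSide x = ⟨x, h⟩ := dif_pos h

theorem repSide_inv (x : C.Side) : repSide (C.inv x) = repSide x := by
  by_cases h : C.IsRep x
  · simp only [repSide, dif_pos h, dif_neg h.not_inv, C.inv_inv]
  · simp only [repSide, dif_neg h, dif_pos ((isRep_or x).resolve_left h)]

namespace CMAModule

/-- The rows of the elements of the indecomposable Gorenstein-projective modules, arranged in one
matrix: the module of an arc contributes the rows of its two sides, and the module of the side `e`
of an arc on an `∞`-elementary polygon contributes the row of the new side at the end of `e`. -/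
noncomputable def assembleMat (ρ : A ≃ₐ[k] C.matAlg k) (m : ∀ i, gIdeal ρ i) :
    Matrix C.cma.Side C.Side k :=
  Matrix.of fun a z => match a with
    | Sum.inl x => (ρ (m (Sum.inl (repSide x)) : A)).1 x z
    | Sum.inr (e, false) => (ρ (m (Sum.inr e) : A)).1 (C.inv e.1) z
    | Sum.inr (_, true) => 0

variable {ρ : A ≃ₐ[k] C.matAlg k}

theorem assembleMat_old (m : ∀ i, gIdeal ρ i) (x z : C.Side) :
    assembleMat ρ m (oldSide x) z = (ρ (m (Sum.inl (repSide x)) : A)).1 x z := rfl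

theorem assembleMat_new (m : ∀ i, gIdeal ρ i) (e : {e // C.Inf e}) (z : C.Side) :
    assembleMat ρ m (newSide e false) z = (ρ (m (Sum.inr e) : A)).1 (C.inv e.1) z := rfl

theorem assembleMat_true (m : ∀ i, gIdeal ρ i) (e : {e // C.Inf e}) (z : C.Side) :
    assembleMat ρ m (newSide e true) z = 0 := rfl

theorem assembleMat_mem (m : ∀ i, gIdeal ρ i) : assembleMat ρ m ∈ C.cmaColumns k := by
  refine ⟨fun a z h => ?_, fun x => ?_⟩
  · obtain ⟨x, rfl⟩ | ⟨e, rfl⟩ | ⟨e, rfl⟩ := cma_cases a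
    · exact (ρ _).2.1 _ _ fun h' => h (cma_old_le_old.2 h')
    · have hm : (m (Sum.inr e) : A) ∈ arrowIdeal ρ (C.inv e.1) := (m (Sum.inr e)).2
      exact hm _ _ fun h' => h (cma_new_le_old.2 h'.2)
    · rfl
  · rw [assembleMat_old, assembleMat_old, repSide_inv]
    exact (ρ _).2.2 x

/-- `assembleMat` as a linear map. -/
noncomputable def assemble (ρ : A ≃ₐ[k] C.matAlg k) :
    (∀ i, gIdeal ρ i) →ₗ[Aᵐᵒᵖ] CMAModule ρ where
  toFun m := mk ρ (assembleMat ρ m) (assembleMat_mem m)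
  map_add' m m' := by
    ext a z
    change assembleMat ρ (m + m') a z = assembleMat ρ m a z + assembleMat ρ m' a z
    obtain ⟨x, rfl⟩ | ⟨e, rfl⟩ | ⟨e, rfl⟩ := cma_cases a
    · simp [assembleMat_old]
    · simp [assembleMat_new]
    · simp [assembleMat_true]
  map_smul' b m := by
    ext a z
    change assembleMat ρ (b • m) a z = (assembleMat ρ m * (ρ b.unop).1) a z
    rw [Matrix.mul_apply]
    obtain ⟨x, rfl⟩ | ⟨e, rfl⟩ | ⟨e, rfl⟩ := cma_cases a
    · simp only [assembleMat_old]
      exact apply_mul_entry ρ _ _ _ _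
    · simp only [assembleMat_new]
      exact apply_mul_entry ρ _ _ _ _
    · simp [assembleMat_true]

theorem mat_assemble (m : ∀ i, gIdeal ρ i) : (assemble ρ m).mat = assembleMat ρ m := rfl

theorem assemble_bijective : Function.Bijective (assemble ρ) := by
  refine ⟨(injective_iff_map_eq_zero _).2 fun m hm => ?_, fun m => ?_⟩
  · have h : ∀ a z, assembleMat ρ m a z = 0 := fun a z =>
      congrFun (congrFun (congrArg mat hm) a) z
    funext i
    refine Subtype.ext (ext_entry ρ fun y z => ?_)
    have h0 : (ρ ((0 : ∀ i, gIdeal ρ i) i : A)).1 y z = 0 := by simp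
    rw [h0]
    rcases i with r | e
    · have hr : (m (Sum.inl r) : A) ∈ projIdeal ρ r.1 := (m (Sum.inl r)).2
      by_cases hy : y = r.1 ∨ y = C.inv r.1
      · have hy' : repSide y = r := by
          rcases hy with rfl | rfl
          · exact repSide_of_isRep r.2
          · rw [repSide_inv]; exact repSide_of_isRep r.2
        subst hy'
        exact h (oldSide y) z
      · exact hr y z (fun h => hy (Or.inl h)) fun h => hy (Or.inr h)
    · have hr : (m (Sum.inr e) : A) ∈ arrowIdeal ρ (C.inv e.1) := (m (Sum.inr e)).2
      by_cases hy : y = C.inv e.1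
      · subst hy
        exact h (newSide e false) z
      · exact hr y z fun h => hy h.1
  · obtain ⟨b, hb⟩ := exists_rows_old m
    have hnext : ∀ e : {e // C.Inf e}, ∃ f, C.next e.1 = some f := fun e =>
      e.2.exists_next.imp fun _ h => h.1
    choose f hf using hnext
    choose d hd using fun e => exists_row_new m e (hf e)
    refine ⟨fun
      | Sum.inl r => ⟨idem ρ r.1 * b, idem_mul_mem r.1 b⟩
      | Sum.inr e => ⟨unit ρ (lt_of_succ (hf e)) * d e, unit_mul_mem (hf e) (d e)⟩, ?_⟩
    ext a z
    rw [mat_assemble]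
    obtain ⟨x, rfl⟩ | ⟨e, rfl⟩ | ⟨e, rfl⟩ := cma_cases a
    · rw [assembleMat_old, idem_mul_apply, if_pos, hb]
      rcases repSide_eq x with h | h
      · exact Or.inl h.symm
      · right; rw [h, C.inv_inv]
    · rw [assembleMat_new, unit_mul_apply, if_pos rfl, hd]
    · rw [assembleMat_true]
      exact (m.mat_mem.1 _ _ cma_not_true_le_old).symm

end CMAModule

/-- The Cohen–Macaulay–Auslander algebra of the matrix algebra of a side system `C` is the matrix
algebra of `C.cma`. -/
theorem nonempty_cmAuslander_equiv (ρ : A ≃ₐ[k] C.matAlg k) :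
    Nonempty (CMAuslander A ≃ₐ[k] C.cma.matAlg k) := by
  classical
  obtain ⟨Θ, hΘ⟩ := exists_indGproj_equiv ρ
  let θ := fun i => (hΘ i).some
  have : Finite C.GIndex := inferInstance
  have := Fintype.ofFinite C.GIndex
  let φ : (⨁ G : IndGproj A, G.rep) ≃ₗ[Aᵐᵒᵖ] CMAModule ρ :=
    (DirectSum.lequivCongrLeft Aᵐᵒᵖ Θ.symm).trans <|
      (DirectSum.linearEquivFunOnFintype Aᵐᵒᵖ C.GIndex fun i => (Θ i).rep).trans <|
        (LinearEquiv.piCongrRight fun i => (θ i).symm).trans <|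
          LinearEquiv.ofBijective (CMAModule.assemble ρ) CMAModule.assemble_bijective
  exact ⟨(φ.conjAlgEquiv k).trans (CMAModule.endEquiv ρ).symm⟩

end SideSystem

/-! ### Isomorphisms of side systems, and the side systems of marked surfaces -/

namespace SideSystem

/-- Isomorphisms of side systems. -/
structure Iso (C D : SideSystem) extends C.Side ≃ D.Side where
  map_inv : ∀ x, toFun (C.inv x) = D.inv (toFun x)
  map_succ : ∀ x, (C.succ x).map toFun = D.succ (toFun x)

namespace Iso

variable {C D : SideSystem}

theorem inv_apply (φ : Iso C D) (x : C.Side) : φ.toEquiv (C.inv x) = D.inv (φ.toEquiv x) :=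
  φ.map_inv x

theorem succ_apply (φ : Iso C D) (x : C.Side) :
    (C.succ x).map φ.toEquiv = D.succ (φ.toEquiv x) :=
  φ.map_succ x

theorem next_apply (φ : Iso C D) (x : C.Side) :
    (C.next x).map φ.toEquiv = D.next (φ.toEquiv x) := by
  rw [next, succ_apply, inv_apply, next]

theorem succ_eq_some (φ : Iso C D) {x y : C.Side} (h : C.succ x = some y) :
    D.succ (φ.toEquiv x) = some (φ.toEquiv y) := by
  rw [← succ_apply, h, Option.map_some]

/-- The inverse of an isomorphism. -/
def symm (φ : Iso C D) : Iso D C where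
  toEquiv := φ.toEquiv.symm
  map_inv x := φ.toEquiv.injective (by simp [inv_apply])
  map_succ x := by
    refine Option.map_injective φ.toEquiv.injective ?_
    change ((D.succ x).map φ.toEquiv.symm).map φ.toEquiv =
      (C.succ (φ.toEquiv.symm x)).map φ.toEquiv
    rw [succ_apply, Option.map_map]
    simp

end Iso

end SideSystem

/-- Transport of a presentation along an isomorphism of side systems. -/
def Presents.transport {C D : SideSystem} {Q : BoundQuiver} (P : Presents C Q)
    (φ : SideSystem.Iso C D) : Presents D Q where
  vtx x := P.vtx (φ.toEquiv.symm x)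
  vtx_surj := P.vtx_surj.comp φ.toEquiv.symm.surjective
  vtx_eq x y := by
    rw [P.vtx_eq, φ.toEquiv.symm.injective.eq_iff]
    refine or_congr Iff.rfl ?_
    rw [← φ.toEquiv.injective.eq_iff, φ.inv_apply]
    simp
  out a := φ.toEquiv (P.out a)
  inn a := φ.toEquiv (P.inn a)
  succ_out a := φ.succ_eq_some (P.succ_out a)
  out_inj := φ.toEquiv.injective.comp P.out_inj
  out_surj x y h := by
    obtain ⟨a, ha⟩ := P.out_surj _ _ (φ.symm.succ_eq_some h)
    exact ⟨a, by rw [ha]; exact φ.toEquiv.apply_symm_apply x⟩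
  s_eq a := by rw [P.s_eq]; simp
  t_eq a := by rw [P.t_eq]; simp
  rel_iff a b := by
    rw [P.rel_iff, ← φ.toEquiv.injective.eq_iff, φ.inv_apply]

/-- The bound quiver of a surface with arcs is presented by every side system with the same
sides. -/
def ArcSurface.presents (T : ArcSurface) (C : SideSystem) (ψ : T.Side ≃ C.Side)
    (hinv : ∀ e, ψ (T.inv e) = C.inv (ψ e)) (hnext : ∀ e, (T.next e).map ψ = C.next (ψ e)) :
    Presents C T.boundQuiver where
  vtx x := Quot.mk _ (ψ.symm x)
  vtx_surj v := by
    obtain ⟨e, rfl⟩ := Quot.exists_rep v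
    exact ⟨ψ e, congrArg (Quot.mk _) (ψ.symm_apply_apply e)⟩
  vtx_eq x y := by
    obtain ⟨e, rfl⟩ := ψ.surjective x
    obtain ⟨f, rfl⟩ := ψ.surjective y
    rw [ψ.symm_apply_apply, ψ.symm_apply_apply]
    constructor
    · intro h
      have hT : ∀ e, T.inv (T.inv e) = e := fun e => ψ.injective (by simp [hinv])
      have h1 := congrArg (Quot.lift (fun x => ({x, T.inv x} : Set T.Side)) (by
        rintro a _ rfl
        rw [hT, Set.pair_comm])) h
      have h2 : ({e, T.inv e} : Set T.Side) = {f, T.inv f} := h1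
      have h3 : e ∈ ({f, T.inv f} : Set T.Side) := h2 ▸ Set.mem_insert _ _
      rcases h3 with rfl | rfl
      · exact Or.inl rfl
      · exact Or.inr (hinv f)
    · rintro (h | h)
      · rw [ψ.injective h]
      · rw [← hinv] at h
        rw [ψ.injective h]
        exact (Quot.sound (r := fun e f : T.Side => f = T.inv e) rfl).symm
  out a := C.inv (ψ a.1.1)
  inn a := ψ a.1.2
  succ_out a := by
    have := hnext a.1.1
    rw [a.2] at this
    exact this.symm
  out_inj a b h := by
    have h1 := ψ.injective (SideSystem.inv_injective h)
    refine Subtype.ext (Prod.ext h1 (Option.some.inj ?_))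
    rw [← a.2, ← b.2, h1]
  out_surj x y h := by
    have h1 := hnext (ψ.symm (C.inv x))
    rw [ψ.apply_symm_apply, SideSystem.next, C.inv_inv, h] at h1
    obtain ⟨f, hf, -⟩ := Option.map_eq_some_iff.1 h1
    exact ⟨⟨(_, f), hf⟩, by simp⟩
  s_eq a := by
    change Quot.mk _ a.1.1 = Quot.mk _ (ψ.symm (C.inv (ψ a.1.1)))
    rw [← hinv, ψ.symm_apply_apply]
    exact Quot.sound rfl
  t_eq a := by
    change Quot.mk _ a.1.2 = Quot.mk _ (ψ.symm (ψ a.1.2))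
    rw [ψ.symm_apply_apply]
  rel_iff a b := by
    rw [C.inv_inv, ψ.injective.eq_iff]
    rfl

namespace MarkedSurface

variable (S : MarkedSurface)

theorem succ_eq_some {e f : S.Side} (h : S.succ e = some f) :
    f.1 = e.1 ∧ f.2.1 = e.2.1 + 1 := by
  rw [succ] at h
  split_ifs at h
  cases h
  exact ⟨rfl, rfl⟩

/-- The side system of a marked surface. -/
def system : SideSystem where
  Side := S.Side
  inv := S.glue
  succ := S.succ
  inv_inv := S.glue_glue
  inv_ne := S.glue_ne
  succ_inj x y z hx hy := by
    obtain ⟨h1, h2⟩ := S.succ_eq_some hx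
    obtain ⟨h3, h4⟩ := S.succ_eq_some hy
    obtain ⟨j, x⟩ := x
    obtain ⟨j', y⟩ := y
    obtain rfl : j = j' := h1.symm.trans h3
    have h5 : x.1 = y.1 := Nat.succ_injective (h2.symm.trans h4)
    rw [Fin.ext h5]
  acyclic x h := by
    have : ∀ y, Relation.TransGen (fun a b => S.succ a = some b) x y → x.2.1 < y.2.1 := by
      intro y h
      induction h with
      | single h => have := (S.succ_eq_some h).2; lia
      | tail _ h ih => have := (S.succ_eq_some h).2; lia
    exact (this x h).false

/-- The side system of `𝐒` presents the bound quiver of `𝐒`. -/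
def presents : Presents S.system S.toArcSurface.boundQuiver :=
  S.toArcSurface.presents S.system (Equiv.refl _) (fun _ => rfl) fun e => by
    change (S.next e).map id = S.next e
    simp

theorem cma_next_eq (e : S.cma.Side) : S.cma.next e = S.system.cma.next e := by
  rcases e with e | ⟨e, _ | _⟩
  · by_cases h : S.OnInfinityPolygon e
    · exact (dif_pos h).trans (SideSystem.cma_succ_old (C := S.system) h).symm
    · exact (dif_neg h).trans (SideSystem.cma_succ_old_of_not (C := S.system) h).symm
  · rfl
  · rfl

/-- The side system `S.system.cma` presents the bound quiver of `𝐒^CMA`. -/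
noncomputable def presentsCMA : Presents S.system.cma S.cma.boundQuiver :=
  S.cma.presents S.system.cma (Equiv.refl _) (fun e => by rcases e with e | ⟨e, b⟩ <;> rfl)
    fun e => (congrFun Option.map_id (S.cma.next e)).trans (S.cma_next_eq e)

/-- The Cohen–Macaulay–Auslander algebra of the algebra of `𝐒` is the algebra of `𝐒^CMA`. -/
theorem nonempty_cmAuslander_equiv (k : Type u) [Field k] :
    Nonempty (CMAuslander (S.algebra k) ≃ₐ[k] S.cma.algebra k) :=
  (SideSystem.nonempty_cmAuslander_equiv (S.presents.algEquiv k)).map fun φ =>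
    φ.trans (S.presentsCMA.algEquiv k).symm

end MarkedSurface

/-! ### The side system is determined by its matrix algebra -/

/-- Mutually inverse matrices have the same number of rows and columns, and there is a bijection
between the rows and the columns along which the entries do not vanish: some term of the Leibniz
formula for the determinant is non-zero. -/
theorem Matrix.exists_equiv_of_mul_eq_one {k m n : Type*} [Field k] [Fintype m] [Fintype n]
    [DecidableEq m] [DecidableEq n] {M : Matrix m n k} {N : Matrix n m k} (h : M * N = 1)
    (h' : N * M = 1) : ∃ τ : n ≃ m, ∀ i, M (τ i) i ≠ 0 := by
  let e : n ≃ m := Fintype.equivOfCardEq (Matrix.square_of_invertible M N h h').symm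
  have h1 : (M.submatrix e id) * (N.submatrix id e) = 1 := by
    rw [← Matrix.submatrix_mul _ _ _ _ _ Function.bijective_id, h, Matrix.submatrix_one_equiv]
  have h2 : (M.submatrix e id).det ≠ 0 := by
    intro h3
    have := congrArg Matrix.det h1
    rw [Matrix.det_mul, h3, zero_mul, Matrix.det_one] at this
    exact zero_ne_one this
  rw [Matrix.det_apply] at h2
  obtain ⟨p, -, hp⟩ := Finset.exists_ne_zero_of_sum_ne_zero h2
  refine ⟨p.trans e, fun i hi => hp ?_⟩
  have h3 : ∏ j, M.submatrix e id (p j) j = 0 := Finset.prod_eq_zero (Finset.mem_univ i) hi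
  rw [h3, smul_zero]

namespace SideSystem

variable {C D : SideSystem} {k : Type u} [Field k]

noncomputable instance : Fintype {x // C.IsRep x} := Fintype.ofFinite _

theorem sum_idemMat : ∑ r : {x // C.IsRep x}, idemMat (k := k) r.1 = 1 := by
  classical
  ext y z
  simp only [AddSubmonoidClass.coe_finsetSum, Matrix.sum_apply, idemMat_apply]
  rw [show ((1 : C.matAlg k) : Matrix C.Side C.Side k) = 1 from rfl, Matrix.one_apply,
    Finset.sum_eq_single (repSide y)]
  · rcases repSide_eq y with h | h <;> simp [h]
  · intro r _ hr
    refine if_neg fun h => hr ?_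
    rcases h.2 with h | h
    · rw [h, repSide_of_isRep r.2]
    · rw [h, repSide_inv, repSide_of_isRep r.2]
  · simp

/-- The only characters of the matrix algebra are the diagonal entries. -/
theorem exists_character_eq (χ : C.matAlg k →ₐ[k] k) : ∃ x, ∀ M, χ M = M.1 x x := by
  obtain ⟨r, hr⟩ : ∃ r : C.Side, χ (idemMat r) ≠ 0 := by
    by_contra! h
    have h1 := congrArg χ (sum_idemMat (C := C) (k := k))
    rw [map_sum, Finset.sum_eq_zero fun r _ => h r.1, map_one] at h1
    exact zero_ne_one h1
  have hidem : (idemMat r : C.matAlg k) * idemMat r = idemMat r := by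
    ext y z
    rw [idemMat_mul_apply, idemMat_apply]
    by_cases h : y = z
    · subst h; simp
    · simp [h]
  have hr1 : χ (idemMat r) = 1 := by
    have := congrArg χ hidem
    rw [map_mul] at this
    exact mul_right_cancel₀ hr (this.trans (one_mul _).symm)
  refine ⟨r, fun M => ?_⟩
  by_contra hM
  -- this element is in the kernel of `χ`, and it is invertible
  let u : C.matAlg k := idemMat r * M + (1 - (1 + χ M) • idemMat r)
  have hχ : χ u = 0 := by
    simp only [u, map_add, map_sub, map_mul, map_one, map_smul, hr1, smul_eq_mul]
    ring
  have hu : ∀ x, ((AlgEquiv.refl : C.matAlg k ≃ₐ[k] C.matAlg k) u).1 x x ≠ 0 := by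
    intro x
    change (idemMat r * M).1 x x +
      ((1 : Matrix C.Side C.Side k) x x - (1 + χ M) • (idemMat r).1 x x) ≠ 0
    rw [idemMat_mul_apply, idemMat_apply, Matrix.one_apply_eq]
    by_cases hx : x = r ∨ x = C.inv r
    · have h1 : M.1 x x = M.1 r r := by
        rcases hx with rfl | rfl
        · rfl
        · exact M.2.2 r
      rw [if_pos hx, if_pos ⟨rfl, hx⟩, h1, smul_eq_mul, mul_one]
      intro h2
      exact hM (by linear_combination -h2)
    · rw [if_neg hx, if_neg fun h => hx h.2]
      simp
  obtain ⟨b, hb⟩ := exists_mul_eq hu 1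
  have := congrArg χ hb
  rw [map_mul, hχ, zero_mul, map_one] at this
  exact zero_ne_one this

/-- The arrows of a side system. -/
abbrev Arrow (C : SideSystem) : Type := {p : C.Side × C.Side // C.succ p.1 = some p.2}

theorem Arrow.lt (a : C.Arrow) : a.1.1 < a.1.2 := lt_of_succ a.2

theorem Arrow.ext_source {a b : C.Arrow} (h : a.1.1 = b.1.1) : a = b := by
  refine Subtype.ext (Prod.ext h (Option.some.inj ?_))
  rw [← a.2, ← b.2, h]

theorem Arrow.ext_target {a b : C.Arrow} (h : a.1.2 = b.1.2) : a = b :=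
  Arrow.ext_source (C.succ_inj _ _ _ a.2 (by rw [h]; exact b.2))

/-- An arrow as an element of the matrix algebra. -/
noncomputable abbrev Arrow.mat (k : Type u) [Field k] (a : C.Arrow) : C.matAlg k := unitMat a.lt

theorem Arrow.mat_apply_self (a : C.Arrow) (x : C.Side) : (a.mat k).1 x x = 0 := by
  rw [unitMat_apply, if_neg]
  rintro ⟨h, h'⟩
  exact a.lt.ne (h.trans h'.symm)

open Classical in
theorem eq_sum_unitMat {M : C.matAlg k} (h : ∀ x, M.1 x x = 0) :
    M = ∑ p : C.Side × C.Side, if h : p.1 < p.2 then M.1 p.1 p.2 • unitMat h else 0 := by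
  ext z w
  simp only [AddSubmonoidClass.coe_finsetSum, Matrix.sum_apply, Fintype.sum_prod_type]
  have h1 : ∀ x y, (if h : x < y then M.1 x y • unitMat h else (0 : C.matAlg k)).1 z w =
      if x = z then if y = w then M.1 x y else 0 else 0 := by
    intro x y
    by_cases h1 : x < y
    · rw [dif_pos h1, SetLike.val_smul, Matrix.smul_apply, unitMat_apply, smul_eq_mul]
      split_ifs <;> simp_all
    · have h2 : M.1 x y = 0 := by
        by_cases h6 : x = y
        · rw [← h6, h]
        · exact M.2.1 x y fun h7 => h1 (lt_of_le_of_ne h7 h6)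
      rw [dif_neg h1, h2, ite_self, ite_self]
      rfl
  simp [h1]

/-- A functional that satisfies the Leibniz rule with respect to two diagonal entries is determined
by its values at the arrows, for the elements with vanishing diagonal: the other paths are
products. -/
theorem map_eq_sum_arrow (f : C.matAlg k →ₗ[k] k) {x y : C.Side}
    (hf : ∀ M N, f (M * N) = M.1 x x * f N + f M * N.1 y y) {M : C.matAlg k}
    (hM : ∀ x, M.1 x x = 0) : f M = ∑ a : C.Arrow, M.1 a.1.1 a.1.2 * f (a.mat k) := by
  have hself : ∀ {u v : C.Side} (h : u < v) z, (unitMat h : C.matAlg k).1 z z = 0 := by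
    intro u v h z
    rw [unitMat_apply, if_neg]
    rintro ⟨h1, h2⟩
    exact h.ne (h1.trans h2.symm)
  have h0 : ∀ {u v : C.Side} (h : u < v), C.succ u ≠ some v → f (unitMat h) = 0 := by
    intro u v h huv
    obtain ⟨w, hw, hwv⟩ := exists_succ_le h
    have hwv' : w < v := lt_of_le_of_ne hwv fun h => huv (h ▸ hw)
    have h1 : (unitMat h : C.matAlg k) = unitMat (lt_of_succ hw) * unitMat hwv' := by
      ext p q
      rw [unitMat_mul_apply, unitMat_apply, unitMat_apply]
      by_cases hp : p = u
      · simp [hp]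
      · simp [hp, Ne.symm hp]
    rw [h1, hf, hself, hself, zero_mul, mul_zero, add_zero]
  classical
  conv_lhs => rw [eq_sum_unitMat hM, map_sum]
  rw [← Finset.sum_subset (Finset.subset_univ
    (Finset.univ.filter fun p : C.Side × C.Side => C.succ p.1 = some p.2)),
    Finset.sum_subtype _ (p := fun p : C.Side × C.Side => C.succ p.1 = some p.2) (by simp)]
  · refine Finset.sum_congr rfl fun a _ => ?_
    rw [dif_pos (lt_of_succ a.2), map_smul, smul_eq_mul]
  · intro p _ hp
    split_ifs with h
    · rw [map_smul, h0 h (by simpa using hp), smul_zero]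
    · exact map_zero f

/-- A diagonal entry, as a character. -/
noncomputable def diagHom (x : C.Side) : C.matAlg k →ₐ[k] k :=
  AlgHom.ofLinearMap
    { toFun M := M.1 x x
      map_add' _ _ := rfl
      map_smul' _ _ := rfl }
    (Matrix.one_apply_eq x) (fun M N => matAlg_apply_self M N x)

/-- A matrix entry, as a linear functional. -/
noncomputable def entry (x y : C.Side) : C.matAlg k →ₗ[k] k where
  toFun M := M.1 x y
  map_add' _ _ := rfl
  map_smul' _ _ := rfl

/-- Under the isomorphism `φ` the characters of `x` and `x'` correspond to each other. -/
def Match (φ : C.matAlg k ≃ₐ[k] D.matAlg k) (x : C.Side) (x' : D.Side) : Prop :=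
  ∀ M, (φ M).1 x' x' = M.1 x x

section Match

variable {φ : C.matAlg k ≃ₐ[k] D.matAlg k}

theorem Match.symm {x : C.Side} {x' : D.Side} (h : Match φ x x') : Match φ.symm x' x :=
  fun M => by rw [← h, φ.apply_symm_apply]

theorem Match.inv_left {x : C.Side} {x' : D.Side} (h : Match φ x x') : Match φ (C.inv x) x' :=
  fun M => by rw [M.2.2, h]

theorem Match.inv_right {x : C.Side} {x' : D.Side} (h : Match φ x x') : Match φ x (D.inv x') :=
  fun M => by rw [(φ M).2.2, h]

theorem exists_match_left (φ : C.matAlg k ≃ₐ[k] D.matAlg k) (x' : D.Side) :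
    ∃ x, Match φ x x' :=
  exists_character_eq ((diagHom x').comp (φ : C.matAlg k →ₐ[k] D.matAlg k))

theorem exists_match_right (φ : C.matAlg k ≃ₐ[k] D.matAlg k) (x : C.Side) :
    ∃ x', Match φ x x' :=
  (exists_match_left φ.symm x).imp fun _ h => h.symm

theorem eq_or_eq_inv_of_idemMat {x y : C.Side}
    (h : (idemMat x : C.matAlg k).1 y y ≠ 0) : y = x ∨ y = C.inv x := by
  rw [idemMat_apply] at h
  by_contra h'
  exact h (if_neg fun h => h' h.2)

theorem idemMat_apply_self (x : C.Side) : (idemMat x : C.matAlg k).1 x x = 1 := by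
  rw [idemMat_apply, if_pos ⟨rfl, Or.inl rfl⟩]

theorem match_of_idemMat {x : C.Side} {x' : D.Side} (h : (φ (idemMat x)).1 x' x' ≠ 0) :
    Match φ x x' := by
  obtain ⟨y, hy⟩ := exists_match_left φ x'
  rw [hy] at h
  rcases eq_or_eq_inv_of_idemMat h with rfl | rfl
  · exact hy
  · simpa using hy.inv_left

theorem Match.left_unique {x y : C.Side} {x' : D.Side} (h : Match φ x x') (h' : Match φ y x') :
    y = x ∨ y = C.inv x := by
  refine eq_or_eq_inv_of_idemMat (k := k) ?_
  rw [← h', h, idemMat_apply_self]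
  exact one_ne_zero

theorem Match.right_unique {x : C.Side} {x' y' : D.Side} (h : Match φ x x') (h' : Match φ x y') :
    y' = x' ∨ y' = D.inv x' :=
  h.symm.left_unique h'.symm

theorem map_apply_self_eq_zero {M : C.matAlg k} (hM : ∀ x, M.1 x x = 0) (x' : D.Side) :
    (φ M).1 x' x' = 0 := by
  obtain ⟨x, hx⟩ := exists_match_left φ x'
  rw [hx, hM]

/-- The coefficients of the images of the arrows at the arrows. -/
noncomputable def arrowMatrix (φ : C.matAlg k ≃ₐ[k] D.matAlg k) : Matrix D.Arrow C.Arrow k :=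
  Matrix.of fun a' a => (φ (a.mat k)).1 a'.1.1 a'.1.2

theorem arrowMatrix_apply (a' : D.Arrow) (a : C.Arrow) :
    arrowMatrix φ a' a = (φ (a.mat k)).1 a'.1.1 a'.1.2 := rfl

/-- The arrow matrices of an isomorphism and of its inverse are inverse to each other: an entry at
an arrow satisfies a Leibniz rule, so on images of arrows it only depends on their coefficients at
arrows. -/
theorem arrowMatrix_symm_mul (φ : C.matAlg k ≃ₐ[k] D.matAlg k) :
    arrowMatrix φ.symm * arrowMatrix φ = 1 := by
  ext b a
  obtain ⟨x, hx⟩ := exists_match_right φ b.1.1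
  obtain ⟨y, hy⟩ := exists_match_right φ b.1.2
  have h := map_eq_sum_arrow
    ((entry b.1.1 b.1.2).comp (φ.symm : D.matAlg k →ₗ[k] C.matAlg k)) (x := x) (y := y)
    (fun M N => by
      change (φ.symm (M * N)).1 b.1.1 b.1.2 =
        M.1 x x * (φ.symm N).1 b.1.1 b.1.2 + (φ.symm M).1 b.1.1 b.1.2 * N.1 y y
      rw [map_mul, matAlg_apply_succ _ _ b.2, hx.symm, hy.symm])
    (M := φ (a.mat k)) (map_apply_self_eq_zero a.mat_apply_self)
  have h1 : (φ.symm (φ (a.mat k))).1 b.1.1 b.1.2 =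
      ∑ a' : D.Arrow, (φ (a.mat k)).1 a'.1.1 a'.1.2 * (φ.symm (a'.mat k)).1 b.1.1 b.1.2 := h
  rw [φ.symm_apply_apply, unitMat_apply] at h1
  rw [Matrix.mul_apply, Matrix.one_apply]
  simp only [arrowMatrix_apply]
  simp only [mul_comm] at h1 ⊢
  rw [← h1]
  refine if_congr ?_ rfl rfl
  rw [Subtype.ext_iff, Prod.ext_iff, eq_comm, eq_comm (a := a.1.2)]

theorem exists_arrow_equiv (φ : C.matAlg k ≃ₐ[k] D.matAlg k) :
    ∃ τ : C.Arrow ≃ D.Arrow, ∀ a, (φ (a.mat k)).1 (τ a).1.1 (τ a).1.2 ≠ 0 :=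
  Matrix.exists_equiv_of_mul_eq_one (M := arrowMatrix φ) (N := arrowMatrix φ.symm)
    (arrowMatrix_symm_mul φ.symm) (arrowMatrix_symm_mul φ)

theorem match_source {a : C.Arrow} {a' : D.Arrow} (h : (φ (a.mat k)).1 a'.1.1 a'.1.2 ≠ 0) :
    Match φ a.1.1 a'.1.1 := by
  have h1 : idemMat a.1.1 * a.mat k = a.mat k := by
    ext y z
    rw [idemMat_mul_apply, unitMat_apply]
    by_cases hy : a.1.1 = y
    · simp [hy]
    · simp [hy]
  rw [← h1, map_mul, matAlg_apply_succ _ _ a'.2, map_apply_self_eq_zero a.mat_apply_self,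
    mul_zero, add_zero] at h
  exact match_of_idemMat (left_ne_zero_of_mul h)

theorem match_target {a : C.Arrow} {a' : D.Arrow} (h : (φ (a.mat k)).1 a'.1.1 a'.1.2 ≠ 0) :
    Match φ a.1.2 a'.1.2 := by
  have h1 : a.mat k * idemMat a.1.2 = a.mat k := by
    ext y z
    rw [mul_idemMat_apply, unitMat_apply]
    by_cases hz : a.1.2 = z
    · simp [hz]
    · simp [hz]
  rw [← h1, map_mul, matAlg_apply_succ _ _ a'.2, map_apply_self_eq_zero a.mat_apply_self,
    zero_mul, zero_add] at h
  exact match_of_idemMat (right_ne_zero_of_mul h)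

/-- A product of two arrows which is zero corresponds to a product which is zero. -/
theorem target_eq_inv_source {a b : C.Arrow} {a' b' : D.Arrow}
    (ha : (φ (a.mat k)).1 a'.1.1 a'.1.2 ≠ 0) (hb : (φ (b.mat k)).1 b'.1.1 b'.1.2 ≠ 0)
    (h : a.1.2 = C.inv b.1.1) : a'.1.2 = D.inv b'.1.1 := by
  have h1 := (match_source hb).inv_left
  rw [← h] at h1
  refine (h1.right_unique (match_target ha)).resolve_left fun h2 => ?_
  have h3 : a.mat k * b.mat k = 0 := by
    ext y z
    rw [unitMat_mul_apply, unitMat_apply]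
    split_ifs with h4 h5
    · exact (C.ne_inv _ (h5.1.trans h)).elim
    · rfl
    · rfl
  -- the coefficient of the product at the path `a' b'`
  have h4 : (φ (a.mat k) * φ (b.mat k)).1 a'.1.1 b'.1.2 =
      (φ (a.mat k)).1 a'.1.1 a'.1.2 * (φ (b.mat k)).1 b'.1.1 b'.1.2 := by
    change ((φ (a.mat k)).1 * (φ (b.mat k)).1) _ _ = _
    rw [Matrix.mul_apply, Finset.sum_eq_single a'.1.2, h2]
    · intro z _ hz
      by_cases h5 : a'.1.1 ≤ z
      · rcases eq_or_lt_of_le h5 with rfl | h5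
        · rw [map_apply_self_eq_zero a.mat_apply_self, zero_mul]
        · have h6 := lt_of_le_of_ne (succ_le_of_lt a'.2 h5) (Ne.symm hz)
          rw [h2] at h6
          rcases eq_or_lt_of_le (succ_le_of_lt b'.2 h6) with rfl | h7
          · rw [map_apply_self_eq_zero b.mat_apply_self, mul_zero]
          · rw [(φ (b.mat k)).2.1 _ _ h7.not_ge, mul_zero]
      · rw [(φ (a.mat k)).2.1 _ _ h5, zero_mul]
    · simp
  rw [← map_mul, h3, map_zero] at h4
  exact mul_ne_zero ha hb h4.symm

/-- An isomorphism of matrix algebras gives a bijection of the arrows which is compatible with their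
end points and with the products of two arrows that vanish. -/
theorem exists_arrow_equiv_iff (φ : C.matAlg k ≃ₐ[k] D.matAlg k) :
    ∃ τ : C.Arrow ≃ D.Arrow, (∀ a, Match φ a.1.1 (τ a).1.1 ∧ Match φ a.1.2 (τ a).1.2) ∧
      ∀ a b, a.1.2 = C.inv b.1.1 ↔ (τ a).1.2 = D.inv (τ b).1.1 := by
  obtain ⟨τ, hτ⟩ := exists_arrow_equiv φ
  obtain ⟨υ, hυ⟩ := exists_arrow_equiv φ.symm
  refine ⟨τ, fun a => ⟨match_source (hτ a), match_target (hτ a)⟩, ?_⟩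
  let R : Set (C.Arrow × C.Arrow) := {p | p.1.1.2 = C.inv p.2.1.1}
  let R' : Set (D.Arrow × D.Arrow) := {p | p.1.1.2 = D.inv p.2.1.1}
  have h1 : Set.MapsTo (τ.prodCongr τ) R R' := fun p hp =>
    target_eq_inv_source (hτ p.1) (hτ p.2) hp
  have h2 : Set.MapsTo (υ.prodCongr υ) R' R := fun p hp =>
    target_eq_inv_source (hυ p.1) (hυ p.2) hp
  -- an injection of `R` into `R'` is surjective, as there is one in the other direction
  have h3 : (τ.prodCongr τ) '' R = R' := by
    refine Set.eq_of_subset_of_ncard_le h1.image_subset ?_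
    rw [Set.ncard_image_of_injective _ (τ.prodCongr τ).injective,
      ← Set.ncard_image_of_injective R' (υ.prodCongr υ).injective]
    exact Set.ncard_le_ncard h2.image_subset
  intro a b
  refine ⟨fun h => h1 (show (a, b) ∈ R from h), fun h => ?_⟩
  have h4 : (τ a, τ b) ∈ (τ.prodCongr τ) '' R := h3 ▸ h
  obtain ⟨p, hp, hp'⟩ := h4
  have h5 : p = (a, b) := (τ.prodCongr τ).injective hp'
  rw [h5] at hp
  exact hp

end Match

end SideSystem

/-! ### Isomorphic matrix algebras have isomorphic side systems -/

namespace SideSystem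

variable {C D : SideSystem} {k : Type u} [Field k]

/-- The side `x'` has the same arrows as `x`, with respect to a bijection `τ` of the arrows. -/
def SameArrows (τ : C.Arrow ≃ D.Arrow) (x : C.Side) (x' : D.Side) : Prop :=
  (∀ a, a.1.1 = x ↔ (τ a).1.1 = x') ∧ ∀ a, a.1.2 = x ↔ (τ a).1.2 = x'

variable {φ : C.matAlg k ≃ₐ[k] D.matAlg k} {τ : C.Arrow ≃ D.Arrow}

theorem Match.cases {x y : C.Side} {x' y' : D.Side} (h : Match φ x x') (h' : Match φ y y') :
    ((y = x ∨ y = C.inv x) ↔ (y' = x' ∨ y' = D.inv x')) := by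
  constructor
  · rintro (rfl | rfl)
    · exact h.right_unique h'
    · exact h.right_unique (by simpa using h'.inv_left)
  · rintro (rfl | rfl)
    · exact h.left_unique h'
    · exact h.left_unique (by simpa using h'.inv_right)

variable (hτ : ∀ a, Match φ a.1.1 (τ a).1.1 ∧ Match φ a.1.2 (τ a).1.2)
  (hrel : ∀ a b, a.1.2 = C.inv b.1.1 ↔ (τ a).1.2 = D.inv (τ b).1.1)

include hτ hrel

/-- The end points of arrows correspond up to `inv`, and the relations decide about the side. -/
theorem target_eq_source_iff (a b : C.Arrow) : a.1.2 = b.1.1 ↔ (τ a).1.2 = (τ b).1.1 := by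
  have h := (hτ b).1.cases (hτ a).2
  have h1 := hrel a b
  have h2 := C.ne_inv b.1.1
  have h3 := D.ne_inv (τ b).1.1
  grind

/-- The side at which an arrow enters corresponds to the one of its image: the arrow which leaves on
this side is the one with a non-zero product, and the arrow which leaves on the other side is the
one with a zero product. -/
theorem sameArrows_of_target {x : C.Side} {a : C.Arrow} (ha : a.1.2 = x) :
    Match φ x (τ a).1.2 ∧ SameArrows τ x (τ a).1.2 ∧
      SameArrows τ (C.inv x) (D.inv (τ a).1.2) := by
  subst ha
  have htgt : ∀ b, b.1.2 = a.1.2 ↔ (τ b).1.2 = (τ a).1.2 := fun b =>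
    ⟨fun h => by rw [Arrow.ext_target h], fun h => by rw [τ.injective (Arrow.ext_target h)]⟩
  refine ⟨(hτ a).2, ⟨fun b => ?_, htgt⟩, fun b => ?_, fun b => ?_⟩
  · rw [eq_comm, target_eq_source_iff hτ hrel, eq_comm]
  · rw [← inv_eq_iff, eq_comm, hrel, eq_comm, inv_eq_iff]
  · have h := (hτ a).2.cases (hτ b).2
    have h1 := htgt b
    have h2 := C.ne_inv a.1.2
    have h3 := D.ne_inv (τ a).1.2
    grind

omit hrel in
/-- The side at which an arrow leaves corresponds to the one of its image, if no arrow enters the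
arc: an arrow that leaves on the other side is a different one, and so is its image. -/
theorem sameArrows_of_source {x : C.Side} (hx : ∀ a : C.Arrow, a.1.2 ≠ x ∧ a.1.2 ≠ C.inv x)
    {a : C.Arrow} (ha : a.1.1 = x) :
    Match φ x (τ a).1.1 ∧ SameArrows τ x (τ a).1.1 ∧
      SameArrows τ (C.inv x) (D.inv (τ a).1.1) := by
  subst ha
  have hsrc : ∀ b, b.1.1 = a.1.1 ↔ (τ b).1.1 = (τ a).1.1 := fun b =>
    ⟨fun h => by rw [Arrow.ext_source h], fun h => by rw [τ.injective (Arrow.ext_source h)]⟩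
  have h2 := C.ne_inv a.1.1
  have h3 := D.ne_inv (τ a).1.1
  refine ⟨(hτ a).1, ⟨hsrc, fun b => ?_⟩, fun b => ?_, fun b => ?_⟩
  · have h := (hτ a).1.cases (hτ b).2
    have h4 := hx b
    grind
  · have h := (hτ a).1.cases (hτ b).1
    have h1 := hsrc b
    grind
  · have h := (hτ a).1.cases (hτ b).2
    have h4 := hx b
    grind

/-- For each side there is a corresponding one.  It is determined by an arrow which enters or leaves
the arc, on one of its two sides, if there is one. -/
theorem exists_sameArrows (x : C.Side) :
    ∃ x', Match φ x x' ∧ SameArrows τ x x' ∧ SameArrows τ (C.inv x) (D.inv x') := by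
  have hswap : (∃ x', Match φ (C.inv x) x' ∧ SameArrows τ (C.inv x) x' ∧
      SameArrows τ (C.inv (C.inv x)) (D.inv x')) →
      ∃ x', Match φ x x' ∧ SameArrows τ x x' ∧ SameArrows τ (C.inv x) (D.inv x') := by
    rintro ⟨x', h1, h2, h3⟩
    rw [C.inv_inv] at h3
    refine ⟨D.inv x', by simpa using h1.inv_left.inv_right, h3, by simpa using h2⟩
  by_cases h1 : ∃ a : C.Arrow, a.1.2 = x
  · obtain ⟨a, ha⟩ := h1
    exact ⟨_, sameArrows_of_target hτ hrel ha⟩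
  by_cases h2 : ∃ a : C.Arrow, a.1.2 = C.inv x
  · obtain ⟨a, ha⟩ := h2
    exact hswap ⟨_, sameArrows_of_target hτ hrel ha⟩
  push Not at h1 h2
  by_cases h3 : ∃ a : C.Arrow, a.1.1 = x
  · obtain ⟨a, ha⟩ := h3
    exact ⟨_, sameArrows_of_source hτ (fun b => ⟨h1 b, h2 b⟩) ha⟩
  by_cases h4 : ∃ a : C.Arrow, a.1.1 = C.inv x
  · obtain ⟨a, ha⟩ := h4
    refine hswap ⟨_, sameArrows_of_source hτ (fun b => ⟨h2 b, ?_⟩) ha⟩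
    rw [C.inv_inv]
    exact h1 b
  push Not at h3 h4
  obtain ⟨x', hx'⟩ := exists_match_right φ x
  refine ⟨x', hx', ⟨fun a => ?_, fun a => ?_⟩, fun a => ?_, fun a => ?_⟩
  · have := hx'.cases (hτ a).1
    grind
  · have := hx'.cases (hτ a).2
    grind
  · have := hx'.cases (hτ a).1
    grind
  · have := hx'.cases (hτ a).2
    grind

/-- A choice of corresponding sides is an isomorphism of side systems. -/
theorem nonempty_iso_of_sameArrows : Nonempty (Iso C D) := by
  classical
  choose f hf1 hf2 hf3 using exists_sameArrows hτ hrel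
  let g : C.Side → D.Side := fun x => if C.IsRep x then f x else D.inv (f (C.inv x))
  have hg : ∀ x, g (C.inv x) = D.inv (g x) := by
    intro x
    by_cases h : C.IsRep x
    · simp only [g, if_pos h, if_neg h.not_inv, C.inv_inv]
    · simp only [g, if_neg h, if_pos ((isRep_or x).resolve_left h), D.inv_inv]
  have hmatch : ∀ x, Match φ x (g x) := by
    intro x
    by_cases h : C.IsRep x
    · simp only [g, if_pos h, hf1]
    · simp only [g, if_neg h]
      simpa using (hf1 (C.inv x)).inv_left.inv_right
  have hsame : ∀ x, SameArrows τ x (g x) := by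
    intro x
    by_cases h : C.IsRep x
    · simp only [g, if_pos h, hf2]
    · simp only [g, if_neg h]
      simpa using hf3 (C.inv x)
  have hinj : Function.Injective g := by
    intro x y hxy
    have h1 := hmatch x
    rw [hxy] at h1
    refine (((hmatch y).left_unique h1).resolve_right fun h => ?_)
    rw [h, hg] at hxy
    exact D.inv_ne _ hxy
  have hsurj : Function.Surjective g := by
    intro x'
    obtain ⟨x, hx⟩ := exists_match_left φ x'
    rcases hx.right_unique (hmatch x) with h | h
    · exact ⟨x, h⟩
    · exact ⟨C.inv x, by rw [hg, h, D.inv_inv]⟩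
  refine ⟨⟨Equiv.ofBijective g ⟨hinj, hsurj⟩, hg, fun x => ?_⟩⟩
  change (C.succ x).map g = D.succ (g x)
  cases h : C.succ x with
  | some y =>
    let a : C.Arrow := ⟨(x, y), h⟩
    have h1 : (τ a).1.1 = g x := ((hsame x).1 a).1 rfl
    have h2 : (τ a).1.2 = g y := ((hsame y).2 a).1 rfl
    rw [← h1, (τ a).2, h2]
    rfl
  | none =>
    cases h' : D.succ (g x) with
    | none => rfl
    | some y' =>
      obtain ⟨a, ha⟩ := τ.surjective ⟨(g x, y'), h'⟩
      have h1 : a.1.1 = x := ((hsame x).1 a).2 (by rw [ha])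
      have h2 := a.2
      rw [h1, h] at h2
      cases h2

omit hτ hrel

/-- Side systems with isomorphic matrix algebras are isomorphic. -/
theorem nonempty_iso (φ : C.matAlg k ≃ₐ[k] D.matAlg k) : Nonempty (Iso C D) := by
  obtain ⟨τ, hτ, hrel⟩ := exists_arrow_equiv_iff φ
  exact nonempty_iso_of_sameArrows hτ hrel

end SideSystem

/-! ### Side systems of gentle algebras -/

namespace BoundQuiver

variable (k : Type u) [Field k] (Q : BoundQuiver)

open Classical in
/-- The action of the generators of the path algebra on sequences, given by an infinite path:
the arrows of the path shift the sequences. -/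
noncomputable def seqAction (a : ℕ → Q.E) : FreeAlgebra k (Q.V ⊕ Q.E) →ₐ[k] Module.End k (ℕ → k) :=
  FreeAlgebra.lift k (Sum.elim
    (fun v =>
      { toFun g n := if Q.s (a n) = v then g n else 0
        map_add' g h := by ext n; by_cases h : Q.s (a n) = v <;> simp [h]
        map_smul' c g := by ext n; by_cases h : Q.s (a n) = v <;> simp [h] })
    (fun b =>
      { toFun g n := if a n = b then g (n + 1) else 0
        map_add' g h := by ext n; by_cases h : a n = b <;> simp [h]
        map_smul' c g := by ext n; by_cases h : a n = b <;> simp [h] }))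

open Classical in
theorem seqAction_triv (a : ℕ → Q.E) (v : Q.V) (g : ℕ → k) (n : ℕ) :
    seqAction k Q a (triv k Q v) g n = if Q.s (a n) = v then g n else 0 := by
  rw [seqAction, triv, FreeAlgebra.lift_ι_apply]
  rfl

open Classical in
theorem seqAction_arr (a : ℕ → Q.E) (b : Q.E) (g : ℕ → k) (n : ℕ) :
    seqAction k Q a (arr k Q b) g n = if a n = b then g (n + 1) else 0 := by
  rw [seqAction, arr, FreeAlgebra.lift_ι_apply]
  rfl

theorem seqAction_rel {a : ℕ → Q.E} (ha : ∀ n, Q.t (a n) = Q.s (a (n + 1)))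
    (ha' : ∀ n, ¬ Q.rel (a n) (a (n + 1))) ⦃x y : FreeAlgebra k (Q.V ⊕ Q.E)⦄
    (h : Relation k Q x y) : seqAction k Q a x = seqAction k Q a y := by
  classical
  refine LinearMap.ext fun g => funext fun n => ?_
  cases h with
  | idem v =>
    rw [map_mul, Module.End.mul_apply]
    simp only [seqAction_triv]
    split_ifs <;> rfl
  | orth v w h =>
    rw [map_mul, Module.End.mul_apply, map_zero]
    simp only [seqAction_triv]
    split_ifs with h1 h2
    · exact (h (h1.symm.trans h2)).elim
    · rfl
    · rfl
  | one =>
    have := Fintype.ofFinite Q.V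
    rw [finsum_eq_sum_of_fintype, map_sum, map_one, LinearMap.sum_apply, Finset.sum_apply]
    simp [seqAction_triv]
  | source b =>
    rw [map_mul, Module.End.mul_apply]
    simp only [seqAction_triv, seqAction_arr]
    split_ifs with h1 h2 h2
    · rfl
    · rfl
    · exact (h1 (by rw [h2])).elim
    · rfl
  | target b =>
    rw [map_mul, Module.End.mul_apply]
    simp only [seqAction_triv, seqAction_arr]
    split_ifs with h1 h2
    · rfl
    · exact (h2 (by rw [← h1, ha])).elim
    · rfl
  | zero b c h =>
    rw [map_mul, Module.End.mul_apply, map_zero]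
    simp only [seqAction_arr]
    split_ifs with h1 h2
    · exact (ha' n (by rwa [h1, h2])).elim
    · rfl
    · rfl

/-- In a finite-dimensional bound quiver algebra there is no infinite non-zero path: otherwise the
sum of the arrows would act on sequences as the shift, which is not integral over `k`. -/
theorem exists_rel_of_infinite_path [Module.Finite k (Q.algebra k)] {a : ℕ → Q.E}
    (ha : ∀ n, Q.t (a n) = Q.s (a (n + 1))) : ∃ n, Q.rel (a n) (a (n + 1)) := by
  classical
  by_contra! ha'
  have := Fintype.ofFinite Q.E
  let Φ : Q.algebra k →ₐ[k] Module.End k (ℕ → k) :=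
    RingQuot.liftAlgHom k ⟨seqAction k Q a, seqAction_rel k Q ha ha'⟩
  let w : Q.algebra k := RingQuot.mkAlgHom k _ (∑ b, arr k Q b)
  have hw : ∀ g n, Φ w g n = g (n + 1) := by
    intro g n
    have h1 : Φ w = seqAction k Q a (∑ b, arr k Q b) :=
      RingQuot.liftAlgHom_mkAlgHom_apply _ _ _ _
    rw [h1, map_sum, LinearMap.sum_apply, Finset.sum_apply]
    simp [seqAction_arr]
  have hpow : ∀ i g n, (Φ w ^ i) g n = g (n + i) := by
    intro i
    induction i with
    | zero => intro g n; rfl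
    | succ i ih =>
      intro g n
      rw [pow_succ, Module.End.mul_apply, ih, hw]
      rfl
  obtain ⟨p, hp, hp0⟩ := Algebra.IsIntegral.isIntegral (R := k) w
  have h2 : Polynomial.aeval (Φ w) p = 0 := by
    rw [Polynomial.aeval_algHom_apply, Polynomial.aeval_def, hp0, map_zero]
  have h3 := congrFun (LinearMap.congr_fun h2 (Pi.single p.natDegree 1)) 0
  rw [Polynomial.aeval_eq_sum_range, LinearMap.sum_apply, Finset.sum_apply,
    Finset.sum_eq_single p.natDegree] at h3
  · rw [LinearMap.smul_apply, Pi.smul_apply, hpow, zero_add, Pi.single_eq_same,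
      Polynomial.coeff_natDegree, hp.leadingCoeff] at h3
    simp at h3
  · intro i _ hi
    rw [LinearMap.smul_apply, Pi.smul_apply, hpow, zero_add, Pi.single_eq_of_ne hi, smul_zero]
  · simp

end BoundQuiver

namespace SideSystem

/-- The side system is non-empty and connected. -/
def Connected (C : SideSystem) : Prop :=
  Nonempty C.Side ∧ ∀ x y, Relation.EqvGen (fun x y => y = C.inv x ∨ C.succ x = some y) x y

end SideSystem

/-- The side system of a connected bound quiver is connected. -/
theorem Presents.connected {C : SideSystem} {Q : BoundQuiver} (P : Presents C Q)
    (h : Q.Connected) : C.Connected := by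
  refine ⟨h.1.map P.rep, fun x y => ?_⟩
  have hself : ∀ x y, P.vtx x = P.vtx y →
      Relation.EqvGen (fun x y => y = C.inv x ∨ C.succ x = some y) x y := by
    intro x y h
    rcases (P.vtx_eq x y).1 h with rfl | rfl
    · exact .refl _
    · exact .symm _ _ (.rel _ _ (Or.inl rfl))
  have key : ∀ v w, Relation.EqvGen (fun x y => ∃ a, Q.s a = x ∧ Q.t a = y) v w →
      ∀ x y, P.vtx x = v → P.vtx y = w →
        Relation.EqvGen (fun x y => y = C.inv x ∨ C.succ x = some y) x y := by
    intro v w h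
    induction h with
    | rel v w h =>
      obtain ⟨a, rfl, rfl⟩ := h
      intro x y hx hy
      exact .trans _ _ _ (hself x (P.out a) (hx.trans (P.s_eq a))) <|
        .trans _ _ _ (.rel _ _ (Or.inr (P.succ_out a))) <|
          hself _ _ ((P.t_eq a).symm.trans hy.symm)
    | refl v => exact fun x y hx hy => hself x y (hx.trans hy.symm)
    | symm v w _ ih => exact fun x y hx hy => .symm _ _ (ih y x hy hx)
    | trans u v w _ _ ih ih' =>
      intro x y hx hy
      obtain ⟨z, hz⟩ := P.vtx_surj v
      exact .trans _ _ _ (ih x z hx hz) (ih' z y hz hy)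
  exact key _ _ (h.2 (P.vtx x) (P.vtx y)) x y rfl rfl

namespace BoundQuiver.IsGentle

variable {k : Type u} [Field k] {Q : BoundQuiver}

theorem eq_of_ncard_le_two {α : Type*} [Finite α] {s : Set α} (h : s.ncard ≤ 2) {a b c : α}
    (ha : a ∈ s) (hb : b ∈ s) (hc : c ∈ s) (hba : b ≠ a) (hca : c ≠ a) : b = c := by
  by_contra hbc
  exact h.not_gt ((Set.two_lt_ncard_iff).2 ⟨a, b, c, ha, hb, hc, hba.symm, hca.symm, hbc⟩)

/-- At each vertex, the arrows can be distributed to two sides such that the non-zero products are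
those of the arrows on the same side. -/
theorem exists_sides_at (h : Q.IsGentle k) (v : Q.V) : ∃ f g : Q.E → Bool,
    (∀ b b', Q.s b = v → Q.s b' = v → f b = f b' → b = b') ∧
    (∀ a a', Q.t a = v → Q.t a' = v → g a = g a' → a = a') ∧
    ∀ a b, Q.t a = v → Q.s b = v → (Q.rel a b ↔ g a = !f b) := by
  classical
  by_cases h1 : ∃ b₀, Q.s b₀ = v
  · obtain ⟨b₀, hb₀⟩ := h1
    refine ⟨fun b => decide (b ≠ b₀), fun a => decide (Q.rel a b₀), ?_, ?_, ?_⟩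
    · intro b b' hb hb' hbb'
      have h2 : b ≠ b₀ ↔ b' ≠ b₀ := not_congr (by simpa using hbb')
      by_cases h3 : b = b₀
      · rw [h3, not_not.1 fun h4 => h2.2 h4 h3]
      · exact eq_of_ncard_le_two (h.out_le v) hb₀ hb hb' h3 (h2.1 h3)
    · intro a a' ha ha' haa'
      have h2 : Q.rel a b₀ ↔ Q.rel a' b₀ := by simpa using haa'
      by_cases h3 : Q.rel a b₀
      · exact h.left_rel b₀ a a' h3 (h2.1 h3)
      · exact h.left_not b₀ a a' (ha.trans hb₀.symm) (ha'.trans hb₀.symm) h3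
          fun h4 => h3 (h2.2 h4)
    · intro a b ha hb
      by_cases h3 : b = b₀
      · subst h3; simp
      · have h4 : Q.rel a b → ¬ Q.rel a b₀ := fun h4 h5 => h3 (h.right_rel a b b₀ h4 h5)
        have h5 : ¬ Q.rel a b₀ → Q.rel a b := fun h5 => by
          by_contra h6
          exact h3 (h.right_not a b b₀ (ha.trans hb.symm) (ha.trans hb₀.symm) h6 h5)
        simp only [h3, ne_eq, not_false_eq_true, decide_true, Bool.not_true,
          decide_eq_false_iff_not]
        exact ⟨h4, h5⟩
  · push Not at h1
    by_cases h2 : ∃ a₀, Q.t a₀ = v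
    · obtain ⟨a₀, ha₀⟩ := h2
      refine ⟨fun _ => true, fun a => decide (a ≠ a₀), fun b _ hb => (h1 b hb).elim, ?_,
        fun _ b _ hb => (h1 b hb).elim⟩
      intro b b' hb hb' hbb'
      have h2 : b ≠ a₀ ↔ b' ≠ a₀ := not_congr (by simpa using hbb')
      by_cases h3 : b = a₀
      · rw [h3, not_not.1 fun h4 => h2.2 h4 h3]
      · exact eq_of_ncard_le_two (h.in_le v) ha₀ hb hb' h3 (h2.1 h3)
    · push Not at h2
      exact ⟨fun _ => true, fun _ => true, fun b _ hb => (h1 b hb).elim,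
        fun b _ hb => (h2 b hb).elim, fun _ b _ hb => (h1 b hb).elim⟩

theorem exists_sides (h : Q.IsGentle k) : ∃ f g : Q.E → Bool,
    (∀ b b', Q.s b = Q.s b' → f b = f b' → b = b') ∧
    (∀ a a', Q.t a = Q.t a' → g a = g a' → a = a') ∧
    ∀ a b, Q.t a = Q.s b → (Q.rel a b ↔ g a = !f b) := by
  choose f g hf hg hfg using h.exists_sides_at
  refine ⟨fun b => f (Q.s b) b, fun a => g (Q.t a) a, fun b b' h h' => ?_, fun a a' h h' => ?_,
    fun a b h => ?_⟩
  · exact hf (Q.s b) b b' rfl h.symm (h'.trans (by rw [h]))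
  · exact hg (Q.t a) a a' rfl h.symm (h'.trans (by rw [h]))
  · rw [hfg (Q.t a) a b rfl h.symm]
    change _ ↔ g (Q.t a) a = !f (Q.s b) b
    rw [h]

/-- A gentle bound quiver is presented by a side system. -/
theorem exists_presents (h : Q.IsGentle k) : ∃ C, Nonempty (Presents C Q) := by
  classical
  obtain ⟨f, g, hf, hg, hfg⟩ := h.exists_sides
  let out : Q.E → Q.V × Bool := fun a => (Q.s a, f a)
  let inn : Q.E → Q.V × Bool := fun a => (Q.t a, g a)
  have hout : Function.Injective out := fun a b hab =>
    hf a b (congrArg Prod.fst hab) (congrArg Prod.snd hab)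
  have hinn : Function.Injective inn := fun a b hab =>
    hg a b (congrArg Prod.fst hab) (congrArg Prod.snd hab)
  let succ : Q.V × Bool → Option (Q.V × Bool) := fun x =>
    if h : ∃ a, out a = x then some (inn h.choose) else none
  have hsucc : ∀ a, succ (out a) = some (inn a) := by
    intro a
    have h1 : ∃ b, out b = out a := ⟨a, rfl⟩
    simp only [succ, dif_pos h1, hout h1.choose_spec]
  have hsucc' : ∀ x y, succ x = some y → ∃ a, out a = x ∧ inn a = y := by
    intro x y hxy
    simp only [succ] at hxy
    split_ifs at hxy with h1
    exact ⟨h1.choose, h1.choose_spec, Option.some.inj hxy⟩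
  have hacyclic : ∀ x, ¬ Relation.TransGen (fun a b => succ a = some b) x x := by
    intro x hx
    -- go around the cycle
    have hnext : ∀ y : {y // Relation.TransGen (fun a b => succ a = some b) y y},
        ∃ z : {y // Relation.TransGen (fun a b => succ a = some b) y y}, succ y.1 = some z.1 := by
      rintro ⟨y, hy⟩
      obtain ⟨z, hz, hzy⟩ := Relation.TransGen.head'_iff.1 hy
      exact ⟨⟨z, Relation.TransGen.tail' hzy hz⟩, hz⟩
    choose F hF using hnext
    choose a ha ha' using fun n => hsucc' _ _ (hF (F^[n] ⟨x, hx⟩))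
    have h1 : ∀ n, inn (a n) = out (a (n + 1)) := by
      intro n
      rw [ha', ha, Function.iterate_succ_apply']
    have h2 : ∀ n, Q.t (a n) = Q.s (a (n + 1)) := fun n => congrArg Prod.fst (h1 n)
    have := h.finite
    obtain ⟨n, hn⟩ := exists_rel_of_infinite_path k Q h2
    rw [hfg _ _ (h2 n)] at hn
    have h3 : g (a n) = f (a (n + 1)) := congrArg Prod.snd (h1 n)
    rw [h3] at hn
    simp at hn
  let C : SideSystem :=
    { Side := Q.V × Bool
      inv := fun x => (x.1, !x.2)
      succ := succ
      inv_inv := by simp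
      inv_ne := fun x hx => by simpa using congrArg Prod.snd hx
      succ_inj := by
        intro x y z hx hy
        obtain ⟨a, rfl, rfl⟩ := hsucc' _ _ hx
        obtain ⟨b, rfl, hb⟩ := hsucc' _ _ hy
        rw [hinn hb]
      acyclic := hacyclic }
  refine ⟨C, ⟨⟨Prod.fst, fun v => ⟨(v, true), rfl⟩, ?_, out, inn, hsucc, hout,
    fun x y hxy => (hsucc' x y hxy).imp fun _ h => h.1, fun _ => rfl, fun _ => rfl, ?_⟩⟩⟩
  · rintro ⟨v, b⟩ ⟨w, c⟩
    change v = w ↔ (v, b) = (w, c) ∨ (v, b) = (w, !c)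
    cases b <;> cases c <;> simp
  · intro a b
    change Q.rel a b ↔ (Q.t a, g a) = (Q.s b, !f b)
    rw [Prod.mk.injEq]
    exact ⟨fun h => ⟨Q.rel_comp a b h, (hfg a b (Q.rel_comp a b h)).1 h⟩,
      fun h => (hfg a b h.1).2 h.2⟩

end BoundQuiver.IsGentle

/-! ### Marked surfaces of connected side systems -/

namespace SideSystem

variable {C : SideSystem}

/-- The minimal sides, which are the first sides of the chains.  They index the `∘`-polygons. -/
abbrev MinSide (C : SideSystem) : Type := {x : C.Side // ∀ y, C.succ y ≠ some x}

theorem exists_minSide_le (x : C.Side) : ∃ μ : C.MinSide, μ.1 ≤ x := by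
  induction x using (wellFounded_lt (α := C.Side)).induction with
  | _ x ih =>
    by_cases h : ∃ y, C.succ y = some x
    · obtain ⟨y, hy⟩ := h
      obtain ⟨μ, hμ⟩ := ih y (lt_of_succ hy)
      exact ⟨μ, hμ.trans (lt_of_succ hy).le⟩
    · push Not at h
      exact ⟨⟨x, h⟩, le_rfl⟩

theorem MinSide.le_antisymm {μ ν : C.MinSide} {x : C.Side} (h : μ.1 ≤ x) (h' : ν.1 ≤ x) :
    μ = ν := by
  have hlt : ∀ {μ ν : C.MinSide}, ¬ μ.1 < ν.1 := by
    intro μ ν hμν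
    obtain ⟨z, -, hz⟩ := exists_le_pred hμν
    exact ν.2 z hz
  rcases le_or_lt_of_le h h' with h1 | h1
  · exact Subtype.ext ((eq_or_lt_of_le h1).resolve_right hlt)
  · exact (hlt h1).elim

/-- The chain that starts at a minimal side. -/
abbrev Chain (μ : C.MinSide) : Type := {x : C.Side // μ.1 ≤ x}

noncomputable instance (μ : C.MinSide) : LinearOrder (Chain μ) where
  le_total x y := (le_or_lt_of_ge x.2 y.2).imp_right le_of_lt
  toDecidableLE := Classical.decRel _

noncomputable instance (μ : C.MinSide) : Fintype (Chain μ) := Fintype.ofFinite _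

theorem Chain.succ_eq_some_iff {μ : C.MinSide} (x y : Chain μ) :
    C.succ x.1 = some y.1 ↔ x ⋖ y := by
  constructor
  · intro h
    have h1 : x.1 < y.1 := lt_of_succ h
    refine ⟨h1, fun z hz hz' => ?_⟩
    have h2 : x.1 < z.1 := hz
    have h3 : z.1 < y.1 := hz'
    exact (succ_le_of_lt h h2).not_gt h3
  · intro h
    have h1 : x.1 < y.1 := h.1
    obtain ⟨z, hz, hzy⟩ := exists_succ_le h1
    rcases eq_or_lt_of_le hzy with rfl | hzy
    · exact hz
    · have h2 : x < (⟨z, x.2.trans (lt_of_succ hz).le⟩ : Chain μ) := lt_of_succ hz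
      exact (h.2 h2 hzy).elim

/-- The chains as intervals. -/
noncomputable def Chain.equivFin (μ : C.MinSide) : Fin (Fintype.card (Chain μ)) ≃o Chain μ :=
  Fintype.orderIsoFinOfCardEq _ rfl

theorem Chain.succ_equivFin_iff {μ : C.MinSide} (i j : Fin (Fintype.card (Chain μ))) :
    C.succ (Chain.equivFin μ i).1 = some (Chain.equivFin μ j).1 ↔ i.1 + 1 = j.1 := by
  rw [Chain.succ_eq_some_iff, apply_covBy_apply_iff, Fin.covBy_iff, Nat.covBy_iff_add_one_eq]

/-- A connected side system is the side system of a marked surface: its `∘`-polygons are the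
chains. -/
theorem Connected.exists_markedSurface (h : C.Connected) :
    ∃ S : MarkedSurface, Nonempty (Iso S.system C) := by
  classical
  have := Fintype.ofFinite C.MinSide
  let s : ℕ := Fintype.card C.MinSide
  let o : Fin s ≃ C.MinSide := (Fintype.equivFin _).symm
  let m : Fin s → ℕ := fun j => Fintype.card (Chain (o j))
  let f : (Σ j, Fin (m j)) → C.Side := fun x => (Chain.equivFin (o x.1) x.2).1
  have hf : Function.Bijective f := by
    constructor
    · rintro ⟨j, x⟩ ⟨j', x'⟩ hx
      have h1 : (o j).1 ≤ f ⟨j, x⟩ := (Chain.equivFin (o j) x).2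
      have h2 : (o j').1 ≤ f ⟨j', x'⟩ := (Chain.equivFin (o j') x').2
      rw [← hx] at h2
      obtain rfl : j = j' := o.injective (MinSide.le_antisymm h1 h2)
      have h3 : x = x' := (Chain.equivFin (o j)).injective (Subtype.ext hx)
      rw [h3]
    · intro x
      obtain ⟨μ, hμ⟩ := exists_minSide_le x
      obtain ⟨j, rfl⟩ := o.surjective μ
      refine ⟨⟨j, (Chain.equivFin (o j)).symm ⟨x, hμ⟩⟩, ?_⟩
      simp [f]
  let ψ : (Σ j, Fin (m j)) ≃ C.Side := Equiv.ofBijective f hf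
  have hsucc : ∀ j i i', C.succ (ψ ⟨j, i⟩) = some (ψ ⟨j, i'⟩) ↔ i.1 + 1 = i'.1 := fun j i i' =>
    Chain.succ_equivFin_iff i i'
  have hsame : ∀ e e', C.succ (ψ e) = some (ψ e') → e.1 = e'.1 := by
    intro e e' he
    have h1 : (o e.1).1 ≤ ψ e' := (Chain.equivFin (o e.1) e.2).2.trans (lt_of_succ he).le
    exact o.injective (MinSide.le_antisymm h1 (Chain.equivFin (o e'.1) e'.2).2)
  have hpos : ∀ j, 0 < m j := fun j => Fintype.card_pos_iff.2 ⟨⟨(o j).1, le_rfl⟩⟩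
  have hconn : ∀ x y, Relation.EqvGen (fun x y => y = C.inv x ∨ C.succ x = some y) x y →
      Relation.EqvGen (fun a b => ∃ i i', ψ.symm (C.inv (ψ ⟨a, i⟩)) = ⟨b, i'⟩)
        (ψ.symm x).1 (ψ.symm y).1 := by
    intro x y hxy
    induction hxy with
    | rel x y hxy =>
      rcases hxy with rfl | hxy
      · refine .rel _ _ ⟨(ψ.symm x).2, (ψ.symm (C.inv x)).2, ?_⟩
        simp
      · have h1 := hsame (ψ.symm x) (ψ.symm y) (by simpa using hxy)
        rw [h1]
        exact .refl _
    | refl x => exact .refl _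
    | symm x y _ ih => exact .symm _ _ ih
    | trans x y z _ _ ih ih' => exact .trans _ _ _ ih ih'
  obtain ⟨x₀⟩ := h.1
  let S : MarkedSurface :=
    { s := s
      m := m
      m_pos := hpos
      glue := fun e => ψ.symm (C.inv (ψ e))
      glue_glue := fun e => by simp
      glue_ne := fun e he => C.inv_ne (ψ e) (by rwa [Equiv.symm_apply_eq] at he)
      s_pos := Fintype.card_pos_iff.2 ((exists_minSide_le x₀).imp fun _ _ => trivial).nonempty
      connected := fun j j' => by
        have h1 := hconn _ _ (h.2 (ψ ⟨j, ⟨0, hpos j⟩⟩) (ψ ⟨j', ⟨0, hpos j'⟩⟩))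
        simpa using h1 }
  refine ⟨S, ⟨⟨ψ, fun e => ψ.apply_symm_apply _, ?_⟩⟩⟩
  rintro ⟨j, i⟩
  change (S.succ ⟨j, i⟩).map ψ = C.succ (ψ ⟨j, i⟩)
  by_cases hi : i.1 + 1 < m j
  · have h1 : S.succ ⟨j, i⟩ = some ⟨j, ⟨i.1 + 1, hi⟩⟩ := dif_pos hi
    rw [h1]
    exact ((hsucc j i ⟨i.1 + 1, hi⟩).2 rfl).symm
  · have h1 : S.succ ⟨j, i⟩ = none := dif_neg hi
    rw [h1, Option.map_none]
    cases h2 : C.succ (ψ ⟨j, i⟩) with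
    | none => rfl
    | some y =>
      obtain ⟨⟨j', i'⟩, rfl⟩ := ψ.surjective y
      obtain rfl : j = j' := hsame _ _ h2
      exact (hi (((hsucc j i i').1 h2).symm ▸ i'.2)).elim

/-- The side system `C.cma` is connected if `C` is. -/
theorem Connected.cma (h : C.Connected) : C.cma.Connected := by
  refine ⟨h.1.map oldSide, ?_⟩
  have hold : ∀ x y, Relation.EqvGen (fun x y => y = C.inv x ∨ C.succ x = some y) x y →
      Relation.EqvGen (fun x y => y = C.cma.inv x ∨ C.cma.succ x = some y)
        (oldSide x) (oldSide y) := by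
    intro x y hxy
    induction hxy with
    | rel x y hxy =>
      rcases hxy with rfl | hxy
      · exact .rel _ _ (Or.inl rfl)
      · obtain ⟨e, rfl⟩ : ∃ e, x = C.inv e := ⟨C.inv x, (C.inv_inv x).symm⟩
        by_cases he : C.Inf e
        · exact .trans _ _ _ (.rel _ _ (Or.inr (cma_succ_old he)))
            (.rel _ _ (Or.inr (cma_succ_new he hxy)))
        · refine .rel _ _ (Or.inr ?_)
          rw [cma_succ_old_of_not he, next, hxy]
          rfl
    | refl x => exact .refl _
    | symm x y _ ih => exact .symm _ _ ih
    | trans x y z _ _ ih ih' => exact .trans _ _ _ ih ih'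
  have hnew : ∀ a, ∃ x, Relation.EqvGen (fun x y => y = C.cma.inv x ∨ C.cma.succ x = some y)
      (oldSide x) a := by
    intro a
    obtain ⟨x, rfl⟩ | ⟨e, rfl⟩ | ⟨e, rfl⟩ := cma_cases a
    · exact ⟨x, .refl _⟩
    · exact ⟨_, .rel _ _ (Or.inr (cma_succ_old e.2))⟩
    · exact ⟨_, .trans _ _ _ (.rel _ _ (Or.inr (cma_succ_old e.2))) (.rel _ _ (Or.inl rfl))⟩
  intro a b
  obtain ⟨x, hx⟩ := hnew a
  obtain ⟨y, hy⟩ := hnew b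
  exact .trans _ _ _ (.symm _ _ hx) (.trans _ _ _ (hold x y (h.2 x y)) hy)

end SideSystem

namespace MarkedSurface

variable {k : Type u} [Field k] {A : Type v} [Ring A] [Algebra k A]

/-- The algebra of a marked surface is the matrix algebra of its side system. -/
theorem isSurfaceOf_of_iso {C : SideSystem} (S : MarkedSurface)
    (φ : SideSystem.Iso S.system C) (ρ : A ≃ₐ[k] C.matAlg k) : S.IsSurfaceOf k A :=
  ⟨((S.presents.transport φ).algEquiv k).trans ρ.symm⟩

/-- An algebra with a connected side system has a marked surface. -/
theorem exists_isSurfaceOf {C : SideSystem} (h : C.Connected) (ρ : A ≃ₐ[k] C.matAlg k) :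
    ∃ S : MarkedSurface, S.IsSurfaceOf k A := by
  obtain ⟨S, ⟨φ⟩⟩ := h.exists_markedSurface
  exact ⟨S, S.isSurfaceOf_of_iso φ ρ⟩

/-- A marked surface of `A^CMA` has the sides of `𝐒^CMA`, for every marked surface `𝐒` of `A`. -/
theorem nonempty_iso_cma {S S' : MarkedSurface} (h : S.IsSurfaceOf k A)
    (h' : S'.IsSurfaceOf k (CMAuslander A)) : Nonempty (SideSystem.Iso S'.system S.system.cma) := by
  obtain ⟨φ⟩ := h
  obtain ⟨φ'⟩ := h'
  obtain ⟨χ⟩ := SideSystem.nonempty_cmAuslander_equiv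
    (φ.symm.trans (S.presents.algEquiv k))
  exact SideSystem.nonempty_iso (((S'.presents.algEquiv k).symm.trans φ').trans χ)

end MarkedSurface

/-! ### The subdivision of a square into three squares -/

namespace Subdivision

/-- The projection of the real line onto the unit interval. -/
noncomputable def clamp (r : ℝ) : I := Set.projIcc 0 1 zero_le_one r

theorem coe_clamp {r : ℝ} (h : 0 ≤ r) (h' : r ≤ 1) : (clamp r : ℝ) = r :=
  congrArg Subtype.val (Set.projIcc_of_mem zero_le_one ⟨h, h'⟩)

theorem clamp_eq {r : ℝ} {x : I} (h : r = x) : clamp r = x := by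
  rw [h]
  exact Set.projIcc_val zero_le_one x

@[fun_prop] theorem continuous_clamp : Continuous clamp :=
  continuous_projIcc (h := zero_le_one)

/-- The reflection of the square at its vertical axis. -/
def flip (p : I × I) : I × I := (unitInterval.symm p.1, p.2)

@[simp] theorem flip_flip (p : I × I) : flip (flip p) = p := by simp [flip]

@[fun_prop] theorem continuous_flip : Continuous flip := by unfold flip; fun_prop

/-- The square as the triangle `3 x ≤ y`, whose left side is the image of the lower edge, directed
downwards. -/
noncomputable def left (p : I × I) : I × I :=
  (clamp ((p.2 + max 0 ((p.1 : ℝ) + p.2 - 1)) / 6), clamp (max (1 - (p.1 : ℝ)) p.2))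

/-- The inverse of `left`. -/
noncomputable def leftInv (p : I × I) : I × I :=
  (clamp (1 - p.2 + max 0 (6 * (p.1 : ℝ) - p.2)), clamp (min (6 * (p.1 : ℝ)) p.2))

/-- The square as the trapezium `y / 3 ≤ x ≤ 1 - y / 3`. -/
noncomputable def middle (p : I × I) : I × I := (clamp (p.1 + p.2 * (1 - 2 * p.1) / 3), p.2)

/-- The inverse of `middle`. -/
noncomputable def middleInv (p : I × I) : I × I :=
  (clamp ((p.1 - p.2 / 3) / (1 - 2 * p.2 / 3)), p.2)

/-- The square as the triangle `3 (1 - x) ≤ y`, whose right side is the image of the lower edge,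
directed upwards. -/
noncomputable def right (p : I × I) : I × I := flip (left (flip p))

/-- The inverse of `right`. -/
noncomputable def rightInv (p : I × I) : I × I := flip (leftInv (flip p))

@[fun_prop] theorem continuous_left : Continuous left := by unfold left; fun_prop

@[fun_prop] theorem continuous_leftInv : Continuous leftInv := by unfold leftInv; fun_prop

@[fun_prop] theorem continuous_middle : Continuous middle := by unfold middle; fun_prop

theorem denominator_pos (p : I × I) : (0 : ℝ) < 1 - 2 * p.2 / 3 := by
  have := p.2.2.2
  linarith

@[fun_prop] theorem continuous_middleInv : Continuous middleInv := by
  have h : Continuous fun p : I × I => ((p.1 : ℝ) - p.2 / 3) / (1 - 2 * p.2 / 3) :=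
    Continuous.div (by fun_prop) (by fun_prop) fun p => (denominator_pos p).ne'
  exact (continuous_clamp.comp h).prodMk continuous_snd

@[fun_prop] theorem continuous_right : Continuous right := by unfold right; fun_prop

@[fun_prop] theorem continuous_rightInv : Continuous rightInv := by unfold rightInv; fun_prop

theorem left_coe (p : I × I) : ((left p).1 : ℝ) = (p.2 + max 0 ((p.1 : ℝ) + p.2 - 1)) / 6 ∧
    ((left p).2 : ℝ) = max (1 - (p.1 : ℝ)) p.2 := by
  obtain ⟨⟨x, hx0, hx1⟩, y, hy0, hy1⟩ := p
  constructor
  · refine coe_clamp ?_ ?_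
    · have := le_max_left 0 (x + y - 1)
      simp only
      linarith
    · have : max 0 (x + y - 1) ≤ 1 := max_le zero_le_one (by linarith)
      simp only
      linarith
  · exact coe_clamp (le_max_of_le_right hy0) (max_le (by simp only; linarith) hy1)

theorem leftInv_coe {p : I × I} (h : 3 * (p.1 : ℝ) ≤ p.2) :
    ((leftInv p).1 : ℝ) = 1 - p.2 + max 0 (6 * (p.1 : ℝ) - p.2) ∧
      ((leftInv p).2 : ℝ) = min (6 * (p.1 : ℝ)) p.2 := by
  obtain ⟨⟨x, hx0, hx1⟩, y, hy0, hy1⟩ := p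
  simp only at h
  constructor
  · refine coe_clamp ?_ ?_
    · have := le_max_left 0 (6 * x - y)
      simp only
      linarith
    · have : max 0 (6 * x - y) ≤ y := max_le hy0 (by linarith)
      simp only
      linarith
  · refine coe_clamp (le_min ?_ hy0) (min_le_of_right_le hy1)
    simp only
    linarith

theorem middle_coe (p : I × I) : ((middle p).1 : ℝ) = p.1 + p.2 * (1 - 2 * p.1) / 3 := by
  obtain ⟨⟨x, hx0, hx1⟩, y, hy0, hy1⟩ := p
  refine coe_clamp ?_ ?_ <;> simp only <;> nlinarith

theorem middleInv_coe {p : I × I} (h : (p.2 : ℝ) ≤ 3 * p.1) (h' : (p.2 : ℝ) ≤ 3 * (1 - p.1)) :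
    ((middleInv p).1 : ℝ) = (p.1 - p.2 / 3) / (1 - 2 * p.2 / 3) := by
  refine coe_clamp (div_nonneg (by linarith) (denominator_pos p).le) ?_
  rw [div_le_one (denominator_pos p)]
  linarith

theorem left_mem (p : I × I) : 3 * ((left p).1 : ℝ) ≤ (left p).2 := by
  rw [(left_coe p).1, (left_coe p).2]
  obtain ⟨⟨x, hx0, hx1⟩, y, hy0, hy1⟩ := p
  simp only
  rcases le_total (x + y) 1 with h | h
  · rw [max_eq_left (by linarith), max_eq_left (by linarith)]
    linarith
  · rw [max_eq_right (by linarith), max_eq_right (by linarith)]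
    linarith

theorem middle_mem (p : I × I) : ((middle p).2 : ℝ) ≤ 3 * (middle p).1 ∧
    ((middle p).2 : ℝ) ≤ 3 * (1 - (middle p).1) := by
  rw [middle_coe]
  obtain ⟨⟨x, hx0, hx1⟩, y, hy0, hy1⟩ := p
  simp only [middle]
  constructor <;> nlinarith

theorem right_mem (p : I × I) : 3 * (1 - ((right p).1 : ℝ)) ≤ (right p).2 := by
  have := left_mem (flip p)
  simpa [right, flip] using this

theorem leftInv_left (p : I × I) : leftInv (left p) = p := by
  obtain ⟨h1, h2⟩ := left_coe p
  obtain ⟨⟨x, hx0, hx1⟩, y, hy0, hy1⟩ := p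
  simp only at h1 h2
  rcases le_total (x + y) 1 with h | h
  · rw [max_eq_left (by linarith)] at h1 h2
    refine Prod.ext (clamp_eq ?_) (clamp_eq ?_) <;> rw [h1, h2] <;> simp only
    · rw [max_eq_left (by linarith)]; ring
    · rw [min_eq_left (by linarith)]; ring
  · rw [max_eq_right (by linarith)] at h1 h2
    refine Prod.ext (clamp_eq ?_) (clamp_eq ?_) <;> rw [h1, h2] <;> simp only
    · rw [max_eq_right (by linarith)]; ring
    · rw [min_eq_right (by linarith)]

theorem left_leftInv {p : I × I} (h : 3 * (p.1 : ℝ) ≤ p.2) : left (leftInv p) = p := by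
  obtain ⟨h1, h2⟩ := leftInv_coe h
  obtain ⟨⟨x, hx0, hx1⟩, y, hy0, hy1⟩ := p
  simp only at h h1 h2
  refine Prod.ext (clamp_eq ?_) (clamp_eq ?_) <;> rw [h1, h2] <;> simp only
  all_goals
    rcases le_total (6 * x) y with h3 | h3
    · rw [max_eq_left (a := 0) (b := 6 * x - y) (by linarith), min_eq_left h3]
      rw [max_eq_left (by linarith)]; ring
    · rw [max_eq_right (a := 0) (b := 6 * x - y) (by linarith), min_eq_right h3]
      rw [max_eq_right (by linarith)]; try ring

theorem middleInv_middle (p : I × I) : middleInv (middle p) = p := by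
  refine Prod.ext (clamp_eq ?_) rfl
  rw [middle_coe]
  have h := denominator_pos p
  change _ / (1 - 2 * (p.2 : ℝ) / 3) = _
  rw [div_eq_iff h.ne']
  change _ - (p.2 : ℝ) / 3 = _
  ring

theorem middle_middleInv {p : I × I} (h : (p.2 : ℝ) ≤ 3 * p.1)
    (h' : (p.2 : ℝ) ≤ 3 * (1 - p.1)) : middle (middleInv p) = p := by
  refine Prod.ext (clamp_eq ?_) rfl
  rw [middleInv_coe h h']
  have h := denominator_pos p
  change _ + (p.2 : ℝ) * _ / 3 = _
  have h1 := div_mul_cancel₀ ((p.1 : ℝ) - p.2 / 3) h.ne'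
  linear_combination h1

theorem rightInv_right (p : I × I) : rightInv (right p) = p := by
  simp [rightInv, right, leftInv_left]

theorem right_rightInv {p : I × I} (h : 3 * (1 - (p.1 : ℝ)) ≤ p.2) : right (rightInv p) = p := by
  rw [right, rightInv, flip_flip, left_leftInv, flip_flip]
  simpa [flip] using h

theorem left_lower (x : I) : left (x, 0) = (0, unitInterval.symm x) := by
  refine Prod.ext (clamp_eq ?_) (clamp_eq ?_)
  · have := x.2.2
    simpa using this
  · have := x.2.2
    simpa using this

theorem left_right_edge (y : I) : left (1, y) = middle (0, y) := by
  refine Prod.ext (Subtype.ext ?_) (clamp_eq ?_)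
  · rw [(left_coe _).1, middle_coe]
    have := y.2.1
    simp [this]
    ring
  · change max (1 - (1 : ℝ)) y = y
    rw [sub_self, max_eq_right y.2.1]

theorem middle_lower (x : I) : middle (x, 0) = (x, 0) :=
  Prod.ext (clamp_eq (by simp)) rfl

theorem flip_middle (p : I × I) : flip (middle p) = middle (flip p) := by
  refine Prod.ext (Subtype.ext ?_) rfl
  change 1 - ((middle p).1 : ℝ) = _
  rw [middle_coe, middle_coe]
  simp only [flip, unitInterval.coe_symm_eq]
  ring

theorem right_lower (x : I) : right (x, 0) = (1, x) := by
  have h : flip (x, 0) = (unitInterval.symm x, 0) := rfl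
  rw [right, h, left_lower]
  simp [flip]

theorem right_left_edge (y : I) : right (0, y) = middle (1, y) := by
  have h : flip (0, y) = (1, y) := by simp [flip]
  rw [right, h, left_right_edge, flip_middle]
  simp [flip]

theorem leftInv_of_eq {p : I × I} (h : 3 * (p.1 : ℝ) = p.2) : leftInv p = (1, p.2) := by
  have := p.2.2.1
  refine Prod.ext (clamp_eq ?_) (clamp_eq ?_)
  · rw [max_eq_right (by linarith)]
    change _ = (1 : ℝ)
    linarith
  · exact min_eq_right (by linarith)

theorem middleInv_of_eq {p : I × I} (h : 3 * (p.1 : ℝ) = p.2) : middleInv p = (0, p.2) := by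
  refine Prod.ext (clamp_eq ?_) rfl
  rw [← h]
  simp

theorem rightInv_of_eq {p : I × I} (h : 3 * (1 - (p.1 : ℝ)) = p.2) : rightInv p = (0, p.2) := by
  rw [rightInv, leftInv_of_eq (by simpa [flip] using h)]
  simp [flip]

theorem middleInv_of_eq' {p : I × I} (h : 3 * (1 - (p.1 : ℝ)) = p.2) :
    middleInv p = (1, p.2) := by
  refine Prod.ext (clamp_eq ?_) rfl
  rw [div_eq_iff (denominator_pos p).ne']
  change _ = (1 : ℝ) * _
  linarith

end Subdivision

/-! ### The homeomorphism of a surface of `A^CMA` onto `𝐒^CMA` -/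

namespace MarkedSurface

open SideSystem Subdivision

theorem point_arc (S : MarkedSurface) (e : S.Side) (x : I) :
    S.point e (x, 0) = S.point (S.glue e) (unitInterval.symm x, 0) := Quot.sound (.arc e x)

theorem point_end (S : MarkedSurface) (e : S.Side) :
    S.point e (1, 0) = S.point (S.glue e) (0, 0) := by
  rw [point_arc, unitInterval.symm_one]

theorem point_polygon (S : MarkedSurface) {e f : S.Side} (h : S.next e = some f) (y : I) :
    S.point e (1, y) = S.point f (0, y) := Quot.sound (.polygon e f y h)

variable {S S' : MarkedSurface}

/-- The next side on an `∞`-elementary polygon. -/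
noncomputable def infNext (e : {e // S.system.Inf e}) : {e // S.system.Inf e} :=
  ⟨e.2.exists_next.choose, e.2.exists_next.choose_spec.2⟩

theorem next_eq_infNext (e : {e // S.system.Inf e}) : S.system.next e.1 = some (infNext e).1 :=
  e.2.exists_next.choose_spec.1

theorem exists_infNext_eq (e : {e // S.system.Inf e}) : ∃ f, infNext f = e := by
  obtain ⟨f, -, hf⟩ := Relation.TransGen.tail'_iff.1 e.2
  refine ⟨⟨f, e.2.of_next hf⟩, Subtype.ext (Option.some.inj ?_)⟩
  rw [← next_eq_infNext]
  exact hf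

/-- The previous side on an `∞`-elementary polygon. -/
noncomputable def infPrev (e : {e // S.system.Inf e}) : {e // S.system.Inf e} :=
  (exists_infNext_eq e).choose

theorem infNext_infPrev (e : {e // S.system.Inf e}) : infNext (infPrev e) = e :=
  (exists_infNext_eq e).choose_spec

theorem infPrev_infNext (e : {e // S.system.Inf e}) : infPrev (infNext e) = e := by
  refine Subtype.ext (next_inj (next_eq_infNext _) ?_)
  rw [infNext_infPrev]
  exact next_eq_infNext e

theorem next_cma_old_of_not {e : S.Side} (h : ¬ S.system.Inf e) :
    S.system.cma.next (oldSide (C := S.system) e) = (S.system.next e).map oldSide :=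
  cma_succ_old_of_not (C := S.system) h

theorem next_cma_old (e : {e // S.system.Inf e}) :
    S.system.cma.next (oldSide e.1) = some (newSide e false) :=
  cma_succ_old e.2

theorem next_cma_true (e : {e // S.system.Inf e}) :
    S.system.cma.next (newSide e true) = some (oldSide (infNext e).1) :=
  cma_succ_new e.2 (next_eq_infNext e)

theorem next_cma_false (e : {e // S.system.Inf e}) :
    S.system.cma.next (newSide e false) = none := rfl

open Classical in
/-- The position of the squares of `𝐒^CMA` in the squares of `𝐒`: the square of a side `e` on an
`∞`-elementary polygon is subdivided into the squares of the new arc at the start of `e`, of `e`,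
and of the new arc at the end of `e`. -/
noncomputable def subdivide (S : MarkedSurface) (a : S.system.cma.Side) (p : I × I) : S.Surf :=
  match a with
  | Sum.inl e => S.point e (if S.system.Inf e then middle p else p)
  | Sum.inr (e, false) => S.point e.1 (right p)
  | Sum.inr (e, true) => S.point (infNext e).1 (left p)

theorem subdivide_of_not {e : S.Side} (h : ¬ S.system.Inf e) (p : I × I) :
    S.subdivide (oldSide (C := S.system) e) p = S.point e p :=
  congrArg (S.point e) (if_neg h)

theorem subdivide_old (e : {e // S.system.Inf e}) (p : I × I) :
    S.subdivide (oldSide e.1) p = S.point e.1 (middle p) :=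
  congrArg (S.point e.1) (if_pos e.2)

theorem subdivide_false (e : {e // S.system.Inf e}) (p : I × I) :
    S.subdivide (newSide e false) p = S.point e.1 (right p) := rfl

theorem subdivide_true (e : {e // S.system.Inf e}) (p : I × I) :
    S.subdivide (newSide e true) p = S.point (infNext e).1 (left p) := rfl

theorem subdivide_old_lower (e : S.Side) (x : I) :
    S.subdivide (oldSide (C := S.system) e) (x, 0) = S.point e (x, 0) := by
  by_cases h : S.system.Inf e
  · rw [subdivide_old ⟨e, h⟩, middle_lower]
  · rw [subdivide_of_not h]

theorem subdivide_false_lower (e : {e // S.system.Inf e}) (x : I) :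
    S.subdivide (newSide e false) (x, 0) = S.point e.1 (1, x) := by
  rw [subdivide_false, right_lower]

theorem subdivide_true_lower (e : {e // S.system.Inf e}) (x : I) :
    S.subdivide (newSide e true) (x, 0) = S.point e.1 (1, unitInterval.symm x) := by
  rw [subdivide_true, left_lower, S.point_polygon (next_eq_infNext e)]

theorem continuous_subdivide (a : S.system.cma.Side) : Continuous (S.subdivide a) := by
  obtain ⟨e, rfl⟩ | ⟨e, rfl⟩ | ⟨e, rfl⟩ := cma_cases a
  · by_cases h : S.system.Inf e
    · exact ((S.continuous_point e).comp continuous_middle).congr fun p =>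
        (subdivide_old ⟨e, h⟩ p).symm
    · exact (S.continuous_point e).congr fun p => (subdivide_of_not h p).symm
  · exact (S.continuous_point e.1).comp continuous_right
  · exact (S.continuous_point (infNext e).1).comp continuous_left

theorem subdivide_arc (a : S.system.cma.Side) (x : I) :
    S.subdivide a (x, 0) = S.subdivide (S.system.cma.inv a) (unitInterval.symm x, 0) := by
  obtain ⟨e, rfl⟩ | ⟨e, rfl⟩ | ⟨e, rfl⟩ := cma_cases a
  · exact (subdivide_old_lower e x).trans ((S.point_arc e x).trans
      (subdivide_old_lower (S.glue e) _).symm)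
  · refine (subdivide_false_lower e x).trans (Eq.trans ?_ (subdivide_true_lower e _).symm)
    rw [unitInterval.symm_symm]
  · exact (subdivide_true_lower e x).trans (subdivide_false_lower e _).symm

theorem subdivide_polygon {a b : S.system.cma.Side} (h : S.system.cma.next a = some b) (y : I) :
    S.subdivide a (1, y) = S.subdivide b (0, y) := by
  obtain ⟨e, rfl⟩ | ⟨e, rfl⟩ | ⟨e, rfl⟩ := cma_cases a
  · by_cases he : S.system.Inf e
    · obtain rfl := Option.some.inj ((next_cma_old ⟨e, he⟩).symm.trans h)
      rw [subdivide_old ⟨e, he⟩, subdivide_false, right_left_edge]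
    · rw [next_cma_old_of_not he] at h
      obtain ⟨f, hf, rfl⟩ := Option.map_eq_some_iff.1 h
      have hf' : ¬ S.system.Inf f := fun hf' => he (hf'.of_next hf)
      rw [subdivide_of_not he, subdivide_of_not hf', S.point_polygon hf]
  · rw [next_cma_false] at h
    cases h
  · obtain rfl := Option.some.inj ((next_cma_true e).symm.trans h)
    rw [subdivide_true, subdivide_old, left_right_edge]

variable (ψ : Iso S'.system S.system.cma)

/-- The map from a surface with the sides of `𝐒^CMA` to the surface of `𝐒`. -/
noncomputable def fromCMA : S'.Surf → S.Surf :=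
  Quot.lift (fun q => S.subdivide (ψ.toEquiv q.1) q.2) (by
    rintro _ _ (⟨e, x⟩ | ⟨e, f, y, h⟩)
    · have h1 : ψ.toEquiv (S'.glue e) = S.system.cma.inv (ψ.toEquiv e) := ψ.inv_apply e
      simp only [h1]
      exact subdivide_arc _ _
    · exact subdivide_polygon ((ψ.next_apply e).symm.trans (congrArg (Option.map ψ.toEquiv) h)) y)

theorem continuous_fromCMA : Continuous (fromCMA ψ) :=
  continuous_quot_lift _ (continuous_sigma fun e => continuous_subdivide (ψ.toEquiv e))

/-- The point with coordinates `p` in the square of the side of the surface `S'` which corresponds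
to the side `a` of `𝐒^CMA`. -/
def cmaPoint (a : S.system.cma.Side) (p : I × I) : S'.Surf := S'.point (ψ.toEquiv.symm a) p

theorem fromCMA_cmaPoint (a : S.system.cma.Side) (p : I × I) :
    fromCMA ψ (cmaPoint ψ a p) = S.subdivide a p := by
  change S.subdivide (ψ.toEquiv (ψ.toEquiv.symm a)) p = _
  rw [Equiv.apply_symm_apply]

theorem exists_cmaPoint (x : S'.Surf) : ∃ a p, cmaPoint ψ a p = x := by
  obtain ⟨⟨e, p⟩, rfl⟩ := Quot.exists_rep x
  exact ⟨ψ.toEquiv e, p, congrArg (S'.point · p) (ψ.toEquiv.symm_apply_apply e)⟩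

theorem continuous_cmaPoint (a : S.system.cma.Side) : Continuous (cmaPoint ψ a) :=
  S'.continuous_point _

theorem cmaPoint_arc (a : S.system.cma.Side) (x : I) :
    cmaPoint ψ a (x, 0) = cmaPoint ψ (S.system.cma.inv a) (unitInterval.symm x, 0) := by
  have h : ψ.toEquiv.symm (S.system.cma.inv a) = S'.glue (ψ.toEquiv.symm a) := ψ.symm.inv_apply a
  exact (S'.point_arc _ x).trans (congrArg (S'.point · (unitInterval.symm x, 0)) h.symm)

theorem cmaPoint_polygon {a b : S.system.cma.Side} (h : S.system.cma.next a = some b) (y : I) :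
    cmaPoint ψ a (1, y) = cmaPoint ψ b (0, y) := by
  refine S'.point_polygon ?_ y
  have h1 := ψ.symm.next_apply a
  rw [h] at h1
  exact h1.symm

open Classical in
/-- The map from a square of a side on an `∞`-elementary polygon of `𝐒` to a surface with the sides
of `𝐒^CMA`. -/
noncomputable def unsubdivide (e : {e // S.system.Inf e}) (p : I × I) : S'.Surf :=
  if 3 * (p.1 : ℝ) ≤ p.2 then cmaPoint ψ (newSide (infPrev e) true) (leftInv p)
  else if (p.2 : ℝ) ≤ 3 * (1 - p.1) then cmaPoint ψ (oldSide e.1) (middleInv p)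
  else cmaPoint ψ (newSide e false) (rightInv p)

theorem unsubdivide_left (e : {e // S.system.Inf e}) {p : I × I} (h : 3 * (p.1 : ℝ) ≤ p.2) :
    unsubdivide ψ e p = cmaPoint ψ (newSide (infPrev e) true) (leftInv p) := if_pos h

theorem unsubdivide_middle (e : {e // S.system.Inf e}) {p : I × I} (h : (p.2 : ℝ) ≤ 3 * p.1)
    (h' : (p.2 : ℝ) ≤ 3 * (1 - p.1)) :
    unsubdivide ψ e p = cmaPoint ψ (oldSide e.1) (middleInv p) := by
  rw [unsubdivide, if_pos h']
  split_ifs with h1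
  · have h2 := le_antisymm h1 h
    have h3 := next_cma_true (infPrev e)
    rw [infNext_infPrev] at h3
    rw [leftInv_of_eq h2, middleInv_of_eq h2, cmaPoint_polygon ψ h3]
  · rfl

theorem unsubdivide_right (e : {e // S.system.Inf e}) {p : I × I}
    (h : 3 * (1 - (p.1 : ℝ)) ≤ p.2) :
    unsubdivide ψ e p = cmaPoint ψ (newSide e false) (rightInv p) := by
  have hp := p.2.2.2
  rw [unsubdivide, if_neg (by linarith)]
  split_ifs with h1
  · have h2 := le_antisymm h h1
    rw [rightInv_of_eq h2, middleInv_of_eq' h2, cmaPoint_polygon ψ (next_cma_old e)]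
  · rfl

theorem continuous_unsubdivide (e : {e // S.system.Inf e}) : Continuous (unsubdivide ψ e) := by
  refine Continuous.if_le ((continuous_cmaPoint ψ _).comp continuous_leftInv)
    (Continuous.if_le ((continuous_cmaPoint ψ _).comp continuous_middleInv)
      ((continuous_cmaPoint ψ _).comp continuous_rightInv) (by fun_prop) (by fun_prop) ?_)
    (by fun_prop) (by fun_prop) ?_
  · intro p hp
    rw [← unsubdivide_right ψ e hp.ge]
    by_cases h : (p.2 : ℝ) ≤ 3 * p.1
    · rw [← unsubdivide_middle ψ e h hp.le]
    · have := p.2.2.2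
      linarith
  · intro p hp
    have := p.2.2.2
    have h : (p.2 : ℝ) ≤ 3 * (1 - p.1) := by linarith
    rw [if_pos h]
    exact (unsubdivide_left ψ e hp.le).symm.trans (unsubdivide_middle ψ e hp.ge h)

open Classical in
/-- The map from a square of `𝐒` to a surface with the sides of `𝐒^CMA`. -/
noncomputable def toCMASquare (e : S.Side) (p : I × I) : S'.Surf :=
  if h : S.system.Inf e then unsubdivide ψ ⟨e, h⟩ p else cmaPoint ψ (oldSide (C := S.system) e) p

theorem toCMASquare_of_inf (e : {e // S.system.Inf e}) (p : I × I) :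
    toCMASquare ψ e.1 p = unsubdivide ψ e p := dif_pos e.2

theorem toCMASquare_of_not {e : S.Side} (h : ¬ S.system.Inf e) (p : I × I) :
    toCMASquare ψ e p = cmaPoint ψ (oldSide (C := S.system) e) p := dif_neg h

theorem toCMASquare_lower (e : S.Side) (x : I) :
    toCMASquare ψ e (x, 0) = cmaPoint ψ (oldSide (C := S.system) e) (x, 0) := by
  by_cases h : S.system.Inf e
  · have hx := x.2
    have h0 : (((x, 0) : I × I).2 : ℝ) ≤ 3 * (x : ℝ) := by
      have := hx.1
      simpa using this
    have h1 : (((x, 0) : I × I).2 : ℝ) ≤ 3 * (1 - (x : ℝ)) := by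
      have := hx.2
      simpa using this
    refine (toCMASquare_of_inf ψ ⟨e, h⟩ _).trans ((unsubdivide_middle ψ _ h0 h1).trans ?_)
    rw [← middle_lower x, middleInv_middle, middle_lower]
  · exact toCMASquare_of_not ψ h _

/-- The map from the surface of `𝐒` to a surface with the sides of `𝐒^CMA`. -/
noncomputable def toCMA : S.Surf → S'.Surf :=
  Quot.lift (fun q => toCMASquare ψ q.1 q.2) (by
    rintro _ _ (⟨e, x⟩ | ⟨e, f, y, h⟩)
    · simp only [toCMASquare_lower]
      exact cmaPoint_arc ψ _ _
    · by_cases he : S.system.Inf e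
      · obtain rfl : (infNext ⟨e, he⟩).1 = f :=
          Option.some.inj ((next_eq_infNext ⟨e, he⟩).symm.trans h)
        have hy := y.2.1
        refine (toCMASquare_of_inf ψ ⟨e, he⟩ _).trans
          (Eq.trans ?_ (toCMASquare_of_inf ψ _ _).symm)
        -- both sides are points of the new arc at the end of `e`
        rw [unsubdivide_right ψ _ (by simpa using hy), unsubdivide_left ψ _ (by simpa using hy),
          infPrev_infNext]
        have h1 : ((1, y) : I × I) = right (y, 0) := (right_lower y).symm
        have h2 : ((0, y) : I × I) = left (unitInterval.symm y, 0) := by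
          rw [left_lower, unitInterval.symm_symm]
        rw [h1, h2, rightInv_right, leftInv_left]
        exact cmaPoint_arc ψ _ _
      · have hf : ¬ S.system.Inf f := fun hf => he (hf.of_next h)
        refine (toCMASquare_of_not ψ he _).trans
          (Eq.trans (cmaPoint_polygon ψ ?_ y) (toCMASquare_of_not ψ hf _).symm)
        rw [next_cma_old_of_not he]
        exact congrArg (Option.map _) h)

theorem continuous_toCMA : Continuous (toCMA ψ) := by
  refine continuous_quot_lift _ (continuous_sigma fun e => ?_)
  by_cases h : S.system.Inf e
  · exact (continuous_unsubdivide ψ ⟨e, h⟩).congr fun p => (toCMASquare_of_inf ψ ⟨e, h⟩ p).symm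
  · exact (continuous_cmaPoint ψ _).congr fun p => (toCMASquare_of_not ψ h p).symm

theorem toCMA_fromCMA (x : S'.Surf) : toCMA ψ (fromCMA ψ x) = x := by
  obtain ⟨a, p, rfl⟩ := exists_cmaPoint ψ x
  rw [fromCMA_cmaPoint]
  obtain ⟨e, rfl⟩ | ⟨e, rfl⟩ | ⟨e, rfl⟩ := cma_cases a
  · by_cases h : S.system.Inf e
    · rw [subdivide_old ⟨e, h⟩]
      refine (toCMASquare_of_inf ψ ⟨e, h⟩ _).trans ?_
      rw [unsubdivide_middle ψ _ (middle_mem p).1 (middle_mem p).2, middleInv_middle]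
    · rw [subdivide_of_not h]
      exact toCMASquare_of_not ψ h p
  · refine (toCMASquare_of_inf ψ e _).trans ?_
    rw [unsubdivide_right ψ _ (right_mem p), rightInv_right]
  · refine (toCMASquare_of_inf ψ (infNext e) _).trans ?_
    rw [unsubdivide_left ψ _ (left_mem p), leftInv_left, infPrev_infNext]

theorem fromCMA_toCMA (x : S.Surf) : fromCMA ψ (toCMA ψ x) = x := by
  obtain ⟨⟨e, p⟩, rfl⟩ := Quot.exists_rep x
  change fromCMA ψ (toCMASquare ψ e p) = S.point e p
  by_cases h : S.system.Inf e
  · rw [toCMASquare_of_inf ψ ⟨e, h⟩]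
    rcases le_total (3 * (p.1 : ℝ)) p.2 with h1 | h1
    · rw [unsubdivide_left ψ _ h1, fromCMA_cmaPoint, subdivide_true, left_leftInv h1,
        infNext_infPrev]
    · rcases le_total (p.2 : ℝ) (3 * (1 - p.1)) with h2 | h2
      · rw [unsubdivide_middle ψ _ h1 h2, fromCMA_cmaPoint, subdivide_old, middle_middleInv h1 h2]
      · rw [unsubdivide_right ψ _ h2, fromCMA_cmaPoint, subdivide_false, right_rightInv h2]
  · rw [toCMASquare_of_not ψ h, fromCMA_cmaPoint, subdivide_of_not h]

/-- A surface with the sides of `𝐒^CMA` is homeomorphic to the surface of `𝐒`. -/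
noncomputable def cmaHomeomorph : S'.Surf ≃ₜ S.Surf where
  toFun := fromCMA ψ
  invFun := toCMA ψ
  left_inv := toCMA_fromCMA ψ
  right_inv := fromCMA_toCMA ψ
  continuous_toFun := continuous_fromCMA ψ
  continuous_invFun := continuous_toCMA ψ

/-- The homeomorphism maps the arcs onto the arcs of `𝐒^CMA`. -/
theorem cmaHomeomorph_curve (e : S'.Side) (x : I) :
    cmaHomeomorph ψ (S'.point e (x, 0)) = S.cma.curve (ψ.toEquiv e) x := by
  change S.subdivide (ψ.toEquiv e) (x, 0) = _
  obtain ⟨f, hf⟩ | ⟨f, hf⟩ | ⟨f, hf⟩ := cma_cases (ψ.toEquiv e) <;> rw [hf]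
  · exact subdivide_old_lower f x
  · exact subdivide_false_lower f x
  · exact subdivide_true_lower f x

theorem image_marked : cmaHomeomorph ψ '' S'.toArcSurface.marked = S.cma.marked := by
  have h : ∀ a, (∃ e, S.subdivide a (0, 0) = S.point e (0, 0)) ∨
      ∃ e, S.OnInfinityPolygon e ∧ S.subdivide a (0, 0) = S.point e (1, 1) := by
    intro a
    obtain ⟨e, rfl⟩ | ⟨e, rfl⟩ | ⟨e, rfl⟩ := cma_cases a
    · exact Or.inl ⟨e, subdivide_old_lower e 0⟩
    · refine Or.inl ⟨S.glue e.1, ?_⟩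
      exact (subdivide_false_lower e 0).trans (S.point_end e.1)
    · refine Or.inr ⟨e.1, e.2, ?_⟩
      rw [subdivide_true_lower, unitInterval.symm_zero]
  ext x
  constructor
  · rintro ⟨_, ⟨e, rfl⟩, rfl⟩
    exact h (ψ.toEquiv e)
  · have key : ∀ a, S.subdivide a (0, 0) ∈ cmaHomeomorph ψ '' S'.toArcSurface.marked := fun a =>
      ⟨cmaPoint ψ a (0, 0), ⟨_, rfl⟩, fromCMA_cmaPoint ψ a (0, 0)⟩
    rintro (⟨e, rfl⟩ | ⟨e, he, rfl⟩)
    · rw [← subdivide_old_lower]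
      exact key _
    · have h1 := subdivide_true_lower (S := S) ⟨e, he⟩ 0
      rw [unitInterval.symm_zero] at h1
      rw [← h1]
      exact key _

include ψ in
/-- A marked surface with the sides of `𝐒^CMA` is homotopic to `𝐒^CMA`. -/
theorem homotopic_cma : ArcSurface.Homotopic S'.toArcSurface S.cma := by
  refine ⟨cmaHomeomorph ψ, ψ.toEquiv, image_marked ψ, fun e => ?_, fun e => ?_, fun e => ?_⟩
  · refine (ψ.inv_apply e).trans ?_
    rcases ψ.toEquiv e with f | ⟨f, b⟩ <;> rfl
  · exact (ψ.next_apply e).trans (S.cma_next_eq _).symm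
  · let H : S'.toArcSurface.Surf ≃ₜ S.cma.Surf := cmaHomeomorph ψ
    have h : (H : C(S'.toArcSurface.Surf, S.cma.Surf)).comp (S'.toArcSurface.curve e) =
        S.cma.curve (ψ.toEquiv e) :=
      ContinuousMap.ext fun x => cmaHomeomorph_curve ψ e x
    change ContinuousMap.HomotopicRel
      ((H : C(S'.toArcSurface.Surf, S.cma.Surf)).comp (S'.toArcSurface.curve e)) _ _
    rw [h]
    exact ContinuousMap.HomotopicRel.refl _

end MarkedSurface

/-! ### The marked surfaces of a gentle algebra and of its Cohen–Macaulay–Auslander algebra -/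

theorem proposition3p2 {k : Type u} [Field k] :
    (∀ (A : Type v) [Ring A] [Algebra k A], IsGentleAlgebra k A →
      (∃ S : MarkedSurface, S.IsSurfaceOf k A) ∧
      (∃ S' : MarkedSurface, S'.IsSurfaceOf k (CMAuslander A)) ∧
      ∀ S S' : MarkedSurface, S.IsSurfaceOf k A → S'.IsSurfaceOf k (CMAuslander A) →
        ArcSurface.Homotopic S'.toArcSurface S.cma) ∧
    (∀ S : MarkedSurface, Nonempty (CMAuslander (S.algebra k) ≃ₐ[k] S.cma.algebra k)) := by
  refine ⟨fun A _ _ hA => ?_, fun S => S.nonempty_cmAuslander_equiv k⟩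
  obtain ⟨Q, hQ, ⟨φ⟩⟩ := hA
  obtain ⟨C, ⟨P⟩⟩ := hQ.exists_presents
  have hC := P.connected hQ.connected
  have ρ := φ.trans (P.algEquiv k)
  obtain ⟨χ⟩ := SideSystem.nonempty_cmAuslander_equiv ρ
  refine ⟨MarkedSurface.exists_isSurfaceOf hC ρ, MarkedSurface.exists_isSurfaceOf hC.cma χ,
    fun S S' hS hS' => ?_⟩
  obtain ⟨ψ⟩ := MarkedSurface.nonempty_iso_cma hS hS'
  exact MarkedSurface.homotopic_cma ψ
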